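/- Let $d\ge 1$, write $Q_R=(-R/2,R/2)^d$, and let $\omega\subset\mathbb R^d$ be a connected, unbounded open set that is $1$-periodic (invariant under translation by $\mathbb Z^d$), with $\mathbb R^d\setminus\omega=\bigcup_k\overline{F_k}$, where each $F_k$ is a bounded Lipschitz domain with connected boundary and $\inf_{k\ne\ell}\operatorname{dist}(F_k,F_\ell)>0$. Put $F=\bigcup_kF_k$ and, for $t>0$, let $\Lambda_t=t$ on $F$ and $\Lambda_t=1$ on $\mathbb R^d\setminus F$. Let $\kappa_1,\kappa_2>0$. Let $A=(a_{ij}^{\alpha\beta}(x))$, $1\le i,j,\alpha,\beta\le d$, be a real, bounded, measurable, $1$-periodic tensor on $\mathbb R^d$ such that, for all $x$, $a_{ij}^{\alpha\beta}(x)=a_{ji}^{\beta\alpha}(x)=a_{\alpha j}^{i\beta}(x)$ and $\kappa_1|\xi|^2\le\sum_{i,j,\alpha,\beta} a_{ij}^{\alpha\beta}(x)\,\xi_i^\alpha\xi_j^\beta\le\kappa_2|\xi|^2$ for every symmetric matrix $\xi=(\xi_i^\alpha)\in\mathbb R^{d\times d}$. For $u,v$ with gradients $(\nabla u)_i^\alpha=\partial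 u^\alpha/\partial x_i$ write $A\nabla u\cdot\nabla v=\sum_{i,j,\alpha,\beta} a_{ij}^{\alpha\beta}\,\frac{\partial u^\beta}{\partial x_j}\,\frac{\partial v^\alpha}{\partial x_i}$. For an open set $\Omega$, a function $u\in H^1(\Omega;\mathbb R^d)$ is called a weak solution of $\mathcal L_\delta(u)=0$ in $\Omega$ - for $0<\delta<\infty$, if $\int_\Omega\Lambda_{\delta^2}A\nabla u\cdot\nabla v\,dx=0$ for all $v\in H^1_0(\Omega;\mathbb R^d)$ (that is, $-\operatorname{div}(\Lambda_{\delta^2}A\nabla u)=0$); - for $\delta=0$, if $\int_{\Omega\cap\omega}A\nabla u\cdot\nabla v\,dx=0$ for all $v\in H^1_0(\Omega;\mathbb R^d)$ and, in addition, $u$ is a weak solution of $\operatorname{div}(A\nabla u)=0$ in $\Omega\cap F$, i.e. $\int_{\Omega\cap F}A\nabla u\cdot\nabla v\,dx=0$ for all $v\in H^1_0(\Omega\cap F;\mathbb R^d)$. Then there is a constant $C>0$ depending only on $d$, $\kappa_1$, $\kappa_2$ and $\omega$ such that, for every such tensor $A$, every $0\le\delta<\infty$, every $R\ge4$ and every weak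 solution $u\in H^1(Q_{2R};\mathbb R^d)$ of $\mathcal L_\delta(u)=0$ in $Q_{2R}$, $$\int_{Q_R}|\nabla u|^2\,dx\le\frac{C(1+\delta^2)}{R^2}\int_{Q_{2R}}|u|^2\,dx .$$ In particular, the inequality is uniform for $\delta\in[0,1]$. -/

import Mathlib

open MeasureTheory Filter Topology

noncomputable section

namespace HighContrast

/-- Euclidean space of dimension `d`. -/
abbrev Rd (d : ℕ) : Type := EuclideanSpace ℝ (Fin d)

/-- The vector of `ℝᵈ` with the integer coordinates `z`. -/
def latticeVec {d : ℕ} (z : Fin d → ℤ) : Rd d := WithLp.toLp 2 (fun i => (z i : ℝ))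

/-- The open cube `(-R/2, R/2)ᵈ` of side length `R` centred at the origin. -/
def cube (d : ℕ) (R : ℝ) : Set (Rd d) := {x | ∀ i, -(R / 2) < x i ∧ x i < R / 2}

/-! ### Geometry of the matrix and of the inclusions -/

/-- The set `U` has Lipschitz boundary: near each boundary point there is a unit vector `ν` (the
vertical direction) such that `U` is locally the region above the graph of a Lipschitz function
`ψ` of the horizontal part `x - ⟪ν, x⟫ ν`. -/
def HasLipschitzBoundary {d : ℕ} (U : Set (Rd d)) : Prop :=
  ∀ z ∈ frontier U, ∃ (ν : Rd d) (r : ℝ) (K : NNReal) (ψ : Rd d → ℝ),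
    ‖ν‖ = 1 ∧ 0 < r ∧ LipschitzWith K ψ ∧
      ∀ x ∈ Metric.ball z r, x ∈ U ↔ ψ (x - inner ℝ ν x • ν) < inner ℝ ν x

/-- A bounded Lipschitz domain (a nonempty connected bounded open set with Lipschitz boundary)
whose boundary is connected. -/
structure IsInclusion {d : ℕ} (U : Set (Rd d)) : Prop where
  isOpen : IsOpen U
  isConnected : IsConnected U
  isBounded : Bornology.IsBounded U
  lipschitz : HasLipschitzBoundary U
  frontier_connected : IsConnected (frontier U)

/-- `ω` is a connected, unbounded, `1`-periodic open set whose complement is the union of the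
closures of the bounded Lipschitz domains `F k`, which have pairwise distances bounded below by a
positive constant (so that these closures are mutually disjoint). -/
structure IsPeriodicMatrix {d : ℕ} {ι : Type*} (ω : Set (Rd d)) (F : ι → Set (Rd d)) : Prop where
  isOpen : IsOpen ω
  isConnected : IsConnected ω
  unbounded : ¬ Bornology.IsBounded ω
  periodic : ∀ (z : Fin d → ℤ) (x : Rd d), x + latticeVec z ∈ ω ↔ x ∈ ω
  compl_eq : ωᶜ = ⋃ k, closure (F k)
  inclusion : ∀ k, IsInclusion (F k)
  separated : ∃ c : ℝ, 0 < c ∧ ∀ k l, k ≠ l → ∀ x ∈ F k, ∀ y ∈ F l, c ≤ dist x y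

/-! ### The coefficients -/

/-- Coefficient tensors on `ℝᵈ`; `A x i j α β` is the entry `a_{ij}^{αβ}(x)`. -/
abbrev Tensor (d : ℕ) : Type := Rd d → Fin d → Fin d → Fin d → Fin d → ℝ

/-- The bilinear form `a_{ij}^{αβ} ξ_j^β ζ_i^α` of one value of a tensor; the entry `ξ_i^α` of a
matrix is `ξ i α`. -/
def form {d : ℕ} (a : Fin d → Fin d → Fin d → Fin d → ℝ) (ξ ζ : Matrix (Fin d) (Fin d) ℝ) : ℝ :=
  ∑ i, ∑ j, ∑ α, ∑ β, a i j α β * ξ j β * ζ i α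

/-- The square of the Euclidean (Frobenius) norm of a matrix. -/
def normSq {d : ℕ} (ξ : Matrix (Fin d) (Fin d) ℝ) : ℝ := ∑ i, ∑ α, ξ i α ^ 2

/-- The tensor `A` is (Lebesgue) measurable, bounded, `1`-periodic, and satisfies the elasticity
condition with the constants `κ₁`, `κ₂`. -/
structure IsElasticityTensor {d : ℕ} (κ₁ κ₂ : ℝ) (A : Tensor d) : Prop where
  measurable : ∀ i j α β, AEMeasurable (fun x => A x i j α β) volume
  bounded : ∃ M : ℝ, ∀ x i j α β, |A x i j α β| ≤ M
  periodic : ∀ (z : Fin d → ℤ) (x : Rd d), A (x + latticeVec z) = A x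
  symm_major : ∀ x i j α β, A x i j α β = A x j i β α
  symm_minor : ∀ x i j α β, A x i j α β = A x α j i β
  lower : ∀ x (ξ : Matrix (Fin d) (Fin d) ℝ), ξ.IsSymm → κ₁ * normSq ξ ≤ form (A x) ξ ξ
  upper : ∀ x (ξ : Matrix (Fin d) (Fin d) ℝ), ξ.IsSymm → form (A x) ξ ξ ≤ κ₂ * normSq ξ

open Classical in
/-- The function `Λ_t`, equal to `t` on `F = ⋃ k, F k` and to `1` elsewhere. -/
def contrast {d : ℕ} {ι : Type*} (F : ι → Set (Rd d)) (t : ℝ) (x : Rd d) : ℝ :=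
  if x ∈ ⋃ k, F k then t else 1

/-! ### Sobolev spaces of vector fields -/

/-- Matrix fields on `ℝᵈ`; for the gradient of `u`, the entry `G x i α` is `∂u^α/∂x_i`. -/
abbrev MatrixField (d : ℕ) : Type := Rd d → Matrix (Fin d) (Fin d) ℝ

/-- The classical gradient of a differentiable vector field. -/
def classicalGrad {d : ℕ} (φ : Rd d → Rd d) : MatrixField d :=
  fun x => Matrix.of fun i α => (fderiv ℝ φ x (EuclideanSpace.single i 1)) α

/-- `φ` is smooth with compact support contained in `Ω`. -/
def IsTest {d : ℕ} {V : Type*} [NormedAddCommGroup V] [NormedSpace ℝ V]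
    (Ω : Set (Rd d)) (φ : Rd d → V) : Prop :=
  ContDiff ℝ ((⊤ : ℕ∞) : WithTop ℕ∞) φ ∧ HasCompactSupport φ ∧ tsupport φ ⊆ Ω

/-- `u ∈ H¹(Ω; ℝᵈ)`, with weak gradient `G`. -/
structure MemH1 {d : ℕ} (Ω : Set (Rd d)) (u : Rd d → Rd d) (G : MatrixField d) : Prop where
  memLp : MemLp u 2 (volume.restrict Ω)
  grad_memLp : ∀ i α, MemLp (fun x => G x i α) 2 (volume.restrict Ω)
  weak : ∀ i α, ∀ φ : Rd d → ℝ, IsTest Ω φ →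
    ∫ x in Ω, u x α * fderiv ℝ φ x (EuclideanSpace.single i 1) = - ∫ x in Ω, G x i α * φ x

/-- `v ∈ H¹₀(Ω; ℝᵈ)`, with weak gradient `G`: the field `v` is the limit in `H¹(Ω; ℝᵈ)` of
smooth vector fields with compact support in `Ω`. -/
structure MemH10 {d : ℕ} (Ω : Set (Rd d)) (v : Rd d → Rd d) (G : MatrixField d) : Prop where
  memH1 : MemH1 Ω v G
  approx : ∃ φ : ℕ → Rd d → Rd d, (∀ n, IsTest Ω (φ n)) ∧
    Tendsto (fun n => eLpNorm (fun x => φ n x - v x) 2 (volume.restrict Ω)) atTop (𝓝 0) ∧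
    ∀ i α, Tendsto (fun n => eLpNorm (fun x => classicalGrad (φ n) x i α - G x i α) 2
      (volume.restrict Ω)) atTop (𝓝 0)

/-! ### Weak solutions -/

/-- For `0 < δ < ∞`: the field `u ∈ H¹(Ω; ℝᵈ)` with weak gradient `G` is a weak solution of
`-div (Λ_{δ²} A ∇u) = 0` in `Ω`. -/
def IsWeakSolutionPos {d : ℕ} {ι : Type*} (F : ι → Set (Rd d)) (A : Tensor d) (δ : ℝ)
    (Ω : Set (Rd d)) (u : Rd d → Rd d) (G : MatrixField d) : Prop :=
  MemH1 Ω u G ∧ ∀ v Gv, MemH10 Ω v Gv →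
    ∫ x in Ω, contrast F (δ ^ 2) x * form (A x) (G x) (Gv x) = 0

/-- For `δ = 0` (soft inclusions): the field `u ∈ H¹(Ω; ℝᵈ)` with weak gradient `G` satisfies
`∫_{Ω ∩ ω} A ∇u · ∇v = 0` for all `v ∈ H¹₀(Ω; ℝᵈ)` and, by convention, is moreover a weak solution
of `div (A ∇u) = 0` in `Ω ∩ F`, where `F = ⋃ k, F k`. -/
def IsWeakSolutionZero {d : ℕ} {ι : Type*} (ω : Set (Rd d)) (F : ι → Set (Rd d)) (A : Tensor d)
    (Ω : Set (Rd d)) (u : Rd d → Rd d) (G : MatrixField d) : Prop :=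
  MemH1 Ω u G ∧
    (∀ v Gv, MemH10 Ω v Gv → ∫ x in Ω ∩ ω, form (A x) (G x) (Gv x) = 0) ∧
    (∀ v Gv, MemH10 (Ω ∩ ⋃ k, F k) v Gv →
      ∫ x in Ω ∩ ⋃ k, F k, form (A x) (G x) (Gv x) = 0)

/-- The field `u ∈ H¹(Ω; ℝᵈ)` with weak gradient `G` is a weak solution of `L_δ u = 0` in `Ω`,
for `0 ≤ δ < ∞`. -/
def IsWeakSolution {d : ℕ} {ι : Type*} (ω : Set (Rd d)) (F : ι → Set (Rd d)) (A : Tensor d)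
    (δ : ℝ) (Ω : Set (Rd d)) (u : Rd d → Rd d) (G : MatrixField d) : Prop :=
  (0 < δ → IsWeakSolutionPos F A δ Ω u G) ∧ (δ = 0 → IsWeakSolutionZero ω F A Ω u G)

end HighContrast

end

open HighContrast

/-! The weight degenerates on the inclusions as δ → 0, so testing with η²u controls the strain (the
symmetric part of the gradient) only in the matrix ω: there the weight is 1, and the right-hand side
carries at worst the factor 1 + δ². This is `IsWeakSolution.lintegral_matrix_le`. Inside one
inclusion the weight is constant and divides out, so u solves div(A∇u) = 0 there whatever δ is, and
its energy is bounded by that of a competitor with the same boundary values. A competitor whose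
strain is controlled by the strain in the matrix therefore closes the argument.

The competitor is an extension from the matrix (`exists_extension`). Near a boundary point the
inclusion lies above a Lipschitz graph, and at height about S the extension is built from 2u(x −
8Sν) − u(x − 16Sν). This combination reproduces affine fields; two of them at consecutive dyadic
scales differ by a combination that annihilates affine fields and is bounded in L² by S times the
strain alone. Blending the scales with cutoffs of slope 1/S hence costs only strain, never the full
gradient (`exists_local_extension`). Finitely many scales are used and the given smooth field is
kept in a thin last layer, so that the result is smooth and equals the field near the boundary, at
the price of an arbitrarily small error. Gluing finitely many local extensions costs the square of
the field; that term is removed by first subtracting a rigid motion, using a Korn–Poincaré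
inequality on a connected chain of pieces of ω (`exists_kornOn_biUnion`). The latter inequality is
elementary: the increment of a field along a segment, in the direction of the segment, sees only
strain, and such increments to the vertices of a simplex determine the field. By periodicity there
are finitely many inclusions up to translation, so the constants are uniform and the source regions
overlap boundedly (`exists_uniform_extension`).

For the solution itself two nested cutoffs are used. The field ηu is approximated by test fields φ,
each φ is replaced in every inclusion by its extension w, and ζ²(φ − w), which is compactly
supported in the inclusion, serves as test field. Together with the matrix estimate this bounds the
strain of ζu everywhere, and Korn's inequality for compactly supported fields
(`MemH1.lintegral_normSq_le`) gives the full gradient. -/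

namespace HighContrast

open scoped ENNReal

variable {d : ℕ}

/-! ### Strain and increments along segments -/

/-- Functions of class `C^∞` on `ℝᵈ`. -/
abbrev Smooth {V : Type*} [NormedAddCommGroup V] [NormedSpace ℝ V] (u : Rd d → V) : Prop :=
  ContDiff ℝ ((⊤ : ℕ∞) : WithTop ℕ∞) u

/-- The square of the norm of the symmetric part of a matrix. -/
noncomputable def symSq (ξ : Matrix (Fin d) (Fin d) ℝ) : ℝ :=
  ∑ i, ∑ α, ((ξ i α + ξ α i) / 2) ^ 2

/-- The square of the norm of the symmetric part of the classical gradient. -/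
noncomputable def strain (u : Rd d → Rd d) (x : Rd d) : ℝ := symSq (classicalGrad u x)

lemma symSq_nonneg (ξ : Matrix (Fin d) (Fin d) ℝ) : 0 ≤ symSq ξ :=
  Finset.sum_nonneg fun _ _ => Finset.sum_nonneg fun _ _ => sq_nonneg _

lemma normSq_nonneg (ξ : Matrix (Fin d) (Fin d) ℝ) : 0 ≤ normSq ξ :=
  Finset.sum_nonneg fun _ _ => Finset.sum_nonneg fun _ _ => sq_nonneg _

lemma strain_nonneg (u : Rd d → Rd d) (x : Rd d) : 0 ≤ strain u x := symSq_nonneg _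

lemma symSq_le_normSq (ξ : Matrix (Fin d) (Fin d) ℝ) : symSq ξ ≤ normSq ξ := by
  have h1 : symSq ξ ≤ ∑ i, ∑ α, (ξ i α ^ 2 / 2 + ξ α i ^ 2 / 2) :=
    Finset.sum_le_sum fun i _ => Finset.sum_le_sum fun α _ => by
      nlinarith [sq_nonneg (ξ i α - ξ α i)]
  refine h1.trans (le_of_eq ?_)
  simp only [Finset.sum_add_distrib, ← Finset.sum_div]
  rw [Finset.sum_comm (f := fun i α => ξ α i ^ 2)]
  simp only [normSq]
  ring

lemma symSq_add_le (ξ ζ : Matrix (Fin d) (Fin d) ℝ) :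
    symSq (ξ + ζ) ≤ 2 * symSq ξ + 2 * symSq ζ := by
  simp only [symSq, Finset.mul_sum, ← Finset.sum_add_distrib, Matrix.add_apply]
  exact Finset.sum_le_sum fun i _ => Finset.sum_le_sum fun α _ => by
    nlinarith [sq_nonneg ((ξ i α + ξ α i) - (ζ i α + ζ α i))]

lemma symSq_smul (c : ℝ) (ξ : Matrix (Fin d) (Fin d) ℝ) :
    symSq (c • ξ) = c ^ 2 * symSq ξ := by
  simp only [symSq, Finset.mul_sum, Matrix.smul_apply, smul_eq_mul]
  exact Finset.sum_congr rfl fun i _ => Finset.sum_congr rfl fun α _ => by ring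

lemma normSq_add_le (ξ ζ : Matrix (Fin d) (Fin d) ℝ) :
    normSq (ξ + ζ) ≤ 2 * normSq ξ + 2 * normSq ζ := by
  simp only [normSq, Finset.mul_sum, ← Finset.sum_add_distrib, Matrix.add_apply]
  exact Finset.sum_le_sum fun i _ => Finset.sum_le_sum fun α _ => by
    nlinarith [sq_nonneg (ξ i α - ζ i α)]

lemma normSq_smul (c : ℝ) (ξ : Matrix (Fin d) (Fin d) ℝ) :
    normSq (c • ξ) = c ^ 2 * normSq ξ := by
  simp only [normSq, Finset.mul_sum, Matrix.smul_apply, smul_eq_mul]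
  exact Finset.sum_congr rfl fun i _ => Finset.sum_congr rfl fun α _ => by ring

lemma norm_sq_eq_sum (h : Rd d) : ‖h‖ ^ 2 = ∑ i, h i ^ 2 := by
  rw [EuclideanSpace.norm_sq_eq]; simp

lemma fderiv_apply_eq_sum (u : Rd d → Rd d) (x h : Rd d) (α : Fin d) :
    fderiv ℝ u x h α = ∑ i, h i * classicalGrad u x i α := by
  have : h = ∑ i, h i • EuclideanSpace.single i (1 : ℝ) := by
    ext j
    simp [Finset.sum_apply, Pi.single_apply]
  conv_lhs => rw [this]
  simp [classicalGrad, map_sum, Finset.sum_apply]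

/-- Exchanging the two indices shows that the quadratic form of the gradient sees only its symmetric
part; then Cauchy–Schwarz over pairs of indices. -/
lemma inner_fderiv_sq_le (u : Rd d → Rd d) (x h : Rd d) :
    (inner ℝ (fderiv ℝ u x h) h) ^ 2 ≤ ‖h‖ ^ 4 * strain u x := by
  set G := classicalGrad u x with hG
  have e1 : inner ℝ (fderiv ℝ u x h) h = ∑ i, ∑ α, h i * h α * G i α := by
    rw [PiLp.inner_apply]
    simp only [fderiv_apply_eq_sum, RCLike.inner_apply, conj_trivial, Finset.mul_sum]
    rw [Finset.sum_comm]
    refine Finset.sum_congr rfl fun i _ => Finset.sum_congr rfl fun α _ => by ring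
  have e2 : inner ℝ (fderiv ℝ u x h) h = ∑ i, ∑ α, h i * h α * ((G i α + G α i) / 2) := by
    have e3 : ∑ i, ∑ α, h i * h α * G α i = ∑ i, ∑ α, h i * h α * G i α := by
      rw [Finset.sum_comm]
      refine Finset.sum_congr rfl fun i _ => Finset.sum_congr rfl fun α _ => by ring
    have : ∑ i, ∑ α, h i * h α * ((G i α + G α i) / 2)
        = (∑ i, ∑ α, h i * h α * G i α + ∑ i, ∑ α, h i * h α * G α i) / 2 := by
      simp only [← Finset.sum_add_distrib, Finset.sum_div]
      refine Finset.sum_congr rfl fun i _ => Finset.sum_congr rfl fun α _ => by ring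
    rw [this, e3, e1]; ring
  rw [e2, ← Finset.sum_product' (s := Finset.univ) (t := Finset.univ)
    (f := fun i α => h i * h α * ((G i α + G α i) / 2))]
  refine (Finset.sum_mul_sq_le_sq_mul_sq _ _ _).trans (le_of_eq ?_)
  rw [Finset.sum_product' (f := fun i α => (h i * h α) ^ 2),
    Finset.sum_product' (f := fun i α => ((G i α + G α i) / 2) ^ 2)]
  have : ‖h‖ ^ 4 = ∑ i, ∑ α, (h i * h α) ^ 2 := by
    rw [show ‖h‖ ^ 4 = ‖h‖ ^ 2 * ‖h‖ ^ 2 by ring, norm_sq_eq_sum, Finset.sum_mul_sum]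
    simp only [mul_pow]
  rw [this]; rfl

lemma continuous_classicalGrad {u : Rd d → Rd d} (hu : Smooth u) (i α : Fin d) :
    Continuous fun x => classicalGrad u x i α := by
  have h1 : Continuous fun x => fderiv ℝ u x (EuclideanSpace.single i 1) :=
    (hu.continuous_fderiv (by simp)).clm_apply continuous_const
  exact (EuclideanSpace.proj (𝕜 := ℝ) α).continuous.comp h1

lemma continuous_strain {u : Rd d → Rd d} (hu : Smooth u) : Continuous (strain u) := by
  unfold strain symSq
  refine continuous_finsetSum _ fun i _ => continuous_finsetSum _ fun α _ => ?_
  exact (((continuous_classicalGrad hu i α).add (continuous_classicalGrad hu α i)).div_const _).pow _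

lemma sq_integral_le {g : ℝ → ℝ} (hg : Continuous g) :
    (∫ t in (0:ℝ)..1, g t) ^ 2 ≤ ∫ t in (0:ℝ)..1, g t ^ 2 := by
  set c := ∫ t in (0:ℝ)..1, g t with hc
  have h0 : 0 ≤ ∫ t in (0:ℝ)..1, (g t - c) ^ 2 :=
    intervalIntegral.integral_nonneg (by norm_num) fun _ _ => sq_nonneg _
  have h1 : ∫ t in (0:ℝ)..1, (g t - c) ^ 2
      = (∫ t in (0:ℝ)..1, g t ^ 2) - 2 * c * c + c ^ 2 := by
    have : (fun t => (g t - c) ^ 2) = fun t => (g t ^ 2 - (2 * c) * g t) + c ^ 2 := by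
      funext t; ring
    rw [this, intervalIntegral.integral_add, intervalIntegral.integral_sub,
      intervalIntegral.integral_const_mul, ← hc]
    · simp
    all_goals exact Continuous.intervalIntegrable (by fun_prop) _ _
  nlinarith

/-- The increment of `u` along a segment, in the direction of the segment, is controlled by the
strain along that segment. -/
lemma ofReal_sq_inner_sub_le {u : Rd d → Rd d} (hu : Smooth u) (p q : Rd d) :
    ENNReal.ofReal ((inner ℝ (u q - u p) (q - p)) ^ 2) ≤
      ENNReal.ofReal (‖q - p‖ ^ 4) *
        ∫⁻ t in Set.Icc (0 : ℝ) 1, ENNReal.ofReal (strain u (p + t • (q - p))) := by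
  set h := q - p with hh
  have hd : Differentiable ℝ u := hu.differentiable (by simp)
  have hline : ∀ t : ℝ, HasDerivAt (fun t : ℝ => p + t • h) h t := fun t => by
    simpa using ((hasDerivAt_id t).smul_const h).const_add p
  have hder : ∀ t : ℝ, HasDerivAt (fun t : ℝ => inner ℝ (u (p + t • h)) h)
      (inner ℝ (fderiv ℝ u (p + t • h) h) h) t := fun t => by
    have h1 := (hd (p + t • h)).hasFDerivAt.comp_hasDerivAt t (hline t)
    simpa using h1.inner ℝ (hasDerivAt_const t h)
  have hcl : Continuous fun t : ℝ => p + t • h := by fun_prop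
  have hcont : Continuous fun t : ℝ => inner ℝ (fderiv ℝ u (p + t • h) h) h :=
    (((hu.continuous_fderiv (by simp)).comp hcl).clm_apply continuous_const).inner continuous_const
  have hcs : Continuous fun t : ℝ => strain u (p + t • h) := (continuous_strain hu).comp hcl
  have hint : inner ℝ (u q - u p) h = ∫ t in (0:ℝ)..1, inner ℝ (fderiv ℝ u (p + t • h) h) h := by
    rw [intervalIntegral.integral_eq_sub_of_hasDerivAt (fun t _ => hder t)
      (hcont.intervalIntegrable _ _)]
    simp [hh, inner_sub_left]
  have hle : (inner ℝ (u q - u p) h) ^ 2 ≤ ‖h‖ ^ 4 * ∫ t in (0:ℝ)..1, strain u (p + t • h) := by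
    rw [hint]
    refine (sq_integral_le hcont).trans ?_
    rw [← intervalIntegral.integral_const_mul]
    exact intervalIntegral.integral_mono_on (by norm_num)
      ((hcont.pow 2).intervalIntegrable _ _) ((hcs.const_mul _).intervalIntegrable _ _)
      fun t _ => inner_fderiv_sq_le u _ h
  refine (ENNReal.ofReal_le_ofReal hle).trans ?_
  rw [ENNReal.ofReal_mul (by positivity), intervalIntegral.integral_of_le (by norm_num),
    ofReal_integral_eq_lintegral_ofReal
      ((hcs.integrableOn_Icc (a := 0) (b := 1)).mono_set Set.Ioc_subset_Icc_self)
      (ae_of_all _ fun _ => strain_nonneg _ _)]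
  gcongr
  exact Set.Ioc_subset_Icc_self

/-- Translation of the domain of an integral. -/
lemma setLIntegral_translate_le (g : Rd d → ℝ≥0∞) (c : Rd d) {X Y : Set (Rd d)}
    (hX : MeasurableSet X) (hY : MeasurableSet Y) (hXY : ∀ x ∈ X, x + c ∈ Y) :
    ∫⁻ x in X, g (x + c) ≤ ∫⁻ x in Y, g x := by
  rw [← lintegral_indicator hX, ← lintegral_indicator hY,
    ← lintegral_add_right_eq_self (Y.indicator g) c]
  refine lintegral_mono fun x => ?_
  by_cases hx : x ∈ X
  · simp [hx, hXY x hx]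
  · simp [hx]

lemma measurable_ofReal_strain {u : Rd d → Rd d} (hu : Smooth u) :
    Measurable fun x => ENNReal.ofReal (strain u x) :=
  (continuous_strain hu).measurable.ennreal_ofReal

/-- Increments of `u` between two fixed offsets of a variable point. -/
lemma lintegral_sq_inner_offset_le {u : Rd d → Rd d} (hu : Smooth u) (a b : Rd d)
    {X Y : Set (Rd d)} (hX : MeasurableSet X) (hY : MeasurableSet Y)
    (hXY : ∀ x ∈ X, ∀ t ∈ Set.Icc (0 : ℝ) 1, x + (a + t • (b - a)) ∈ Y) :
    ∫⁻ x in X, ENNReal.ofReal ((inner ℝ (u (x + b) - u (x + a)) (b - a)) ^ 2) ≤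
      ENNReal.ofReal (‖b - a‖ ^ 4) * ∫⁻ x in Y, ENNReal.ofReal (strain u x) := by
  have hm := measurable_ofReal_strain hu
  calc ∫⁻ x in X, ENNReal.ofReal ((inner ℝ (u (x + b) - u (x + a)) (b - a)) ^ 2)
      ≤ ∫⁻ x in X, ENNReal.ofReal (‖b - a‖ ^ 4) *
        ∫⁻ t in Set.Icc (0 : ℝ) 1, ENNReal.ofReal (strain u (x + (a + t • (b - a)))) := by
        refine lintegral_mono fun x => ?_
        have := ofReal_sq_inner_sub_le hu (x + a) (x + b)
        simpa [add_sub_add_left_eq_sub, add_assoc] using this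
    _ = ENNReal.ofReal (‖b - a‖ ^ 4) * ∫⁻ t in Set.Icc (0 : ℝ) 1, ∫⁻ x in X,
          ENNReal.ofReal (strain u (x + (a + t • (b - a)))) := by
        have hm2 : Measurable fun p : Rd d × ℝ =>
            ENNReal.ofReal (strain u (p.1 + (a + p.2 • (b - a)))) :=
          hm.comp (by fun_prop)
        rw [lintegral_const_mul _ (hm2.lintegral_prod_right'), lintegral_lintegral_swap]
        exact hm2.aemeasurable
    _ ≤ ENNReal.ofReal (‖b - a‖ ^ 4) * ∫⁻ t in Set.Icc (0 : ℝ) 1, ∫⁻ x in Y,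
          ENNReal.ofReal (strain u x) := by
        refine mul_le_mul' le_rfl ?_
        refine setLIntegral_mono measurable_const fun t ht => ?_
        exact setLIntegral_translate_le (fun x => ENNReal.ofReal (strain u x)) _ hX hY
          fun x hx => hXY x hx t ht
    _ = _ := by simp

/-! ### Rigid motions and interpolation on a simplex -/

/-- Infinitesimal rigid motions. -/
def IsRigid (r : Rd d → Rd d) : Prop :=
  ∃ (b : Rd d) (W : Rd d →L[ℝ] Rd d), (∀ x, inner ℝ (W x) x = 0) ∧ ∀ x, r x = b + W x

namespace IsRigid

variable {r r' : Rd d → Rd d}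

lemma contDiff (hr : IsRigid r) : Smooth r := by
  obtain ⟨b, W, -, h⟩ := hr
  rw [show r = fun x => b + W x from funext h]
  exact contDiff_const.add W.contDiff

lemma inner_sub (hr : IsRigid r) (p q : Rd d) : inner ℝ (r q - r p) (q - p) = 0 := by
  obtain ⟨b, W, hW, h⟩ := hr
  rw [h, h, add_sub_add_left_eq_sub, ← map_sub, hW]

lemma sub (hr : IsRigid r) (hr' : IsRigid r') : IsRigid fun x => r x - r' x := by
  obtain ⟨b, W, hW, h⟩ := hr
  obtain ⟨b', W', hW', h'⟩ := hr'
  refine ⟨b - b', W - W', fun x => ?_, fun x => ?_⟩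
  · simp [inner_sub_left, hW, hW']
  · simp only [h, h', sub_apply]; abel

lemma classicalGrad_add (hr : IsRigid r) (x : Rd d) (i α : Fin d) :
    classicalGrad r x i α + classicalGrad r x α i = 0 := by
  obtain ⟨b, W, hW, h⟩ := hr
  have hf : fderiv ℝ r x = W := by
    rw [show r = fun x => b + W x from funext h, fderiv_const_add]
    exact W.fderiv
  have h1 := hW (EuclideanSpace.single i 1 + EuclideanSpace.single α 1)
  have h2 := hW (EuclideanSpace.single i 1)
  have h3 := hW (EuclideanSpace.single α 1)
  rw [map_add, inner_add_left, inner_add_right, inner_add_right, h2, h3] at h1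
  simp only [EuclideanSpace.inner_single_right, conj_trivial, one_mul, zero_add, add_zero] at h1
  simp only [classicalGrad, Matrix.of_apply, hf]
  linarith

end IsRigid

lemma classicalGrad_add_fun {u v : Rd d → Rd d} {x : Rd d} (hu : DifferentiableAt ℝ u x)
    (hv : DifferentiableAt ℝ v x) :
    classicalGrad (fun x => u x + v x) x = classicalGrad u x + classicalGrad v x := by
  ext i α
  simp [classicalGrad, fderiv_fun_add hu hv]

lemma classicalGrad_sub_fun {u v : Rd d → Rd d} {x : Rd d} (hu : DifferentiableAt ℝ u x)
    (hv : DifferentiableAt ℝ v x) :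
    classicalGrad (fun x => u x - v x) x = classicalGrad u x - classicalGrad v x := by
  ext i α
  simp [classicalGrad, fderiv_fun_sub hu hv]

lemma strain_sub_rigid {u r : Rd d → Rd d} (hu : Smooth u) (hr : IsRigid r) (x : Rd d) :
    strain (fun x => u x - r x) x = strain u x := by
  unfold strain
  rw [classicalGrad_sub_fun (hu.differentiable (by simp) x) (hr.contDiff.differentiable (by simp) x)]
  refine Finset.sum_congr rfl fun i _ => Finset.sum_congr rfl fun α _ => ?_
  have := hr.classicalGrad_add x i α
  simp only [Matrix.sub_apply]
  congr 1
  linarith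

lemma strain_add_rigid {u r : Rd d → Rd d} (hu : Smooth u) (hr : IsRigid r) (x : Rd d) :
    strain (fun x => u x + r x) x = strain u x := by
  have := strain_sub_rigid (u := fun x => u x + r x) (hu.add hr.contDiff) hr x
  simpa using this.symm

/-- The vertices of the coordinate simplex of size `h`, relative to its corner. -/
noncomputable def vertex (h : ℝ) : Option (Fin d) → Rd d
  | none => 0
  | some i => EuclideanSpace.single i h

lemma norm_vertex_le {h : ℝ} (hh : 0 ≤ h) (o : Option (Fin d)) : ‖vertex h o‖ ≤ h := by
  cases o <;> simp [vertex, hh, abs_of_nonneg]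

/-- The value of a field at `x` is determined by its values at the vertices of a simplex, up to the
increments of the field along the segments from `x` to the vertices. -/
lemma sq_mul_norm_sq_le (w : Rd d → Rd d) {h M : ℝ} (x y : Rd d)
    (hM : ∀ o, ‖x - (y + vertex h o)‖ ≤ M) :
    h ^ 2 * ‖w x‖ ^ 2 ≤ 4 * d * ∑ o, ((inner ℝ (w (y + vertex h o) - w x) (y + vertex h o - x)) ^ 2
      + M ^ 2 * ‖w (y + vertex h o)‖ ^ 2) := by
  set T : Option (Fin d) → ℝ := fun o =>
    (inner ℝ (w (y + vertex h o) - w x) (y + vertex h o - x)) ^ 2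
      + M ^ 2 * ‖w (y + vertex h o)‖ ^ 2 with hT
  have hT0 : ∀ o, 0 ≤ T o := fun o => by positivity
  have hcs : ∀ o, (inner ℝ (w (y + vertex h o)) (x - (y + vertex h o))) ^ 2
      ≤ M ^ 2 * ‖w (y + vertex h o)‖ ^ 2 := fun o => by
    have h1 := abs_real_inner_le_norm (w (y + vertex h o)) (x - (y + vertex h o))
    have h2 : |inner ℝ (w (y + vertex h o)) (x - (y + vertex h o))| ≤ M * ‖w (y + vertex h o)‖ := by
      refine h1.trans ?_
      rw [mul_comm]
      gcongr
      exact hM o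
    rw [← mul_pow, ← sq_abs]
    gcongr
  have key : ∀ i, (h * w x i) ^ 2 ≤ 4 * ∑ o, T o := fun i => by
    have hsum : T none + T (some i) ≤ ∑ o, T o := by
      have := Finset.sum_le_sum_of_subset_of_nonneg
        (Finset.subset_univ {none, some i}) fun o _ _ => hT0 o
      simpa using this
    -- The edge from the corner to vertex `i` is a difference of two vectors starting at `x`.
    -- Pairing `w x` with each of them gives an increment along that segment up to a term at the
    -- vertex.
    have e : h * w x i =
        inner ℝ (w (y + vertex h none) - w x) (y + vertex h none - x)
        - inner ℝ (w (y + vertex h (some i)) - w x) (y + vertex h (some i) - x)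
        + inner ℝ (w (y + vertex h none)) (x - (y + vertex h none))
        - inner ℝ (w (y + vertex h (some i))) (x - (y + vertex h (some i))) := by
      have h3 : inner ℝ (w x) (vertex h (some i) : Rd d) = h * w x i := by
        simp [vertex, EuclideanSpace.inner_single_right]
      rw [← h3]
      have h4 : (vertex h none : Rd d) = 0 := rfl
      rw [h4]
      generalize (vertex h (some i) : Rd d) = v
      simp only [inner_sub_left, inner_sub_right, inner_add_right, add_zero]
      ring
    rw [e]
    have a1 := hcs none
    have a2 := hcs (some i)
    have : ∀ a b c e : ℝ, (a - b + c - e) ^ 2 ≤ 4 * (a ^ 2 + c ^ 2 + (b ^ 2 + e ^ 2)) :=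
      fun a b c e => by
        nlinarith [sq_nonneg (a + b), sq_nonneg (a - c), sq_nonneg (a + e), sq_nonneg (b + c),
          sq_nonneg (b - e), sq_nonneg (c + e)]
    refine (this _ _ _ _).trans ?_
    have hT2 : (inner ℝ (w (y + vertex h none) - w x) (y + vertex h none - x)) ^ 2
      + (inner ℝ (w (y + vertex h none)) (x - (y + vertex h none))) ^ 2
      + ((inner ℝ (w (y + vertex h (some i)) - w x) (y + vertex h (some i) - x)) ^ 2
      + (inner ℝ (w (y + vertex h (some i))) (x - (y + vertex h (some i)))) ^ 2)
        ≤ T none + T (some i) := by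
      simp only [hT]; linarith
    linarith
  calc h ^ 2 * ‖w x‖ ^ 2 = ∑ i, (h * w x i) ^ 2 := by
        rw [norm_sq_eq_sum, Finset.mul_sum]; simp only [mul_pow]
    _ ≤ ∑ _i : Fin d, 4 * ∑ o, T o := Finset.sum_le_sum fun i _ => key i
    _ = 4 * d * ∑ o, T o := by simp; ring

/-- A field is interpolated at the vertices of a simplex by a rigid motion, up to its increments
along the edges. -/
lemma exists_rigid_simplex (u : Rd d → Rd d) (y : Rd d) {h : ℝ} (hh : 0 < h) :
    ∃ r : Rd d → Rd d, IsRigid r ∧ ∀ o, h ^ 2 * ‖u (y + vertex h o) - r (y + vertex h o)‖ ^ 2 ≤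
      d * (3 * ∑ o, ∑ o', (inner ℝ (u (y + vertex h o') - u (y + vertex h o))
        (vertex h o' - vertex h o)) ^ 2) := by
  set p : Option (Fin d) → Rd d := fun o => y + vertex h o with hp
  set f : Option (Fin d) → Option (Fin d) → ℝ := fun o o' =>
    inner ℝ (u (p o') - u (p o)) (vertex h o' - vertex h o) with hf
  set S := ∑ o, ∑ o', (f o o') ^ 2 with hS
  have hfS : ∀ o o', (f o o') ^ 2 ≤ S := fun o o' =>
    (Finset.single_le_sum (f := fun o' => (f o o') ^ 2) (fun _ _ => sq_nonneg _)
      (Finset.mem_univ o')).trans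
    (Finset.single_le_sum (f := fun o => ∑ o', (f o o') ^ 2)
      (fun _ _ => Finset.sum_nonneg fun _ _ => sq_nonneg _) (Finset.mem_univ o))
  have hS0 : 0 ≤ S := Finset.sum_nonneg fun _ _ => Finset.sum_nonneg fun _ _ => sq_nonneg _
  -- `L` holds the difference quotients along the edges at the corner. The rigid motion matches `u`
  -- at the corner and has the skew part `W` of `L` as its linear part.
  set L : Matrix (Fin d) (Fin d) ℝ := Matrix.of fun j i => (u (p (some i)) - u (p none)) j / h
  set W : Matrix (Fin d) (Fin d) ℝ := Matrix.of fun j i => (L j i - L i j) / 2 with hWdef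
  set T : Rd d →L[ℝ] Rd d := LinearMap.toContinuousLinearMap (Matrix.toEuclideanLin W) with hTdef
  have hT : ∀ x j, T x j = ∑ i, W j i * x i := fun x j => by
    simp [hTdef, Matrix.toLpLin_apply, Matrix.mulVec, dotProduct]
  have hskew : ∀ x, inner ℝ (T x) x = 0 := fun x => by
    rw [PiLp.inner_apply]
    simp only [hT, RCLike.inner_apply, conj_trivial, Finset.mul_sum]
    have h1 : ∑ j, ∑ i, x j * (W j i * x i) = - ∑ j, ∑ i, x j * (W j i * x i) := by
      conv_lhs => rw [Finset.sum_comm]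
      simp only [← Finset.sum_neg_distrib]
      refine Finset.sum_congr rfl fun j _ => Finset.sum_congr rfl fun i _ => ?_
      simp only [hWdef, Matrix.of_apply]; ring
    linarith
  refine ⟨fun x => (u y - T y) + T x, ⟨u y - T y, T, hskew, fun _ => rfl⟩, fun o => ?_⟩
  have hr : u (p o) - ((u y - T y) + T (p o)) = u (p o) - u y - T (vertex h o) := by
    simp only [hp, map_add]; abel
  change h ^ 2 * ‖u (p o) - ((u y - T y) + T (p o))‖ ^ 2 ≤ d * (3 * S)
  rw [hr]
  have hp0 : p none = y := by simp [hp, vertex]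
  cases o with
  | none => simp [hp0, vertex]; positivity
  | some i =>
    rw [norm_sq_eq_sum, Finset.mul_sum]
    have key : ∀ j, h ^ 2 * (u (p (some i)) - u y - T (vertex h (some i))) j ^ 2 ≤ 3 * S := fun j => by
      have e1 : T (vertex h (some i)) j = W j i * h := by
        rw [hT]; simp [vertex]
      set a : Fin d → Fin d → ℝ := fun i j => (u (p (some i)) - u y) j with ha
      have e2 : (u (p (some i)) - u y - T (vertex h (some i))) j = (a i j + a j i) / 2 := by
        rw [PiLp.sub_apply, e1]
        simp only [hWdef, L, Matrix.of_apply, hp0, ha]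
        field_simp; ring
      have f0 : ∀ k, f none (some k) = h * a k k := fun k => by
        simp only [hf, hp0]
        simp [vertex, EuclideanSpace.inner_single_right, ha]
      have f1 : f (some j) (some i) = h * (a i i - a j i - (a i j - a j j)) := by
        simp only [hf]
        have : u (p (some i)) - u (p (some j))
          = (u (p (some i)) - u y) - (u (p (some j)) - u y) := by abel
        rw [this]
        simp only [vertex, inner_sub_right, EuclideanSpace.inner_single_right, conj_trivial,
          PiLp.sub_apply, ha]
        ring
      -- The residual at a vertex is a symmetrized corner increment; polarization writes it through
      -- the three edges joining the corner and the vertices `i` and `j`.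
      have e3 : h * ((a i j + a j i) / 2)
          = (f none (some i) + f none (some j) - f (some j) (some i)) / 2 := by
        rw [f0, f0, f1]; ring
      rw [e2, ← mul_pow, e3]
      have b1 := hfS none (some i)
      have b2 := hfS none (some j)
      have b3 := hfS (some j) (some i)
      have : ∀ a b c : ℝ, ((a + b - c) / 2) ^ 2 ≤ (3 / 4) * (a ^ 2 + b ^ 2 + c ^ 2) := fun a b c => by
        nlinarith [sq_nonneg (a - b), sq_nonneg (a + c), sq_nonneg (b + c)]
      refine (this _ _ _).trans ?_
      linarith
    refine (Finset.sum_le_sum fun j _ => key j).trans ?_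
    simp

/-! ### The Korn–Poincaré inequality -/

lemma lintegral_comp_smul_le {g : Rd d → ℝ≥0∞} (hg : Measurable g) (c : Rd d) {t : ℝ}
    (ht : 1 / 2 ≤ t) : ∫⁻ y, g (c + t • y) ≤ 2 ^ d * ∫⁻ y, g y := by
  have ht0 : 0 < t := by linarith
  have h1 : ∫⁻ y, g (c + t • y) = ENNReal.ofReal |(t ^ d)⁻¹| * ∫⁻ y, g y := by
    have h2 := Measure.map_addHaar_smul (volume : Measure (Rd d)) ht0.ne'
    rw [finrank_euclideanSpace_fin] at h2
    have h3 : ∫⁻ y, g (c + y) ∂(Measure.map (t • · : Rd d → Rd d) volume)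
        = ∫⁻ y, g (c + t • y) :=
      lintegral_map (hg.comp (measurable_const_add c)) (measurable_const_smul t)
    rw [← h3, h2, lintegral_smul_measure, lintegral_add_left_eq_self, smul_eq_mul]
  rw [h1]
  gcongr
  rw [abs_of_nonneg (by positivity), ← inv_pow]
  calc ENNReal.ofReal (t⁻¹ ^ d) ≤ ENNReal.ofReal (2 ^ d) := by
        gcongr
        rw [inv_le_comm₀ ht0 (by norm_num)]
        linarith
    _ = 2 ^ d := by rw [ENNReal.ofReal_pow (by norm_num)]; simp

/-- The intermediate point is affine in `x` with factor `1 - t` and in `y` with factor `t`. One of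
the two is at least 1/2, and the change of variables in that endpoint has Jacobian at most `2 ^ d`.
-/
lemma lintegral_lintegral_segment_le {g : Rd d → ℝ≥0∞} (hg : Measurable g) (X Y : Set (Rd d))
    (v : Rd d) {t : ℝ} :
    ∫⁻ y in Y, ∫⁻ x in X, g (x + t • (y + v - x)) ≤
      2 ^ d * (volume X + volume Y) * ∫⁻ y, g y := by
  have hmeas : Measurable fun p : Rd d × Rd d => g (p.2 + t • (p.1 + v - p.2)) :=
    hg.comp (by fun_prop)
  rcases le_total t (1 / 2) with ht | ht
  · calc ∫⁻ y in Y, ∫⁻ x in X, g (x + t • (y + v - x))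
        ≤ ∫⁻ y in Y, 2 ^ d * ∫⁻ x, g x := by
          refine lintegral_mono fun y => (setLIntegral_le_lintegral _ _).trans ?_
          refine le_trans (le_of_eq (lintegral_congr fun x => ?_))
            (lintegral_comp_smul_le hg (t • (y + v)) (t := 1 - t) (by linarith))
          congr 1
          module
      _ = 2 ^ d * volume Y * ∫⁻ x, g x := by simp; ring
      _ ≤ _ := by gcongr; exact le_add_self
  · rw [lintegral_lintegral_swap hmeas.aemeasurable]
    calc ∫⁻ x in X, ∫⁻ y in Y, g (x + t • (y + v - x))
        ≤ ∫⁻ x in X, 2 ^ d * ∫⁻ y, g y := by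
          refine lintegral_mono fun x => (setLIntegral_le_lintegral _ _).trans ?_
          refine le_trans (le_of_eq (lintegral_congr fun y => ?_))
            (lintegral_comp_smul_le hg (x + t • (v - x)) ht)
          congr 1
          module
      _ = 2 ^ d * volume X * ∫⁻ x, g x := by simp; ring
      _ ≤ _ := by gcongr; exact le_self_add

/-- The Korn–Poincaré inequality on `D`, with the strain on `E`. -/
def KornOn (D E : Set (Rd d)) : Prop :=
  ∃ C : NNReal, ∀ u : Rd d → Rd d, Smooth u → ∃ r : Rd d → Rd d, IsRigid r ∧
    ∫⁻ x in D, ENNReal.ofReal (‖u x - r x‖ ^ 2) ≤ C * ∫⁻ x in E, ENNReal.ofReal (strain u x)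

lemma KornOn.mono {D D' E E' : Set (Rd d)} (h : KornOn D E) (hD : D' ⊆ D) (hE : E ⊆ E') :
    KornOn D' E' := by
  obtain ⟨C, hC⟩ := h
  refine ⟨C, fun u hu => ?_⟩
  obtain ⟨r, hr, hle⟩ := hC u hu
  refine ⟨r, hr, (lintegral_mono_set hD).trans (hle.trans ?_)⟩
  gcongr

/-- Averaging over both endpoints matters: with one endpoint fixed the change of variables
degenerates as the point approaches it. The indicator of `E` is put into the integrand first, so
that the substitutions act on the whole space. -/
lemma lintegral_sq_inner_segment_le {u : Rd d → Rd d} (hu : Smooth u) {X Y E : Set (Rd d)}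
    (hX : MeasurableSet X) (hY : MeasurableSet Y) (hE : MeasurableSet E) (v : Rd d) {M : ℝ}
    (hM : ∀ x ∈ X, ∀ y ∈ Y, ‖y + v - x‖ ≤ M)
    (hseg : ∀ x ∈ X, ∀ y ∈ Y, ∀ t ∈ Set.Icc (0 : ℝ) 1, x + t • (y + v - x) ∈ E) :
    ∫⁻ y in Y, ∫⁻ x in X, ENNReal.ofReal ((inner ℝ (u (y + v) - u x) (y + v - x)) ^ 2) ≤
      ENNReal.ofReal (M ^ 4) * (2 ^ d * (volume X + volume Y)) *
        ∫⁻ x in E, ENNReal.ofReal (strain u x) := by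
  set g : Rd d → ℝ≥0∞ := E.indicator fun x => ENNReal.ofReal (strain u x) with hgdef
  have hg : Measurable g := (measurable_ofReal_strain hu).indicator hE
  have hm3 : Measurable fun p : (Rd d × Rd d) × ℝ => g (p.1.2 + p.2 • (p.1.1 + v - p.1.2)) :=
    hg.comp (by fun_prop)
  have hm2 : Measurable fun p : Rd d × Rd d =>
      ∫⁻ t in Set.Icc (0 : ℝ) 1, g (p.2 + t • (p.1 + v - p.2)) := hm3.lintegral_prod_right'
  calc ∫⁻ y in Y, ∫⁻ x in X, ENNReal.ofReal ((inner ℝ (u (y + v) - u x) (y + v - x)) ^ 2)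
      ≤ ∫⁻ y in Y, ∫⁻ x in X, ENNReal.ofReal (M ^ 4) *
          ∫⁻ t in Set.Icc (0 : ℝ) 1, g (x + t • (y + v - x)) := by
        refine setLIntegral_mono' hY fun y hy => setLIntegral_mono' hX fun x hx => ?_
        refine (ofReal_sq_inner_sub_le hu x (y + v)).trans ?_
        gcongr ENNReal.ofReal (?_ ^ 4) * ?_
        · exact hM x hx y hy
        · refine setLIntegral_mono' measurableSet_Icc fun t ht => ?_
          rw [hgdef, Set.indicator_of_mem (hseg x hx y hy t ht)]
    _ = ENNReal.ofReal (M ^ 4) * ∫⁻ t in Set.Icc (0 : ℝ) 1, ∫⁻ y in Y, ∫⁻ x in X,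
          g (x + t • (y + v - x)) := by
        have e1 : ∀ y, ∫⁻ x in X, ENNReal.ofReal (M ^ 4) *
            ∫⁻ t in Set.Icc (0 : ℝ) 1, g (x + t • (y + v - x)) = ENNReal.ofReal (M ^ 4) *
            ∫⁻ t in Set.Icc (0 : ℝ) 1, ∫⁻ x in X, g (x + t • (y + v - x)) := fun y => by
          have hm6 : Measurable fun x : Rd d =>
              ∫⁻ t in Set.Icc (0 : ℝ) 1, g (x + t • (y + v - x)) := hm2.comp measurable_prodMk_left
          rw [lintegral_const_mul _ hm6, lintegral_lintegral_swap]
          exact (hg.comp (by fun_prop : Measurable fun p : Rd d × ℝ =>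
            p.1 + p.2 • (y + v - p.1))).aemeasurable
        have hm4 : Measurable fun p : (Rd d × ℝ) × Rd d => g (p.2 + p.1.2 • (p.1.1 + v - p.2)) :=
          hg.comp (by fun_prop)
        have hm5 : Measurable fun p : Rd d × ℝ => ∫⁻ x in X, g (x + p.2 • (p.1 + v - x)) :=
          hm4.lintegral_prod_right'
        simp_rw [e1]
        rw [lintegral_const_mul _ hm5.lintegral_prod_right', lintegral_lintegral_swap]
        exact hm5.aemeasurable
    _ ≤ ENNReal.ofReal (M ^ 4) * ∫⁻ t in Set.Icc (0 : ℝ) 1,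
          2 ^ d * (volume X + volume Y) * ∫⁻ x, g x := by
        gcongr
        exact lintegral_lintegral_segment_le hg X Y v
    _ = _ := by
        rw [setLIntegral_const, hgdef, lintegral_indicator hE]
        simp [mul_assoc]

/-- A rigid motion is controlled on bounded sets by its values on a ball. -/
lemma exists_lintegral_rigid_le {D : Set (Rd d)} (hD : MeasurableSet D)
    (hDb : Bornology.IsBounded D) (c : Rd d) {s : ℝ} (hs : 0 < s) :
    ∃ C : NNReal, ∀ r : Rd d → Rd d, IsRigid r →
      ∫⁻ x in D, ENNReal.ofReal (‖r x‖ ^ 2) ≤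
        C * ∫⁻ x in Metric.ball c s, ENNReal.ofReal (‖r x‖ ^ 2) := by
  -- A simplex of size `s / 2` with corner in the ball of radius `s / 2` has all its vertices in the
  -- ball of radius `s`.
  set h := s / 2 with hh
  have hh0 : 0 < h := by positivity
  set B := Metric.ball c h with hB
  obtain ⟨M₀, hM₀⟩ := hDb.subset_ball c
  have hvol : 0 < volume B := Metric.measure_ball_pos _ _ hh0
  have hvol' : volume B < ∞ := measure_ball_lt_top
  have hDv : volume D < ∞ := hDb.measure_lt_top
  have hmemb : ∀ y ∈ B, ∀ o : Option (Fin d), y + vertex h o ∈ Metric.ball c s := fun y hy o => by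
    rw [Metric.mem_ball, dist_eq_norm] at hy ⊢
    calc ‖y + vertex h o - c‖ = ‖(y - c) + vertex h o‖ := by congr 1; abel
      _ ≤ ‖y - c‖ + ‖vertex h o‖ := norm_add_le _ _
      _ < h + h := add_lt_add_of_lt_of_le hy (norm_vertex_le hh0.le o)
      _ = s := by rw [hh]; ring
  have hM : ∀ x ∈ D, ∀ y ∈ B, ∀ o : Option (Fin d), ‖x - (y + vertex h o)‖ ≤ M₀ + s := by
    intro x hx y hy o
    have h1 := hM₀ hx
    have h2 := hmemb y hy o
    rw [Metric.mem_ball] at h1 h2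
    rw [← dist_eq_norm]
    linarith [dist_triangle_right x (y + vertex h o) c]
  set K : ℝ := 4 * d * (M₀ + s) ^ 2 / h ^ 2 with hK
  set C : ℝ≥0∞ := volume D * ((volume B)⁻¹ * (ENNReal.ofReal K * (d + 1))) with hC
  have hCtop : C ≠ ∞ := by
    refine ENNReal.mul_ne_top hDv.ne (ENNReal.mul_ne_top (ENNReal.inv_ne_top.2 hvol.ne') ?_)
    exact ENNReal.mul_ne_top ENNReal.ofReal_ne_top (by simp)
  refine ⟨C.toNNReal, fun r hr => ?_⟩
  rw [ENNReal.coe_toNNReal hCtop]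
  set I := ∫⁻ x in Metric.ball c s, ENNReal.ofReal (‖r x‖ ^ 2) with hI
  have hcont : Continuous r := hr.contDiff.continuous
  have key : ∀ x ∈ D, ENNReal.ofReal (‖r x‖ ^ 2) ≤
      (volume B)⁻¹ * (ENNReal.ofReal K * (d + 1)) * I := by
    intro x hx
    have h1 : ∀ y ∈ B, ENNReal.ofReal (‖r x‖ ^ 2) ≤
        ENNReal.ofReal K * ∑ o : Option (Fin d), ENNReal.ofReal (‖r (y + vertex h o)‖ ^ 2) := by
      intro y hy
      have h2 := sq_mul_norm_sq_le r x y (h := h) (hM x hx y hy)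
      -- A rigid motion has no increment along a segment in the direction of the segment, so only
      -- the vertex values remain.
      have h3 : ∀ o : Option (Fin d),
          inner ℝ (r (y + vertex h o) - r x) (y + vertex h o - x) = 0 :=
        fun o => hr.inner_sub _ _
      simp only [h3, ne_eq, OfNat.ofNat_ne_zero, not_false_eq_true, zero_pow, zero_add,
        ← Finset.mul_sum] at h2
      rw [← ENNReal.ofReal_sum_of_nonneg fun _ _ => by positivity,
        ← ENNReal.ofReal_mul (by positivity)]
      refine ENNReal.ofReal_le_ofReal ?_
      rw [hK, div_mul_eq_mul_div, le_div_iff₀ (by positivity)]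
      linarith
    have h4 : volume B * ENNReal.ofReal (‖r x‖ ^ 2) ≤ ENNReal.ofReal K * (d + 1) * I := by
      calc volume B * ENNReal.ofReal (‖r x‖ ^ 2)
          = ∫⁻ _y in B, ENNReal.ofReal (‖r x‖ ^ 2) := by rw [setLIntegral_const, mul_comm]
        _ ≤ ∫⁻ y in B, ENNReal.ofReal K *
              ∑ o : Option (Fin d), ENNReal.ofReal (‖r (y + vertex h o)‖ ^ 2) :=
            setLIntegral_mono' measurableSet_ball h1
        _ = ENNReal.ofReal K * ∑ o : Option (Fin d), ∫⁻ y in B,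
              ENNReal.ofReal (‖r (y + vertex h o)‖ ^ 2) := by
            have hmo : ∀ o : Option (Fin d),
                Measurable fun y => ENNReal.ofReal (‖r (y + vertex h o)‖ ^ 2) := fun o =>
              (Continuous.measurable (by fun_prop)).ennreal_ofReal
            rw [lintegral_const_mul _ (Finset.measurable_fun_sum _ fun o _ => hmo o),
              lintegral_finsetSum _ fun o _ => hmo o]
        _ ≤ ENNReal.ofReal K * ∑ _o : Option (Fin d), I := by
            gcongr with o
            exact setLIntegral_translate_le (fun x => ENNReal.ofReal (‖r x‖ ^ 2)) _
              measurableSet_ball measurableSet_ball fun y hy => hmemb y hy o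
        _ = _ := by simp [mul_assoc]
    calc ENNReal.ofReal (‖r x‖ ^ 2) = (volume B)⁻¹ * (volume B * ENNReal.ofReal (‖r x‖ ^ 2)) := by
          rw [← mul_assoc, ENNReal.inv_mul_cancel hvol.ne' hvol'.ne, one_mul]
      _ ≤ (volume B)⁻¹ * (ENNReal.ofReal K * (d + 1) * I) := by gcongr
      _ = _ := by ring
  calc ∫⁻ x in D, ENNReal.ofReal (‖r x‖ ^ 2)
      ≤ ∫⁻ _x in D, (volume B)⁻¹ * (ENNReal.ofReal K * (d + 1)) * I := setLIntegral_mono' hD key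
    _ = C * I := by rw [setLIntegral_const, hC]; ring

/-- Deviation from the rigid motion that interpolates a field on a simplex. -/
lemma exists_rigid_norm_sq_le (u : Rd d → Rd d) (y : Rd d) {h M : ℝ} (hh0 : 0 < h) :
    ∃ r : Rd d → Rd d, IsRigid r ∧ ∀ x, (∀ o, ‖x - (y + vertex h o)‖ ≤ M) →
      ‖u x - r x‖ ^ 2 ≤ 4 * d / h ^ 2 * (∑ o : Option (Fin d),
        (inner ℝ (u (y + vertex h o) - u x) (y + vertex h o - x)) ^ 2) +
        4 * d / h ^ 2 * ((d + 1) * (M ^ 2 * (d * 3 / h ^ 2))) * ∑ o : Option (Fin d),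
          ∑ o' : Option (Fin d), (inner ℝ (u (y + vertex h o') - u (y + vertex h o))
            (vertex h o' - vertex h o)) ^ 2 := by
  obtain ⟨r, hr, hrle⟩ := exists_rigid_simplex u y hh0
  refine ⟨r, hr, fun x hM => ?_⟩
  generalize (∑ o : Option (Fin d), ∑ o' : Option (Fin d),
    (inner ℝ (u (y + vertex h o') - u (y + vertex h o)) (vertex h o' - vertex h o)) ^ 2) = S at hrle ⊢
  have e1 := sq_mul_norm_sq_le (fun x => u x - r x) x y (h := h) hM
  have e2 : ∀ o : Option (Fin d),
      inner ℝ ((u (y + vertex h o) - r (y + vertex h o)) - (u x - r x)) (y + vertex h o - x)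
      = inner ℝ (u (y + vertex h o) - u x) (y + vertex h o - x) := fun o => by
    have e3 : (u (y + vertex h o) - r (y + vertex h o)) - (u x - r x)
      = (u (y + vertex h o) - u x) - (r (y + vertex h o) - r x) := by abel
    rw [e3, inner_sub_left, hr.inner_sub, sub_zero]
  simp only [e2, Finset.sum_add_distrib] at e1
  have e4 : ∑ o : Option (Fin d), M ^ 2 * ‖u (y + vertex h o) - r (y + vertex h o)‖ ^ 2
      ≤ (d + 1) * (M ^ 2 * (d * 3 / h ^ 2)) * S := by
    refine (Finset.sum_le_sum (g := fun _ => M ^ 2 * (d * 3 / h ^ 2) * S) fun o _ => ?_).trans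
      (le_of_eq ?_)
    · rw [mul_assoc]
      gcongr
      rw [div_mul_eq_mul_div, le_div_iff₀ (by positivity)]
      linarith [hrle o]
    · simp; ring
  have e5 : h ^ 2 * ‖u x - r x‖ ^ 2 ≤ 4 * d * (∑ o : Option (Fin d),
      (inner ℝ (u (y + vertex h o) - u x) (y + vertex h o - x)) ^ 2 +
      (d + 1) * (M ^ 2 * (d * 3 / h ^ 2)) * S) :=
    e1.trans (by gcongr)
  have e6 : ‖u x - r x‖ ^ 2 ≤ 4 * d / h ^ 2 * (∑ o : Option (Fin d),
      (inner ℝ (u (y + vertex h o) - u x) (y + vertex h o - x)) ^ 2 +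
      (d + 1) * (M ^ 2 * (d * 3 / h ^ 2)) * S) := by
    rw [div_mul_eq_mul_div, le_div_iff₀ (by positivity)]
    linarith
  refine e6.trans (le_of_eq ?_)
  ring

/-- The Korn–Poincaré inequality on a set that is star-shaped with respect to a ball. -/
lemma KornOn.of_segment {D E : Set (Rd d)} (hD : MeasurableSet D) (hDb : Bornology.IsBounded D)
    (hE : MeasurableSet E) (c : Rd d) {s : ℝ} (hs : 0 < s) (hsub : Metric.ball c s ⊆ D)
    (hseg : ∀ x ∈ D, ∀ y ∈ Metric.ball c s, ∀ t ∈ Set.Icc (0 : ℝ) 1, x + t • (y - x) ∈ E) :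
    KornOn D E := by
  obtain ⟨h, hh⟩ : ∃ h, h = s / 2 := ⟨_, rfl⟩
  have hh0 : 0 < h := by rw [hh]; positivity
  obtain ⟨B, hB⟩ : ∃ B, B = Metric.ball c h := ⟨_, rfl⟩
  obtain ⟨M₀, hM₀⟩ := hDb.subset_ball c
  have hvol : 0 < volume B := hB ▸ Metric.measure_ball_pos _ _ hh0
  have hvol' : volume B < ∞ := hB ▸ measure_ball_lt_top
  have hBm : MeasurableSet B := hB ▸ measurableSet_ball
  have hDv : volume D < ∞ := hDb.measure_lt_top
  have hmemb : ∀ y ∈ B, ∀ o : Option (Fin d), y + vertex h o ∈ Metric.ball c s := fun y hy o => by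
    rw [hB, Metric.mem_ball, dist_eq_norm] at hy
    rw [Metric.mem_ball, dist_eq_norm]
    calc ‖y + vertex h o - c‖ = ‖(y - c) + vertex h o‖ := by congr 1; abel
      _ ≤ ‖y - c‖ + ‖vertex h o‖ := norm_add_le _ _
      _ < h + h := add_lt_add_of_lt_of_le hy (norm_vertex_le hh0.le o)
      _ = s := by rw [hh]; ring
  obtain ⟨M, hMdef⟩ : ∃ M, M = M₀ + s := ⟨_, rfl⟩
  have hM : ∀ x ∈ D, ∀ y ∈ B, ∀ o : Option (Fin d), ‖x - (y + vertex h o)‖ ≤ M := by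
    intro x hx y hy o
    have h1 := hM₀ hx
    have h2 := hmemb y hy o
    rw [Metric.mem_ball] at h1 h2
    rw [← dist_eq_norm]
    linarith [dist_triangle_right x (y + vertex h o) c]
  obtain ⟨K₁, hK₁⟩ : ∃ K : ℝ, K = 4 * d / h ^ 2 := ⟨_, rfl⟩
  obtain ⟨K₂, hK₂⟩ : ∃ K : ℝ, K = 4 * d / h ^ 2 * ((d + 1) * (M ^ 2 * (d * 3 / h ^ 2))) := ⟨_, rfl⟩
  have hK₁0 : 0 ≤ K₁ := by rw [hK₁]; positivity
  have hK₂0 : 0 ≤ K₂ := by rw [hK₂]; positivity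
  obtain ⟨K₃, hK₃⟩ : ∃ K : ℝ≥0∞, K = ENNReal.ofReal K₁ * ((d + 1) *
      (ENNReal.ofReal (M ^ 4) * (2 ^ d * (volume D + volume B)))) +
      ENNReal.ofReal K₂ * volume D * ((d + 1) * ((d + 1) * ENNReal.ofReal ((2 * h) ^ 4))) :=
    ⟨_, rfl⟩
  have hK₃top : K₃ ≠ ∞ := by
    have a1 : ((d : ℝ≥0∞) + 1) ≠ ∞ := by simp
    have a2 : (2 : ℝ≥0∞) ^ d ≠ ∞ := by simp
    have a3 : volume D + volume B ≠ ∞ := ENNReal.add_ne_top.2 ⟨hDv.ne, hvol'.ne⟩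
    rw [hK₃]
    refine ENNReal.add_ne_top.2 ⟨?_, ?_⟩
    · exact ENNReal.mul_ne_top ENNReal.ofReal_ne_top (ENNReal.mul_ne_top a1
        (ENNReal.mul_ne_top ENNReal.ofReal_ne_top (ENNReal.mul_ne_top a2 a3)))
    · exact ENNReal.mul_ne_top (ENNReal.mul_ne_top ENNReal.ofReal_ne_top hDv.ne)
        (ENNReal.mul_ne_top a1 (ENNReal.mul_ne_top a1 ENNReal.ofReal_ne_top))
  have hCtop : K₃ / volume B ≠ ∞ := ENNReal.div_ne_top hK₃top hvol.ne'
  refine ⟨(K₃ / volume B).toNNReal, fun u hu => ?_⟩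
  rw [ENNReal.coe_toNNReal hCtop]
  obtain ⟨I, hI⟩ : ∃ I, I = ∫⁻ x in E, ENNReal.ofReal (strain u x) := ⟨_, rfl⟩
  rw [← hI]
  have huc : Continuous u := hu.continuous
  obtain ⟨f₁, hf₁⟩ : ∃ f : Rd d → Option (Fin d) → Rd d → ℝ≥0∞, f = fun y o x =>
    ENNReal.ofReal ((inner ℝ (u (y + vertex h o) - u x) (y + vertex h o - x)) ^ 2) := ⟨_, rfl⟩
  obtain ⟨f₂, hf₂⟩ : ∃ f : Rd d → Option (Fin d) → Option (Fin d) → ℝ≥0∞, f = fun y o o' =>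
    ENNReal.ofReal ((inner ℝ (u (y + vertex h o') - u (y + vertex h o))
        (vertex h o' - vertex h o)) ^ 2) := ⟨_, rfl⟩
  have hf₁m : ∀ o, Measurable fun p : Rd d × Rd d => f₁ p.1 o p.2 := fun o => by
    rw [hf₁]
    exact (Continuous.measurable (by fun_prop)).ennreal_ofReal
  have hf₁i : ∀ o, Measurable fun y => ∫⁻ x in D, f₁ y o x := fun o =>
    (hf₁m o).lintegral_prod_right'
  have hf₂m : ∀ o o', Measurable fun y => f₂ y o o' := fun o o' => by
    rw [hf₂]
    exact (Continuous.measurable (by fun_prop)).ennreal_ofReal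
  have hf₂s : Measurable fun y => ∑ o, ∑ o', f₂ y o o' :=
    Finset.measurable_fun_sum _ fun o _ => Finset.measurable_fun_sum _ fun o' _ => hf₂m o o'
  have hf₁s : Measurable fun y => ∑ o, ∫⁻ x in D, f₁ y o x :=
    Finset.measurable_fun_sum _ fun o _ => hf₁i o
  -- `Θ y` bounds the squared distance in `L²(D)` from `u` to the rigid motion that interpolates it
  -- on the simplex with corner `y`.
  obtain ⟨Θ, hΘ⟩ : ∃ Θ : Rd d → ℝ≥0∞, Θ = fun y =>
    ENNReal.ofReal K₁ * (∑ o, ∫⁻ x in D, f₁ y o x) +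
    ENNReal.ofReal K₂ * volume D * ∑ o, ∑ o', f₂ y o o' := ⟨_, rfl⟩
  have hΘm : Measurable Θ := by rw [hΘ]; exact (hf₁s.const_mul _).add (hf₂s.const_mul _)
  have hΘi : ∫⁻ y in B, Θ y ≤ K₃ * I := by
    have b1 : ∀ o, ∫⁻ y in B, ∫⁻ x in D, f₁ y o x ≤
        ENNReal.ofReal (M ^ 4) * (2 ^ d * (volume D + volume B)) * I := fun o => by
      rw [hf₁, hI]
      refine lintegral_sq_inner_segment_le hu hD hBm hE (vertex h o)
        (fun x hx y hy => ?_) fun x hx y hy t ht => hseg x hx _ (hmemb y hy o) t ht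
      rw [norm_sub_rev]
      exact hM x hx y hy o
    have b2 : ∀ o o', ∫⁻ y in B, f₂ y o o' ≤ ENNReal.ofReal ((2 * h) ^ 4) * I := fun o o' => by
      rw [hf₂, hI]
      refine (lintegral_sq_inner_offset_le hu (vertex h o) (vertex h o') hBm hE
        fun y hy t ht => ?_).trans ?_
      · have := hseg _ (hsub (hmemb y hy o)) _ (hmemb y hy o') t ht
        rwa [add_sub_add_left_eq_sub, add_assoc] at this
      · gcongr
        refine (norm_sub_le _ _).trans ?_
        linarith [norm_vertex_le hh0.le o, norm_vertex_le hh0.le o']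
    rw [hΘ, lintegral_add_left (hf₁s.const_mul _), lintegral_const_mul _ hf₁s,
      lintegral_const_mul _ hf₂s, lintegral_finsetSum _ fun o _ => hf₁i o,
      lintegral_finsetSum _ fun o _ => Finset.measurable_fun_sum _ fun o' _ => hf₂m o o']
    simp_rw [lintegral_finsetSum _ fun o' _ => hf₂m _ o']
    rw [hK₃, add_mul]
    refine add_le_add ?_ ?_
    · rw [mul_assoc, mul_assoc]
      refine mul_le_mul' le_rfl ?_
      refine (Finset.sum_le_sum fun o _ => b1 o).trans (le_of_eq ?_)
      simp [mul_assoc]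
    · rw [mul_assoc _ _ I]
      refine mul_le_mul' le_rfl ?_
      refine (Finset.sum_le_sum fun o _ => Finset.sum_le_sum fun o' _ => b2 o o').trans
        (le_of_eq ?_)
      simp [mul_assoc]
  -- Some corner does no worse than the average over `B`; its interpolating motion is the one
  -- sought.
  obtain ⟨y, hy, hyle⟩ := exists_le_setLAverage (μ := volume) hvol.ne' hvol'.ne
    (hΘm.aemeasurable)
  rw [setLAverage_eq] at hyle
  obtain ⟨r, hr, hrle⟩ := exists_rigid_norm_sq_le u y (M := M) hh0
  refine ⟨r, hr, ?_⟩
  have hfin : Θ y ≤ K₃ / volume B * I := by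
    refine hyle.trans ?_
    rw [← ENNReal.mul_div_right_comm]
    exact ENNReal.div_le_div_right hΘi _
  refine le_trans ?_ hfin
  have key : ∀ x ∈ D, ENNReal.ofReal (‖u x - r x‖ ^ 2) ≤
      ENNReal.ofReal K₁ * ∑ o, f₁ y o x + ENNReal.ofReal K₂ * ∑ o, ∑ o', f₂ y o o' := by
    intro x hx
    have e1 := hrle x fun o => hM x hx y hy o
    rw [← hK₂, ← hK₁] at e1
    simp only [hf₁, hf₂]
    simp_rw [← ENNReal.ofReal_sum_of_nonneg fun (o : Option (Fin d)) (_ : o ∈ Finset.univ) =>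
      sq_nonneg _]
    rw [← ENNReal.ofReal_sum_of_nonneg fun _ _ => Finset.sum_nonneg fun _ _ => sq_nonneg _,
      ← ENNReal.ofReal_mul hK₁0, ← ENNReal.ofReal_mul hK₂0,
      ← ENNReal.ofReal_add (mul_nonneg hK₁0 (Finset.sum_nonneg fun _ _ => sq_nonneg _))
        (mul_nonneg hK₂0 (Finset.sum_nonneg fun _ _ => Finset.sum_nonneg fun _ _ => sq_nonneg _))]
    exact ENNReal.ofReal_le_ofReal e1
  have hf₁y : ∀ o, Measurable (f₁ y o) := fun o => (hf₁m o).comp measurable_prodMk_left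
  refine (setLIntegral_mono' hD key).trans (le_of_eq ?_)
  rw [lintegral_add_right _ measurable_const,
    lintegral_const_mul _ (Finset.measurable_fun_sum _ fun o _ => hf₁y o),
    lintegral_finsetSum _ fun o _ => hf₁y o, setLIntegral_const, hΘ]
  ring

/-- Two sets whose intersection contains a ball. -/
lemma KornOn.union {D₁ D₂ E₁ E₂ : Set (Rd d)} (h₁ : KornOn D₁ E₁) (h₂ : KornOn D₂ E₂)
    (hD : MeasurableSet D₂) (hDb : Bornology.IsBounded D₂) (c : Rd d) {s : ℝ} (hs : 0 < s)
    (hc₁ : Metric.ball c s ⊆ D₁) (hc₂ : Metric.ball c s ⊆ D₂) :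
    KornOn (D₁ ∪ D₂) (E₁ ∪ E₂) := by
  obtain ⟨C₁, hC₁⟩ := h₁
  obtain ⟨C₂, hC₂⟩ := h₂
  obtain ⟨C, hC⟩ := exists_lintegral_rigid_le hD hDb c hs
  refine ⟨C₁ + (2 * C₂ + 2 * (C * (2 * C₁ + 2 * C₂))), fun u hu => ?_⟩
  obtain ⟨r₁, hr₁, hle₁⟩ := hC₁ u hu
  obtain ⟨r₂, hr₂, hle₂⟩ := hC₂ u hu
  -- The motion of `D₁` serves the union. On the common ball both motions are close to `u`, hence to
  -- each other, and their difference, being rigid, is then controlled on all of `D₂`.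
  refine ⟨r₁, hr₁, ?_⟩
  set I := ∫⁻ x in E₁ ∪ E₂, ENNReal.ofReal (strain u x) with hI
  replace hle₁ : ∫⁻ x in D₁, ENNReal.ofReal (‖u x - r₁ x‖ ^ 2) ≤ C₁ * I :=
    hle₁.trans (mul_le_mul' le_rfl (lintegral_mono_set Set.subset_union_left))
  replace hle₂ : ∫⁻ x in D₂, ENNReal.ofReal (‖u x - r₂ x‖ ^ 2) ≤ C₂ * I :=
    hle₂.trans (mul_le_mul' le_rfl (lintegral_mono_set Set.subset_union_right))
  have hcu := hu.continuous
  have hc1 := hr₁.contDiff.continuous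
  have hc2 := hr₂.contDiff.continuous
  have htri : ∀ a b c : Rd d, ENNReal.ofReal (‖a - c‖ ^ 2) ≤
      2 * ENNReal.ofReal (‖a - b‖ ^ 2) + 2 * ENNReal.ofReal (‖b - c‖ ^ 2) := fun a b c => by
    have h2 : (2 : ℝ≥0∞) = ENNReal.ofReal (2 : ℝ) := by simp
    simp only [h2]
    rw [← ENNReal.ofReal_mul (by norm_num),
      ← ENNReal.ofReal_mul (by norm_num), ← ENNReal.ofReal_add (by positivity) (by positivity)]
    refine ENNReal.ofReal_le_ofReal ?_
    have h1 : ‖a - c‖ ≤ ‖a - b‖ + ‖b - c‖ := norm_sub_le_norm_sub_add_norm_sub a b c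
    nlinarith [norm_nonneg (a - c), sq_nonneg (‖a - b‖ - ‖b - c‖)]
  have htri' : ∀ (X : Set (Rd d)) (f g k : Rd d → Rd d), Continuous f → Continuous g →
      Continuous k → ∫⁻ x in X, ENNReal.ofReal (‖f x - k x‖ ^ 2) ≤
        2 * (∫⁻ x in X, ENNReal.ofReal (‖f x - g x‖ ^ 2)) +
        2 * ∫⁻ x in X, ENNReal.ofReal (‖g x - k x‖ ^ 2) := by
    intro X f g k hf hg hk
    refine (lintegral_mono fun x => htri (f x) (g x) (k x)).trans (le_of_eq ?_)
    have m1 : Measurable fun x => ENNReal.ofReal (‖f x - g x‖ ^ 2) :=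
      (Continuous.measurable (by fun_prop)).ennreal_ofReal
    have m2 : Measurable fun x => ENNReal.ofReal (‖g x - k x‖ ^ 2) :=
      (Continuous.measurable (by fun_prop)).ennreal_ofReal
    rw [lintegral_add_left (m1.const_mul _), lintegral_const_mul _ m1, lintegral_const_mul _ m2]
  have hball : ∫⁻ x in Metric.ball c s, ENNReal.ofReal (‖r₂ x - r₁ x‖ ^ 2) ≤
      (2 * C₁ + 2 * C₂) * I := by
    refine (htri' _ r₂ u r₁ hc2 hcu hc1).trans ?_
    simp_rw [norm_sub_rev (r₂ _) (u _)]
    calc _ ≤ 2 * (C₂ * I) + 2 * (C₁ * I) := by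
          gcongr 2 * ?_ + 2 * ?_
          · exact (lintegral_mono_set hc₂).trans hle₂
          · exact (lintegral_mono_set hc₁).trans hle₁
      _ = _ := by ring
  calc ∫⁻ x in D₁ ∪ D₂, ENNReal.ofReal (‖u x - r₁ x‖ ^ 2)
      ≤ (∫⁻ x in D₁, ENNReal.ofReal (‖u x - r₁ x‖ ^ 2)) +
        ∫⁻ x in D₂, ENNReal.ofReal (‖u x - r₁ x‖ ^ 2) := lintegral_union_le _ _ _
    _ ≤ C₁ * I + (2 * (C₂ * I) + 2 * (C * ((2 * C₁ + 2 * C₂) * I))) := by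
        gcongr
        refine (htri' _ u r₂ r₁ hcu hc2 hc1).trans ?_
        gcongr
        exact (hC _ (hr₂.sub hr₁)).trans (by gcongr)
    _ = _ := by push_cast; ring

lemma KornOn.ball (c : Rd d) {s : ℝ} (hs : 0 < s) :
    KornOn (Metric.ball c s) (Metric.ball c s) := by
  refine KornOn.of_segment measurableSet_ball Metric.isBounded_ball measurableSet_ball c hs
    subset_rfl fun x hx y hy t ht => ?_
  exact (convex_ball c s).add_smul_sub_mem hx hy ht

/-- Balls around two points of a connected open set are joined by a set on which the
Korn–Poincaré inequality holds. -/
lemma exists_kornOn_ball_union {ω : Set (Rd d)} (ho : IsOpen ω) (hc : IsPreconnected ω)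
    {p q : Rd d} (hp : p ∈ ω) (hq : q ∈ ω) :
    ∃ s > 0, ∃ E ⊆ ω, MeasurableSet E ∧ Bornology.IsBounded E ∧
      KornOn (Metric.ball p s ∪ Metric.ball q s) E := by
  have hmono : ∀ (x : Rd d) {a b : ℝ}, a ≤ b → Metric.ball x a ⊆ Metric.ball x b :=
    fun x a b h => Metric.ball_subset_ball h
  -- A symmetric and transitive relation that holds between nearby points holds throughout a
  -- preconnected set. Transitivity is `KornOn.union` on a ball around the middle point.
  refine hc.induction₂ (fun p q => ∃ s > 0, ∃ E ⊆ ω, MeasurableSet E ∧ Bornology.IsBounded E ∧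
      KornOn (Metric.ball p s ∪ Metric.ball q s) E) ?_ ?_ ?_ hp hq
  · intro x hx
    obtain ⟨e, he, hsub⟩ := Metric.isOpen_iff.1 ho x hx
    filter_upwards [nhdsWithin_le_nhds (Metric.ball_mem_nhds x (half_pos he))] with y hy
    refine ⟨e / 2, half_pos he, Metric.ball x e, hsub, measurableSet_ball, Metric.isBounded_ball,
      (KornOn.ball x he).mono (Set.union_subset (hmono x (by linarith)) ?_) subset_rfl⟩
    refine Metric.ball_subset_ball' ?_
    rw [Metric.mem_ball] at hy
    linarith
  · rintro x y z - - - ⟨s, hs, E, hE, hEm, hEb, hk⟩ ⟨s', hs', E', hE', hEm', hEb', hk'⟩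
    have hm : 0 < min s s' := lt_min hs hs'
    refine ⟨min s s', hm, E ∪ E', Set.union_subset hE hE', hEm.union hEm', hEb.union hEb', ?_⟩
    refine (hk.union hk' (measurableSet_ball.union measurableSet_ball)
      (Metric.isBounded_ball.union Metric.isBounded_ball) y hm ?_ ?_).mono ?_ subset_rfl
    · exact (hmono y (min_le_left _ _)).trans Set.subset_union_right
    · exact (hmono y (min_le_right _ _)).trans Set.subset_union_left
    · refine Set.union_subset ?_ ?_
      · exact (hmono x (min_le_left _ _)).trans (Set.subset_union_left.trans Set.subset_union_left)
      · exact (hmono z (min_le_right _ _)).trans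
          (Set.subset_union_right.trans Set.subset_union_right)
  · rintro x y - - ⟨s, hs, E, hE, hEm, hEb, hk⟩
    exact ⟨s, hs, E, hE, hEm, hEb, by rwa [Set.union_comm]⟩

/-! ### Cutoffs and blending of fields -/

/-- Smooth cutoff between two level sets of a Lipschitz function. -/
lemma exists_smooth_cutoff {g : Rd d → ℝ} {K : NNReal} (hg : LipschitzWith K g) {a b : ℝ}
    (hab : a < b) : ∃ χ : Rd d → ℝ, Smooth χ ∧ (∀ x, 0 ≤ χ x ∧ χ x ≤ 1) ∧
      (∀ x, g x ≤ a → χ x = 0) ∧ (∀ x, b ≤ g x → χ x = 1) ∧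
      ∀ x, ‖fderiv ℝ χ x‖ ≤ 2 * K / (b - a) := by
  have hδ : 0 < b - a := sub_pos.2 hab
  -- Mollification radius: over a distance `η` the function `g` varies by at most `(b - a) / 4`, and
  -- the clipped profile `c` leaves exactly this margin above `a` and below `b`. The `+ 1` allows `K
  -- = 0`.
  set η : ℝ := (b - a) / (4 * (K + 1)) with hη
  have hη0 : 0 < η := by positivity
  have hKη : K * η ≤ (b - a) / 4 := by
    rw [hη, mul_div_assoc', div_le_div_iff₀ (by positivity) (by norm_num)]
    nlinarith [K.coe_nonneg]
  set c : Rd d → ℝ := fun x => max 0 (min 1 ((g x - (a + (b - a) / 4)) / ((b - a) / 2))) with hc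
  have hc0 : ∀ x, 0 ≤ c x := fun x => le_max_left _ _
  have hc1 : ∀ x, c x ≤ 1 := fun x => max_le (by norm_num) (min_le_left _ _)
  have hclip : ∀ x y, |c x - c y| ≤ 2 * K / (b - a) * ‖x - y‖ := fun x y => by
    have h1 : |c x - c y| ≤ |(g x - (a + (b - a) / 4)) / ((b - a) / 2)
        - (g y - (a + (b - a) / 4)) / ((b - a) / 2)| := by
      have h5 := abs_max_sub_max_le_max (0 : ℝ) (min 1 ((g x - (a + (b - a) / 4)) / ((b - a) / 2))) 0
        (min 1 ((g y - (a + (b - a) / 4)) / ((b - a) / 2)))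
      have h6 := abs_min_sub_min_le_max (1 : ℝ) ((g x - (a + (b - a) / 4)) / ((b - a) / 2)) 1
        ((g y - (a + (b - a) / 4)) / ((b - a) / 2))
      rw [sub_self, abs_zero] at h5 h6
      have h7 := h6.trans (max_le (abs_nonneg _) le_rfl)
      exact h5.trans (max_le (abs_nonneg _) h7)
    refine h1.trans ?_
    clear h1
    have h2 := hg.dist_le_mul x y
    rw [Real.dist_eq, dist_eq_norm] at h2
    rw [← sub_div, abs_div, abs_of_pos (by positivity : 0 < (b - a) / 2), div_le_iff₀ (by positivity)]
    have h3 : 2 * K / (b - a) * ‖x - y‖ * ((b - a) / 2) = K * ‖x - y‖ := by field_simp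
    rw [h3]
    refine le_trans (le_of_eq ?_) h2
    congr 1; ring
  have hcc : Continuous c := by
    have := hg.continuous
    fun_prop
  let φ : ContDiffBump (0 : Rd d) := ⟨η / 2, η, by positivity, by linarith⟩
  set k : Rd d → ℝ := φ.normed volume with hk
  have hk0 : ∀ t, 0 ≤ k t := fun t => φ.nonneg_normed t
  have hk1 : ∫ t, k t = 1 := φ.integral_normed
  have hki : Integrable k := φ.integrable_normed
  have hkz : ∀ t, η ≤ ‖t‖ → k t = 0 := fun t ht => by
    have : t ∉ Function.support k := by
      rw [hk, φ.support_normed_eq]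
      simpa using ht
    simpa using this
  have hkc : ∀ x, Integrable fun t => k t * c (x - t) := fun x => by
    refine hki.mul_bdd (c := 1) (Continuous.aestronglyMeasurable (by fun_prop)) ?_
    exact ae_of_all _ fun t => by rw [Real.norm_eq_abs, abs_of_nonneg (hc0 _)]; exact hc1 _
  set χ : Rd d → ℝ := fun x => ∫ t, k t * c (x - t) with hχ
  have hsm : Smooth χ := by
    have := φ.hasCompactSupport_normed (μ := volume) |>.contDiff_convolution_left
      (n := ⊤) (ContinuousLinearMap.mul ℝ ℝ) φ.contDiff_normed
      (hcc.locallyIntegrable (μ := (volume : Measure (Rd d))))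
    exact this
  have hval : ∀ x v, (∀ t, ‖t‖ < η → c (x - t) = v) → χ x = v := fun x v h => by
    have : ∀ t, k t * c (x - t) = k t * v := fun t => by
      rcases lt_or_ge ‖t‖ η with ht | ht
      · rw [h t ht]
      · rw [hkz t ht]; simp
    simp only [hχ, this]
    rw [integral_mul_const, hk1, one_mul]
  have hgt : ∀ x t, ‖t‖ < η → |g (x - t) - g x| ≤ (b - a) / 4 := fun x t ht => by
    have h2 := hg.dist_le_mul (x - t) x
    rw [Real.dist_eq, dist_eq_norm] at h2
    have h3 : ‖x - t - x‖ = ‖t‖ := by rw [← norm_neg]; congr 1; abel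
    rw [h3] at h2
    exact h2.trans ((mul_le_mul_of_nonneg_left ht.le K.coe_nonneg).trans hKη)
  refine ⟨χ, hsm, fun x => ⟨integral_nonneg fun t => mul_nonneg (hk0 t) (hc0 _), ?_⟩,
    fun x hx => ?_, fun x hx => ?_, fun x => ?_⟩
  · rw [← hk1]
    exact integral_mono (hkc x) hki fun t => mul_le_of_le_one_right (hk0 t) (hc1 _)
  · refine hval x 0 fun t ht => ?_
    have h1 := abs_le.1 (hgt x t ht)
    refine max_eq_left ((min_le_right _ _).trans ?_)
    exact div_nonpos_of_nonpos_of_nonneg (by linarith) (by positivity)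
  · refine hval x 1 fun t ht => ?_
    have h1 := abs_le.1 (hgt x t ht)
    have : 1 ≤ (g (x - t) - (a + (b - a) / 4)) / ((b - a) / 2) := by
      rw [le_div_iff₀ (by positivity)]; linarith
    simp only [hc, min_eq_left this]
    norm_num
  · have hlip : LipschitzWith (Real.toNNReal (2 * K / (b - a))) χ := by
      refine LipschitzWith.of_dist_le_mul fun x y => ?_
      rw [Real.coe_toNNReal _ (by positivity), Real.dist_eq, dist_eq_norm]
      simp only [hχ]
      rw [← integral_sub (hkc x) (hkc y), ← Real.norm_eq_abs]
      refine (norm_integral_le_integral_norm _).trans ?_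
      calc ∫ t, ‖k t * c (x - t) - k t * c (y - t)‖
          ≤ ∫ t, k t * (2 * K / (b - a) * ‖x - y‖) := by
            refine integral_mono ((hkc x).sub (hkc y)).norm (hki.mul_const _) fun t => ?_
            simp only
            rw [← mul_sub, norm_mul, Real.norm_of_nonneg (hk0 t)]
            refine mul_le_mul_of_nonneg_left ?_ (hk0 t)
            refine (hclip _ _).trans (le_of_eq ?_)
            rw [sub_sub_sub_cancel_right]
        _ = _ := by rw [integral_mul_const, hk1, one_mul]
    have := norm_fderiv_le_of_lipschitz ℝ (x₀ := x) hlip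
    rwa [Real.coe_toNNReal _ (by positivity)] at this

/-- The cutoff attains its minimum there. With its companion for the value 1, this lets gradients of
products be computed pointwise on the closed sets where a cutoff is 0 or 1. -/
lemma fderiv_eq_zero_of_eq_zero {χ : Rd d → ℝ} (h : ∀ x, 0 ≤ χ x ∧ χ x ≤ 1) {x : Rd d}
    (hx : χ x = 0) : fderiv ℝ χ x = 0 :=
  IsLocalMin.fderiv_eq_zero (Eventually.of_forall fun y => by rw [hx]; exact (h y).1)

lemma fderiv_eq_zero_of_eq_one {χ : Rd d → ℝ} (h : ∀ x, 0 ≤ χ x ∧ χ x ≤ 1) {x : Rd d}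
    (hx : χ x = 1) : fderiv ℝ χ x = 0 :=
  IsLocalMax.fderiv_eq_zero (Eventually.of_forall fun y => by rw [hx]; exact (h y).2)

/-- The tensor product of the gradient of a function with a vector. -/
noncomputable def gradTensor (χ : Rd d → ℝ) (x : Rd d) (v : Rd d) : Matrix (Fin d) (Fin d) ℝ :=
  Matrix.of fun i α => fderiv ℝ χ x (EuclideanSpace.single i 1) * v α

lemma gradTensor_zero_left {χ : Rd d → ℝ} {x : Rd d} (h : fderiv ℝ χ x = 0) (v : Rd d) :
    gradTensor χ x v = 0 := by
  ext i α
  simp [gradTensor, h]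

lemma normSq_gradTensor_le (χ : Rd d → ℝ) (x v : Rd d) :
    normSq (gradTensor χ x v) ≤ d * ‖fderiv ℝ χ x‖ ^ 2 * ‖v‖ ^ 2 := by
  rw [norm_sq_eq_sum]
  calc normSq (gradTensor χ x v)
      = (∑ i : Fin d, (fderiv ℝ χ x (EuclideanSpace.single i 1)) ^ 2) * ∑ α, v α ^ 2 := by
        simp only [normSq, gradTensor, Matrix.of_apply, mul_pow, Finset.sum_mul_sum]
    _ ≤ (∑ _i : Fin d, ‖fderiv ℝ χ x‖ ^ 2) * ∑ α, v α ^ 2 := by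
        refine mul_le_mul_of_nonneg_right (Finset.sum_le_sum fun i _ => ?_)
          (Finset.sum_nonneg fun _ _ => sq_nonneg _)
        have h1 := (fderiv ℝ χ x).le_opNorm (EuclideanSpace.single i 1)
        simp only [Real.norm_eq_abs, PiLp.norm_single, norm_one, mul_one] at h1
        rw [← sq_abs]
        exact pow_le_pow_left₀ (abs_nonneg _) (by simpa using h1) 2
    _ = _ := by simp

lemma classicalGrad_smul_fun {χ : Rd d → ℝ} {v : Rd d → Rd d} {x : Rd d}
    (hχ : DifferentiableAt ℝ χ x) (hv : DifferentiableAt ℝ v x) :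
    classicalGrad (fun x => χ x • v x) x = χ x • classicalGrad v x + gradTensor χ x (v x) := by
  ext i α
  simp [classicalGrad, gradTensor, fderiv_fun_smul hχ hv]

lemma classicalGrad_translate (u : Rd d → Rd d) (c x : Rd d) :
    classicalGrad (fun x => u (x + c)) x = classicalGrad u (x + c) := by
  ext i α
  simp [classicalGrad, fderiv_comp_add_right]

lemma classicalGrad_const_smul {u : Rd d → Rd d} {x : Rd d} (c : ℝ)
    (hu : DifferentiableAt ℝ u x) :
    classicalGrad (fun x => c • u x) x = c • classicalGrad u x := by
  ext i α
  simp [classicalGrad, fderiv_fun_const_smul hu]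

/-- The sum of the strain and the square of a field. -/
noncomputable def dens (u : Rd d → Rd d) (x : Rd d) : ℝ := strain u x + ‖u x‖ ^ 2

lemma dens_nonneg (u : Rd d → Rd d) (x : Rd d) : 0 ≤ dens u x :=
  add_nonneg (strain_nonneg u x) (sq_nonneg _)

lemma continuous_dens {u : Rd d → Rd d} (hu : Smooth u) : Continuous (dens u) :=
  (continuous_strain hu).add (hu.continuous.norm.pow 2)

lemma measurable_ofReal_dens {u : Rd d → Rd d} (hu : Smooth u) :
    Measurable fun x => ENNReal.ofReal (dens u x) :=
  (continuous_dens hu).measurable.ennreal_ofReal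

lemma norm_add_sq_le_two (a b : Rd d) : ‖a + b‖ ^ 2 ≤ 2 * ‖a‖ ^ 2 + 2 * ‖b‖ ^ 2 := by
  nlinarith [norm_add_le a b, norm_nonneg (a + b), sq_nonneg (‖a‖ - ‖b‖)]

lemma classicalGrad_blend {χ : Rd d → ℝ} {v w : Rd d → Rd d} (hχ : Smooth χ) (hv : Smooth v)
    (hw : Smooth w) (x : Rd d) :
    classicalGrad (fun x => χ x • v x + (1 - χ x) • w x) x
      = (χ x • classicalGrad v x + (1 - χ x) • classicalGrad w x)
        + gradTensor χ x (v x - w x) := by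
  have dχ := hχ.differentiable (by simp) x
  have dv := hv.differentiable (by simp) x
  have dw := hw.differentiable (by simp) x
  rw [classicalGrad_add_fun (dχ.fun_smul dv) ((dχ.const_sub 1).fun_smul dw),
    classicalGrad_smul_fun dχ dv, classicalGrad_smul_fun (dχ.const_sub 1) dw]
  ext i α
  simp [gradTensor, fderiv_const_sub]
  ring

/-- A convex combination of two fields with variable coefficient. -/
lemma dens_blend_le {χ : Rd d → ℝ} {v w : Rd d → Rd d} (hχ : Smooth χ) (hv : Smooth v)
    (hw : Smooth w) {x : Rd d} (h01 : 0 ≤ χ x ∧ χ x ≤ 1) :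
    dens (fun x => χ x • v x + (1 - χ x) • w x) x ≤
      4 * dens v x + 4 * dens w x + 2 * (d * ‖fderiv ℝ χ x‖ ^ 2 * ‖v x - w x‖ ^ 2) := by
  have e1 := classicalGrad_blend hχ hv hw x
  have e2 : strain (fun x => χ x • v x + (1 - χ x) • w x) x ≤
      4 * strain v x + 4 * strain w x + 2 * (d * ‖fderiv ℝ χ x‖ ^ 2 * ‖v x - w x‖ ^ 2) := by
    unfold strain
    rw [e1]
    have b1 := symSq_add_le (χ x • classicalGrad v x + (1 - χ x) • classicalGrad w x)
      (gradTensor χ x (v x - w x))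
    have b2 := symSq_add_le (χ x • classicalGrad v x) ((1 - χ x) • classicalGrad w x)
    rw [symSq_smul, symSq_smul] at b2
    have b3 := (symSq_le_normSq _).trans (normSq_gradTensor_le χ x (v x - w x))
    have c1 : χ x ^ 2 ≤ 1 := by nlinarith [h01.1, h01.2]
    have c2 : (1 - χ x) ^ 2 ≤ 1 := by nlinarith [h01.1, h01.2]
    have c3 := mul_le_mul_of_nonneg_right c1 (symSq_nonneg (classicalGrad v x))
    have c4 := mul_le_mul_of_nonneg_right c2 (symSq_nonneg (classicalGrad w x))
    linarith
  have e3 : ‖χ x • v x + (1 - χ x) • w x‖ ^ 2 ≤ 2 * ‖v x‖ ^ 2 + 2 * ‖w x‖ ^ 2 := by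
    refine (norm_add_sq_le_two _ _).trans ?_
    rw [norm_smul, norm_smul, mul_pow, mul_pow, Real.norm_eq_abs, Real.norm_eq_abs, sq_abs, sq_abs]
    have c1 : χ x ^ 2 ≤ 1 := by nlinarith [h01.1, h01.2]
    have c2 : (1 - χ x) ^ 2 ≤ 1 := by nlinarith [h01.1, h01.2]
    have c3 := mul_le_mul_of_nonneg_right c1 (sq_nonneg ‖v x‖)
    have c4 := mul_le_mul_of_nonneg_right c2 (sq_nonneg ‖w x‖)
    linarith
  simp only [dens]
  linarith [sq_nonneg ‖v x‖, sq_nonneg ‖w x‖]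

lemma blend_eq_right {χ : Rd d → ℝ} {v w : Rd d → Rd d} (hχ : Smooth χ) (hv : Smooth v)
    (hw : Smooth w) {x : Rd d} (h01 : ∀ x, 0 ≤ χ x ∧ χ x ≤ 1) (hx : χ x = 0) :
    (fun x => χ x • v x + (1 - χ x) • w x) x = w x ∧
    classicalGrad (fun x => χ x • v x + (1 - χ x) • w x) x = classicalGrad w x := by
  refine ⟨by simp [hx], ?_⟩
  rw [classicalGrad_blend hχ hv hw, gradTensor_zero_left (fderiv_eq_zero_of_eq_zero h01 hx), hx]
  simp

lemma blend_eq_left {χ : Rd d → ℝ} {v w : Rd d → Rd d} (hχ : Smooth χ) (hv : Smooth v)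
    (hw : Smooth w) {x : Rd d} (h01 : ∀ x, 0 ≤ χ x ∧ χ x ≤ 1) (hx : χ x = 1) :
    (fun x => χ x • v x + (1 - χ x) • w x) x = v x ∧
    classicalGrad (fun x => χ x • v x + (1 - χ x) • w x) x = classicalGrad v x := by
  refine ⟨by simp [hx], ?_⟩
  rw [classicalGrad_blend hχ hv hw, gradTensor_zero_left (fderiv_eq_zero_of_eq_one h01 hx), hx]
  simp

lemma dens_congr {v w : Rd d → Rd d} {x : Rd d} (h : v x = w x)
    (h' : classicalGrad v x = classicalGrad w x) : dens v x = dens w x := by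
  simp only [dens, strain, h, h']

/-! ### Extension across a Lipschitz graph -/

/-- Combination of two translates of a field that reproduces affine fields. -/
noncomputable def shiftComb (ν : Rd d) (S : ℝ) (u : Rd d → Rd d) (x : Rd d) : Rd d :=
  (2 : ℝ) • u (x + (-(8 * S)) • ν) + (-1 : ℝ) • u (x + (-(16 * S)) • ν)

lemma smooth_shiftComb (ν : Rd d) (S : ℝ) {u : Rd d → Rd d} (hu : Smooth u) :
    Smooth (shiftComb ν S u) := by
  have h : ∀ c : Rd d, Smooth fun x => u (x + c) := fun c =>
    hu.comp (contDiff_id.add contDiff_const)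
  exact ((h _).const_smul (2 : ℝ)).add ((h _).const_smul (-1 : ℝ))

lemma dens_shiftComb_le (ν : Rd d) (S : ℝ) {u : Rd d → Rd d} (hu : Smooth u) (x : Rd d) :
    dens (shiftComb ν S u) x ≤
      8 * dens u (x + (-(8 * S)) • ν) + 2 * dens u (x + (-(16 * S)) • ν) := by
  have h : ∀ c : Rd d, DifferentiableAt ℝ (fun x => u (x + c)) x := fun c =>
    (hu.comp (contDiff_id.add contDiff_const)).differentiable (by simp) x
  have e1 : strain (shiftComb ν S u) x ≤
      8 * strain u (x + (-(8 * S)) • ν) + 2 * strain u (x + (-(16 * S)) • ν) := by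
    unfold strain shiftComb
    rw [classicalGrad_add_fun ((h _).fun_const_smul (2 : ℝ)) ((h _).fun_const_smul (-1 : ℝ)),
      classicalGrad_const_smul _ (h _), classicalGrad_const_smul _ (h _), classicalGrad_translate,
      classicalGrad_translate]
    refine (symSq_add_le _ _).trans (le_of_eq ?_)
    rw [symSq_smul, symSq_smul]; ring
  have e2 : ‖shiftComb ν S u x‖ ^ 2 ≤
      8 * ‖u (x + (-(8 * S)) • ν)‖ ^ 2 + 2 * ‖u (x + (-(16 * S)) • ν)‖ ^ 2 := by
    refine (norm_add_sq_le_two _ _).trans (le_of_eq ?_)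
    rw [norm_smul, norm_smul, mul_pow, mul_pow]; norm_num; ring
  simp only [dens]
  linarith

/-- The coefficients 3, −1, −2 sum to zero, and so do their products with the shifts 8, 16, 4.
Affine fields are therefore annihilated, which is why strain alone can bound the difference. -/
lemma shiftComb_sub (ν : Rd d) (S : ℝ) (u : Rd d → Rd d) (x : Rd d) :
    shiftComb ν S u x - shiftComb ν (S / 2) u x =
      (3 : ℝ) • u (x + (-(8 * S)) • ν) - u (x + (-(16 * S)) • ν)
        - (2 : ℝ) • u (x + (-(4 * S)) • ν) := by
  unfold shiftComb
  rw [show 8 * (S / 2) = 4 * S by ring, show 16 * (S / 2) = 8 * S by ring]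
  module

/-- A combination of three translates that annihilates affine fields is controlled by strains. -/
lemma sq_shift_difference_le (u : Rd d → Rd d) {ν : Rd d} {S b : ℝ} (x : Rd d) (i : Fin d) :
    (b * S * ((3 : ℝ) • u (x + (-(8 * S)) • ν) - u (x + (-(16 * S)) • ν)
        - (2 : ℝ) • u (x + (-(4 * S)) • ν)) i) ^ 2 ≤
      36 * ((inner ℝ (u (x + (-(16 * S)) • ν) - u (x + (-(4 * S)) • ν))
          ((-(16 * S)) • ν - (-(4 * S)) • ν)) ^ 2
        + (inner ℝ (u (x + (-(4 * S)) • ν) -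
            u (x + ((-(8 * S)) • ν + EuclideanSpace.single i (b * S))))
          ((-(4 * S)) • ν - ((-(8 * S)) • ν + EuclideanSpace.single i (b * S)))) ^ 2
        + (inner ℝ (u (x + (-(8 * S)) • ν) -
            u (x + ((-(8 * S)) • ν + EuclideanSpace.single i (b * S))))
          ((-(8 * S)) • ν - ((-(8 * S)) • ν + EuclideanSpace.single i (b * S)))) ^ 2
        + (inner ℝ (u (x + (-(16 * S)) • ν) -
            u (x + ((-(8 * S)) • ν + EuclideanSpace.single i (b * S))))
          ((-(16 * S)) • ν - ((-(8 * S)) • ν + EuclideanSpace.single i (b * S)))) ^ 2) := by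
  generalize u (x + (-(8 * S)) • ν) = u8
  generalize u (x + (-(16 * S)) • ν) = u16
  generalize u (x + (-(4 * S)) • ν) = u4
  generalize u (x + ((-(8 * S)) • ν + EuclideanSpace.single i (b * S))) = q
  simp only [inner_sub_right, inner_sub_left, inner_add_right, inner_smul_right,
    EuclideanSpace.inner_single_right, conj_trivial, PiLp.sub_apply, PiLp.smul_apply, smul_eq_mul]
  generalize inner ℝ u4 ν = n4
  generalize inner ℝ u8 ν = n8
  generalize inner ℝ u16 ν = n16
  generalize inner ℝ q ν = nq
  generalize u4 i = c4
  generalize u8 i = c8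
  generalize u16 i = c16
  generalize q i = cq
  generalize hg : -(16 * S) * (n16 - n4) - -(4 * S) * (n16 - n4) = g
  generalize hf4 : -(4 * S) * (n4 - nq) -
    (-(8 * S) * (n4 - nq) + (b * S * c4 - b * S * cq)) = f4
  generalize hf8 : -(8 * S) * (n8 - nq) -
    (-(8 * S) * (n8 - nq) + (b * S * c8 - b * S * cq)) = f8
  generalize hf16 : -(16 * S) * (n16 - nq) -
    (-(8 * S) * (n16 - nq) + (b * S * c16 - b * S * cq)) = f16
  -- The collinear increment `g` sees only the component along `ν`. The auxiliary point, off the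
  -- line by `b * S` in direction `i`, brings in component `i`; the weights make the value there and
  -- all the `ν`-components cancel.
  have key : b * S * (3 * c8 - c16 - 2 * c4) = -(2 / 3) * g + 2 * f4 - 3 * f8 + f16 := by
    rw [← hg, ← hf4, ← hf8, ← hf16]; ring
  rw [key]
  nlinarith [sq_nonneg (-(2 / 3) * g - 2 * f4), sq_nonneg (-(2 / 3) * g + 3 * f8),
    sq_nonneg (-(2 / 3) * g - f16), sq_nonneg (2 * f4 + 3 * f8), sq_nonneg (2 * f4 - f16),
    sq_nonneg (3 * f8 + f16), sq_nonneg g, sq_nonneg f4, sq_nonneg f8, sq_nonneg f16]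

lemma lintegral_const_mul_add_four {μ : Measure (Rd d)} (c : ℝ≥0∞) {f g h k : Rd d → ℝ≥0∞}
    (hf : Measurable f) (hg : Measurable g) (hh : Measurable h) (hk : Measurable k) :
    ∫⁻ x, c * (f x + g x + h x + k x) ∂μ =
      c * ((∫⁻ x, f x ∂μ) + (∫⁻ x, g x ∂μ) + (∫⁻ x, h x ∂μ) + ∫⁻ x, k x ∂μ) := by
  have hm : Measurable fun x => f x + g x + h x + k x := ((hf.add hg).add hh).add hk
  rw [lintegral_const_mul _ hm, lintegral_add_right _ hk,
    lintegral_add_right _ hh, lintegral_add_right _ hg]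

/-- Segments of length at most `12 * S` contribute a fourth power, and dividing by `(b * S) ^ 2`
leaves `S ^ 2`: exactly what compensates the squared slope of a cutoff at scale `S`. The 144 is the
pointwise factor 36 for four increments. -/
lemma lintegral_shift_difference_le {u : Rd d → Rd d} (hu : Smooth u) {ν : Rd d} (hν : ‖ν‖ = 1)
    {S b : ℝ} (hS : 0 < S) (hb : 0 < b) (hb1 : b ≤ 1) {X Y : Set (Rd d)} (hX : MeasurableSet X)
    (hY : MeasurableSet Y)
    (hXY : ∀ x ∈ X, ∀ τ ∈ Set.Icc (4 : ℝ) 16, ∀ β ∈ Set.Icc 0 b, ∀ i,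
      x + ((-(τ * S)) • ν + EuclideanSpace.single i (β * S)) ∈ Y) :
    ∫⁻ x in X, ENNReal.ofReal (‖shiftComb ν S u x - shiftComb ν (S / 2) u x‖ ^ 2) ≤
      ENNReal.ofReal (d * (144 * 12 ^ 4) / b ^ 2 * S ^ 2) *
        ∫⁻ x in Y, ENNReal.ofReal (strain u x) := by
  obtain ⟨J, hJ⟩ : ∃ J, J = ∫⁻ x in Y, ENNReal.ofReal (strain u x) := ⟨_, rfl⟩
  have huc := hu.continuous
  have hpair : ∀ a c : Rd d, ‖c - a‖ ≤ 12 * S →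
      (∀ x ∈ X, ∀ t ∈ Set.Icc (0 : ℝ) 1, x + (a + t • (c - a)) ∈ Y) →
      ∫⁻ x in X, ENNReal.ofReal ((inner ℝ (u (x + c) - u (x + a)) (c - a)) ^ 2) ≤
        ENNReal.ofReal ((12 * S) ^ 4) * J := fun a c hac hseg => by
    rw [hJ]
    refine (lintegral_sq_inner_offset_le hu a c hX hY hseg).trans ?_
    gcongr
  have hcomp : ∀ i : Fin d, ∫⁻ x in X, ENNReal.ofReal
      ((b * S * (shiftComb ν S u x - shiftComb ν (S / 2) u x) i) ^ 2) ≤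
      ENNReal.ofReal (144 * (12 * S) ^ 4) * J := by
    intro i
    have hm : ∀ a c : Rd d, Measurable fun x =>
        ENNReal.ofReal ((inner ℝ (u (x + c) - u (x + a)) (c - a)) ^ 2) := fun a c =>
      (Continuous.measurable (by fun_prop)).ennreal_ofReal
    have hq : ∀ k : ℝ, k ∈ Set.Icc (4 : ℝ) 16 →
        ∫⁻ x in X, ENNReal.ofReal ((inner ℝ (u (x + (-(k * S)) • ν) -
            u (x + ((-(8 * S)) • ν + EuclideanSpace.single i (b * S))))
          ((-(k * S)) • ν - ((-(8 * S)) • ν + EuclideanSpace.single i (b * S)))) ^ 2) ≤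
        ENNReal.ofReal ((12 * S) ^ 4) * J := fun k hk => by
      refine hpair _ _ ?_ fun x hx t ht => ?_
      · have e : (-(k * S)) • ν - ((-(8 * S)) • ν + EuclideanSpace.single i (b * S))
            = ((8 - k) * S) • ν - EuclideanSpace.single i (b * S) := by module
        rw [e]
        refine (norm_sub_le _ _).trans ?_
        rw [norm_smul, hν, PiLp.norm_single, Real.norm_eq_abs, Real.norm_eq_abs, abs_mul,
          abs_of_pos hS, abs_of_pos (by positivity : 0 < b * S)]
        have : |8 - k| ≤ 8 := abs_le.2 ⟨by linarith [hk.2], by linarith [hk.1]⟩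
        nlinarith
      · have := hXY x hx (8 + t * (k - 8)) ⟨by nlinarith [hk.1, ht.1, ht.2],
          by nlinarith [hk.2, ht.1, ht.2]⟩ ((1 - t) * b) ⟨mul_nonneg (by linarith [ht.2]) hb.le,
          by nlinarith [ht.1]⟩ i
        convert this using 2
        have e : (EuclideanSpace.single i ((1 - t) * b * S) : Rd d)
          = (1 - t) • EuclideanSpace.single i (b * S) := by
          ext j
          by_cases hj : j = i <;> simp [hj, mul_assoc]
        rw [e]
        module
    have h16 : ∫⁻ x in X, ENNReal.ofReal ((inner ℝ (u (x + (-(16 * S)) • ν) -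
          u (x + (-(4 * S)) • ν)) ((-(16 * S)) • ν - (-(4 * S)) • ν)) ^ 2) ≤
        ENNReal.ofReal ((12 * S) ^ 4) * J := by
      refine hpair _ _ ?_ fun x hx t ht => ?_
      · rw [← sub_smul, norm_smul, hν, Real.norm_eq_abs, show -(16 * S) - -(4 * S) = -(12 * S) by ring,
          abs_neg, abs_of_pos (by positivity), mul_one]
      · have := hXY x hx (4 + t * 12) ⟨by linarith [ht.1], by linarith [ht.2]⟩ 0 ⟨le_rfl, hb.le⟩ i
        convert this using 2
        simp only [zero_mul]
        have e : (EuclideanSpace.single i (0 : ℝ) : Rd d) = 0 := by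
          simp
        rw [e]
        module
    have h4 := hq 4 ⟨le_rfl, by norm_num⟩
    have h8 := hq 8 ⟨by norm_num, by norm_num⟩
    have h16' := hq 16 ⟨by norm_num, le_rfl⟩
    calc _ ≤ ∫⁻ x in X, ENNReal.ofReal 36 * (ENNReal.ofReal ((inner ℝ (u (x + (-(16 * S)) • ν)
              - u (x + (-(4 * S)) • ν)) ((-(16 * S)) • ν - (-(4 * S)) • ν)) ^ 2)
          + ENNReal.ofReal ((inner ℝ (u (x + (-(4 * S)) • ν) -
            u (x + ((-(8 * S)) • ν + EuclideanSpace.single i (b * S))))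
          ((-(4 * S)) • ν - ((-(8 * S)) • ν + EuclideanSpace.single i (b * S)))) ^ 2)
          + ENNReal.ofReal ((inner ℝ (u (x + (-(8 * S)) • ν) -
            u (x + ((-(8 * S)) • ν + EuclideanSpace.single i (b * S))))
          ((-(8 * S)) • ν - ((-(8 * S)) • ν + EuclideanSpace.single i (b * S)))) ^ 2)
          + ENNReal.ofReal ((inner ℝ (u (x + (-(16 * S)) • ν) -
            u (x + ((-(8 * S)) • ν + EuclideanSpace.single i (b * S))))
          ((-(16 * S)) • ν - ((-(8 * S)) • ν + EuclideanSpace.single i (b * S)))) ^ 2)) := by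
          refine lintegral_mono fun x => ?_
          rw [← ENNReal.ofReal_add (by positivity) (by positivity),
            ← ENNReal.ofReal_add (by positivity) (by positivity),
            ← ENNReal.ofReal_add (by positivity) (by positivity),
            ← ENNReal.ofReal_mul (by norm_num), shiftComb_sub]
          exact ENNReal.ofReal_le_ofReal (sq_shift_difference_le u x i)
      _ ≤ ENNReal.ofReal 36 * (ENNReal.ofReal ((12 * S) ^ 4) * J
            + ENNReal.ofReal ((12 * S) ^ 4) * J + ENNReal.ofReal ((12 * S) ^ 4) * J
            + ENNReal.ofReal ((12 * S) ^ 4) * J) := by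
          refine (lintegral_const_mul_add_four _
            (hm ((-(4 * S)) • ν) ((-(16 * S)) • ν))
            (hm ((-(8 * S)) • ν + EuclideanSpace.single i (b * S)) ((-(4 * S)) • ν))
            (hm ((-(8 * S)) • ν + EuclideanSpace.single i (b * S)) ((-(8 * S)) • ν))
            (hm ((-(8 * S)) • ν + EuclideanSpace.single i (b * S)) ((-(16 * S)) • ν))).trans_le ?_
          exact mul_le_mul' le_rfl (add_le_add (add_le_add (add_le_add h16 h4) h8) h16')
      _ = _ := by
          rw [ENNReal.ofReal_mul (by norm_num : (0 : ℝ) ≤ 144),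
            show (144 : ℝ) = 36 * 4 by norm_num, ENNReal.ofReal_mul (by norm_num : (0 : ℝ) ≤ 36)]
          have : ENNReal.ofReal 4 = 4 := by simp
          rw [this]; ring
  have hbS : 0 < b * S := by positivity
  have hmi : ∀ i : Fin d, Measurable fun x => ENNReal.ofReal
      ((b * S * (shiftComb ν S u x - shiftComb ν (S / 2) u x) i) ^ 2) := fun i => by
    have c1 := (smooth_shiftComb ν S hu).continuous
    have c2 := (smooth_shiftComb ν (S / 2) hu).continuous
    exact (Continuous.measurable (by fun_prop)).ennreal_ofReal
  calc ∫⁻ x in X, ENNReal.ofReal (‖shiftComb ν S u x - shiftComb ν (S / 2) u x‖ ^ 2)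
      = ∫⁻ x in X, ENNReal.ofReal (1 / (b * S) ^ 2) * ∑ i, ENNReal.ofReal
          ((b * S * (shiftComb ν S u x - shiftComb ν (S / 2) u x) i) ^ 2) := by
        refine lintegral_congr fun x => ?_
        rw [← ENNReal.ofReal_sum_of_nonneg fun _ _ => sq_nonneg _,
          ← ENNReal.ofReal_mul (by positivity), norm_sq_eq_sum]
        simp only [mul_pow _ _ 2, ← Finset.mul_sum]
        congr 1
        field_simp
    _ ≤ ENNReal.ofReal (1 / (b * S) ^ 2) * ∑ _i : Fin d, ENNReal.ofReal (144 * (12 * S) ^ 4) * J := by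
        rw [lintegral_const_mul _ (Finset.measurable_fun_sum _ fun i _ => hmi i),
          lintegral_finsetSum _ fun i _ => hmi i]
        gcongr with i
        exact hcomp i
    _ = _ := by
        rw [Finset.sum_const, Finset.card_univ, Fintype.card_fin, nsmul_eq_mul, ← mul_assoc,
          ← mul_assoc, ← hJ, ← ENNReal.ofReal_natCast, ← ENNReal.ofReal_mul (by positivity),
          ← ENNReal.ofReal_mul (by positivity)]
        congr 2
        field_simp

/-- The strain of a blend of two shifted combinations at consecutive scales. -/
lemma lintegral_dens_blend_shiftComb_le {u : Rd d → Rd d} (hu : Smooth u) {ν : Rd d}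
    (hν : ‖ν‖ = 1) {S b c : ℝ} (hS : 0 < S) (hb : 0 < b) (hb1 : b ≤ 1)
    {χ : Rd d → ℝ} (hχ : Smooth χ) (h01 : ∀ x, 0 ≤ χ x ∧ χ x ≤ 1)
    (hχ' : ∀ x, ‖fderiv ℝ χ x‖ ≤ c / S) {X Y : Set (Rd d)} (hX : MeasurableSet X)
    (hY : MeasurableSet Y)
    (hXY₀ : ∀ x ∈ X, ∀ τ ∈ Set.Icc (4 : ℝ) 16, x + (-(τ * S)) • ν ∈ Y)
    (hXY : ∀ x ∈ X, ∀ τ ∈ Set.Icc (4 : ℝ) 16, ∀ β ∈ Set.Icc 0 b, ∀ i,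
      x + ((-(τ * S)) • ν + EuclideanSpace.single i (β * S)) ∈ Y) :
    ∫⁻ x in X, ENNReal.ofReal (dens (fun x => χ x • shiftComb ν S u x +
        (1 - χ x) • shiftComb ν (S / 2) u x) x) ≤
      ENNReal.ofReal (80 + 2 * (d * c ^ 2) * (d * (144 * 12 ^ 4) / b ^ 2)) *
        ∫⁻ x in Y, ENNReal.ofReal (dens u x) := by
  obtain ⟨J, hJ⟩ : ∃ J, J = ∫⁻ x in Y, ENNReal.ofReal (dens u x) := ⟨_, rfl⟩
  have hm : ∀ k : ℝ, Measurable fun x => ENNReal.ofReal (dens u (x + (-(k * S)) • ν)) := fun k =>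
    (measurable_ofReal_dens hu).comp (measurable_add_const _)
  have hshift : ∀ k ∈ Set.Icc (4 : ℝ) 16,
      ∫⁻ x in X, ENNReal.ofReal (dens u (x + (-(k * S)) • ν)) ≤ J := fun k hk => by
    rw [hJ]
    exact setLIntegral_translate_le (fun x => ENNReal.ofReal (dens u x)) _ hX hY
      fun x hx => hXY₀ x hx k hk
  have hD : ∫⁻ x in X, ENNReal.ofReal (‖shiftComb ν S u x - shiftComb ν (S / 2) u x‖ ^ 2) ≤
      ENNReal.ofReal (d * (144 * 12 ^ 4) / b ^ 2 * S ^ 2) * J := by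
    refine (lintegral_shift_difference_le hu hν hS hb hb1 hX hY hXY).trans ?_
    rw [hJ]
    gcongr with x
    exact le_add_of_nonneg_right (sq_nonneg _)
  have hmD : Measurable fun x =>
      ENNReal.ofReal (‖shiftComb ν S u x - shiftComb ν (S / 2) u x‖ ^ 2) := by
    have c1 := (smooth_shiftComb ν S hu).continuous
    have c2 := (smooth_shiftComb ν (S / 2) hu).continuous
    exact (Continuous.measurable (by fun_prop)).ennreal_ofReal
  -- A combination has weights 8 and 2 at its two shifts, and the blend multiplies by 4. The shift
  -- `8 * S` is common to both scales, so the weights are 32, 32 + 8 and 8, with total 80.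
  have hpt : ∀ x, ENNReal.ofReal (dens (fun x => χ x • shiftComb ν S u x +
        (1 - χ x) • shiftComb ν (S / 2) u x) x) ≤
      ENNReal.ofReal 32 * ENNReal.ofReal (dens u (x + (-(4 * S)) • ν)) +
      ENNReal.ofReal 40 * ENNReal.ofReal (dens u (x + (-(8 * S)) • ν)) +
      ENNReal.ofReal 8 * ENNReal.ofReal (dens u (x + (-(16 * S)) • ν)) +
      ENNReal.ofReal (2 * (d * (c / S) ^ 2)) *
        ENNReal.ofReal (‖shiftComb ν S u x - shiftComb ν (S / 2) u x‖ ^ 2) := fun x => by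
    have p4 := dens_nonneg u (x + (-(4 * S)) • ν)
    have p8 := dens_nonneg u (x + (-(8 * S)) • ν)
    have p16 := dens_nonneg u (x + (-(16 * S)) • ν)
    rw [← ENNReal.ofReal_mul (by norm_num), ← ENNReal.ofReal_mul (by norm_num),
      ← ENNReal.ofReal_mul (by norm_num), ← ENNReal.ofReal_mul (by positivity),
      ← ENNReal.ofReal_add (by positivity) (by positivity),
      ← ENNReal.ofReal_add (by positivity) (by positivity),
      ← ENNReal.ofReal_add (by positivity) (by positivity)]
    refine ENNReal.ofReal_le_ofReal ?_
    refine (dens_blend_le hχ (smooth_shiftComb ν S hu) (smooth_shiftComb ν (S / 2) hu)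
      (h01 x)).trans ?_
    have e1 := dens_shiftComb_le ν S hu x
    have e2 := dens_shiftComb_le ν (S / 2) hu x
    rw [show 8 * (S / 2) = 4 * S by ring, show 16 * (S / 2) = 8 * S by ring] at e2
    have e3 : d * ‖fderiv ℝ χ x‖ ^ 2 * ‖shiftComb ν S u x - shiftComb ν (S / 2) u x‖ ^ 2 ≤
        d * (c / S) ^ 2 * ‖shiftComb ν S u x - shiftComb ν (S / 2) u x‖ ^ 2 := by
      gcongr
      exact hχ' x
    linarith
  calc _ ≤ ∫⁻ x in X, _ := lintegral_mono hpt
    _ ≤ ENNReal.ofReal 32 * J + ENNReal.ofReal 40 * J + ENNReal.ofReal 8 * J +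
        ENNReal.ofReal (2 * (d * (c / S) ^ 2)) *
          (ENNReal.ofReal (d * (144 * 12 ^ 4) / b ^ 2 * S ^ 2) * J) := by
        rw [lintegral_add_right _ (hmD.const_mul _), lintegral_add_right _ ((hm 16).const_mul _),
          lintegral_add_right _ ((hm 8).const_mul _), lintegral_const_mul _ hmD,
          lintegral_const_mul _ (hm 16), lintegral_const_mul _ (hm 8), lintegral_const_mul _ (hm 4)]
        gcongr
        · exact hshift 4 ⟨le_rfl, by norm_num⟩
        · exact hshift 8 ⟨by norm_num, by norm_num⟩
        · exact hshift 16 ⟨by norm_num, le_rfl⟩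
    _ = _ := by
        rw [← hJ, ← mul_assoc, ← ENNReal.ofReal_mul (by positivity), ← add_mul, ← add_mul, ← add_mul,
          ← ENNReal.ofReal_add (by norm_num) (by norm_num),
          ← ENNReal.ofReal_add (by norm_num) (by norm_num),
          ← ENNReal.ofReal_add (by norm_num) (by positivity)]
        congr 2
        field_simp
        ring

/-- Successive blending of the fields `T m, T (m+1), …` and finally `u`. -/
def descend (χ : ℕ → Rd d → ℝ) (T : ℕ → Rd d → Rd d) (u : Rd d → Rd d) :
    ℕ → ℕ → Rd d → Rd d
  | 0, _ => u
  | n + 1, m => fun x => χ m x • T m x + (1 - χ m x) • descend χ T u n (m + 1) x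

lemma smooth_descend {χ : ℕ → Rd d → ℝ} {T : ℕ → Rd d → Rd d} {u : Rd d → Rd d}
    (hχ : ∀ m, Smooth (χ m)) (hT : ∀ m, Smooth (T m)) (hu : Smooth u) (n m : ℕ) :
    Smooth (descend χ T u n m) := by
  induction n generalizing m with
  | zero => exact hu
  | succ n ih =>
    exact ((hχ m).smul (hT m)).add ((contDiff_const.sub (hχ m)).smul (ih (m + 1)))

lemma descend_eq {χ : ℕ → Rd d → ℝ} {T : ℕ → Rd d → Rd d} {u : Rd d → Rd d} {x : Rd d} (n m : ℕ)
    (h : ∀ j < n, χ (m + j) x = 0) : descend χ T u n m x = u x := by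
  induction n generalizing m with
  | zero => rfl
  | succ n ih =>
    have h0 := h 0 (Nat.succ_pos n)
    rw [add_zero] at h0
    simp only [descend, h0, zero_smul, sub_zero, one_smul, zero_add]
    exact ih (m + 1) fun j hj => by
      have := h (j + 1) (by omega)
      rwa [show m + (j + 1) = m + 1 + j by ring] at this

/-- Each strip has ratio 16 = 2⁴ between its ends while the index shrinks it by 2, so a point lies
in at most five strips, both extreme indices included. -/
lemma lintegral_sum_dyadic_le {g : Rd d → ℝ≥0∞} (hg : Measurable g) {ρ : Rd d → ℝ}
    (hρ : Measurable ρ) {σ : ℝ} (hσ : 0 < σ) {B : Set (Rd d)} (hB : MeasurableSet B) (n : ℕ) :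
    ∑ j ∈ Finset.range n, ∫⁻ x in B ∩ {x | -(16 * (σ / 2 ^ j)) ≤ ρ x ∧ ρ x ≤ -(σ / 2 ^ j)}, g x ≤
      5 * ∫⁻ x in B ∩ {x | ρ x < 0}, g x := by
  have hm : ∀ j : ℕ, MeasurableSet
      (B ∩ {x | -(16 * (σ / 2 ^ j)) ≤ ρ x ∧ ρ x ≤ -(σ / 2 ^ j)}) := fun j =>
    hB.inter ((measurableSet_le measurable_const hρ).inter (measurableSet_le hρ measurable_const))
  have hm0 : MeasurableSet (B ∩ {x | ρ x < 0}) := hB.inter (measurableSet_lt hρ measurable_const)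
  simp_rw [← lintegral_indicator (hm _)]
  rw [← lintegral_indicator hm0, ← lintegral_finsetSum _ fun j _ => hg.indicator (hm j),
    ← lintegral_const_mul _ (hg.indicator hm0)]
  refine lintegral_mono fun x => ?_
  classical
  simp only [Set.indicator_apply, ← Finset.sum_filter, Finset.sum_const, nsmul_eq_mul]
  set A := Finset.filter (fun j : ℕ => x ∈ B ∩ {x | -(16 * (σ / 2 ^ j)) ≤ ρ x ∧ ρ x ≤ -(σ / 2 ^ j)})
    (Finset.range n) with hA
  rcases A.eq_empty_or_nonempty with h | h
  · simp [h]
  · set m := A.min' h with hmdef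
    have hmA := A.min'_mem h
    rw [← hmdef] at hmA
    have hsub : A ⊆ Finset.Icc m (m + 4) := fun j hj => by
      rw [Finset.mem_Icc]
      refine ⟨A.min'_le j hj, ?_⟩
      by_contra! hlt
      have h1 := (Finset.mem_filter.1 hj).2.2.1
      have h2 := (Finset.mem_filter.1 hmA).2.2.2
      have h3 : (2 : ℝ) ^ j = 2 ^ m * 2 ^ (j - m) := by
        rw [← pow_add]; congr 1; omega
      have h4 : (2 : ℝ) ^ 5 ≤ 2 ^ (j - m) := pow_le_pow_right₀ (by norm_num) (by omega)
      have h5 : σ / 2 ^ m ≤ 16 * (σ / 2 ^ j) := by linarith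
      have h6 : (0 : ℝ) < 2 ^ m := by positivity
      rw [h3, ← div_div, mul_div_assoc', le_div_iff₀ (by positivity)] at h5
      have h7 : 0 < σ / 2 ^ m := by positivity
      nlinarith
    have hcard : A.card ≤ 5 := (Finset.card_le_card hsub).trans (by simp; omega)
    have hx := (Finset.mem_filter.1 hmA).2
    have hx0 : x ∈ B ∩ {x | ρ x < 0} :=
      ⟨hx.1, lt_of_le_of_lt hx.2.2 (neg_lt_zero.2 (by positivity))⟩
    rw [if_pos hx0]
    gcongr
    exact_mod_cast hcard

lemma norm_sub_le_of_fderiv_bound {u : Rd d → Rd d} (hu : Smooth u) {z : Rd d} {r U : ℝ}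
    (hU : ∀ x ∈ Metric.closedBall z r, ‖fderiv ℝ u x‖ ≤ U) {x y : Rd d}
    (hx : x ∈ Metric.ball z r) (hy : y ∈ Metric.ball z r) : ‖u y - u x‖ ≤ U * ‖y - x‖ :=
  (convex_ball z r).norm_image_sub_le_of_norm_fderiv_le (𝕜 := ℝ)
    (fun w _ => hu.differentiable (by simp) w)
    (fun w hw => hU w (Metric.ball_subset_closedBall hw)) hx hy

/-- A field on the lower side of a Lipschitz graph extends to the upper side, with control of the
strain. The extension agrees with the field near the graph, up to an arbitrarily small error. -/
lemma exists_local_extension {ρ : Rd d → ℝ} {L : NNReal} {ν : Rd d} (hL : 1 ≤ L)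
    (hρ : LipschitzWith L ρ) (hν : ‖ν‖ = 1) (hρν : ∀ x t, ρ (x + t • ν) = ρ x + t)
    {z : Rd d} (hz : ρ z = 0) {r : ℝ} (hr : 0 < r) :
    ∃ r' > 0, ∃ C : NNReal, ∀ u : Rd d → Rd d, Smooth u → ∀ ε : ℝ≥0∞, ε ≠ 0 →
      ∃ w : Rd d → Rd d, Smooth w ∧
        (∀ x, ρ x = 0 → ∀ᶠ y in 𝓝 x, w y = u y) ∧
        ∫⁻ x in Metric.ball z r' ∩ {x | 0 < ρ x}, ENNReal.ofReal (dens w x) ≤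
          C * (∫⁻ x in Metric.ball z r ∩ {x | ρ x < 0}, ENNReal.ofReal (dens u x)) + ε := by
  have hL1 : (1 : ℝ) ≤ L := by exact_mod_cast hL
  have hL0 : (0 : ℝ) < L := by linarith
  -- A point within `r' ≤ σ` of `z`, moved by at most `16 * S m` along `ν` and by `S m` sideways,
  -- stays within `18 * σ` of `z`, hence in the ball of radius `r`. The choice `r' = σ / L` keeps
  -- `ρ` at most `S 0 = σ` there.
  obtain ⟨σ, hσ⟩ : ∃ σ : ℝ, σ = r / 40 := ⟨_, rfl⟩
  have hσ0 : 0 < σ := by rw [hσ]; positivity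
  obtain ⟨r', hr'⟩ : ∃ r' : ℝ, r' = σ / L := ⟨_, rfl⟩
  have hr'0 : 0 < r' := by rw [hr']; positivity
  have hr'σ : r' ≤ σ := by rw [hr']; exact div_le_self hσ0.le hL1
  obtain ⟨S, hS⟩ : ∃ S : ℕ → ℝ, S = fun m => σ / 2 ^ m := ⟨_, rfl⟩
  have hS0 : ∀ m, 0 < S m := fun m => by rw [hS]; positivity
  have hSσ : ∀ m, S m ≤ σ := fun m => by
    rw [hS]; exact div_le_self hσ0.le (one_le_pow₀ (by norm_num))
  have hSsucc : ∀ m, S (m + 1) = S m / 2 := fun m => by rw [hS]; simp only [pow_succ]; field_simp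
  have hSanti : Antitone S := antitone_nat_of_succ_le fun m => by
    rw [hSsucc]; linarith [hS0 m]
  have hS_tend : Tendsto S atTop (𝓝 0) := by
    have := (tendsto_pow_atTop_nhds_zero_of_lt_one (r := (1 / 2 : ℝ)) (by norm_num)
      (by norm_num)).const_mul σ
    rw [mul_zero] at this
    refine this.congr fun m => ?_
    rw [hS, one_div, inv_pow]; rfl
  have hρc : Continuous ρ := hρ.continuous
  have hρm : Measurable ρ := hρc.measurable
  have hρball : ∀ x ∈ Metric.ball z r', ρ x < 2 * S 0 := fun x hx => by
    have h1 := hρ.dist_le_mul x z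
    rw [Real.dist_eq, hz, sub_zero] at h1
    have h2 : L * dist x z ≤ L * r' := mul_le_mul_of_nonneg_left (Metric.mem_ball.1 hx).le hL0.le
    have h3 : L * r' = σ := by rw [hr']; field_simp
    have h4 : S 0 = σ := by rw [hS]; simp
    linarith [le_abs_self (ρ x)]
  -- the points used by the extension
  have hpt : ∀ m, ∀ x ∈ Metric.ball z r', ∀ τ ∈ Set.Icc (0 : ℝ) 16, ∀ v : Rd d,
      ‖v‖ ≤ S m / L → x + ((-(τ * S m)) • ν + v) ∈ Metric.ball z r ∧
        |ρ (x + ((-(τ * S m)) • ν + v)) - (ρ x - τ * S m)| ≤ S m := by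
    intro m x hx τ hτ v hv
    have hv' : ‖v‖ ≤ S m := hv.trans (div_le_self (hS0 m).le hL1)
    constructor
    · rw [Metric.mem_ball, dist_eq_norm] at hx ⊢
      have e : x + ((-(τ * S m)) • ν + v) - z = (x - z) + ((-(τ * S m)) • ν + v) := by abel
      rw [e]
      have n1 : ‖(-(τ * S m)) • ν‖ ≤ 16 * S m := by
        rw [norm_smul, hν, mul_one, Real.norm_eq_abs, abs_neg,
          abs_of_nonneg (mul_nonneg hτ.1 (hS0 m).le)]
        exact mul_le_mul_of_nonneg_right hτ.2 (hS0 m).le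
      have n2 := norm_add_le (x - z) ((-(τ * S m)) • ν + v)
      have n3 := norm_add_le ((-(τ * S m)) • ν) v
      have := hSσ m
      have : r = 40 * σ := by rw [hσ]; ring
      linarith
    · have e : x + ((-(τ * S m)) • ν + v) = (x + v) + (-(τ * S m)) • ν := by abel
      rw [e, hρν]
      have h1 := hρ.dist_le_mul (x + v) x
      rw [Real.dist_eq, dist_eq_norm, add_sub_cancel_left] at h1
      have h2 : L * ‖v‖ ≤ S m := by
        rw [le_div_iff₀ hL0] at hv; linarith
      rw [show ρ (x + v) + -(τ * S m) - (ρ x - τ * S m) = ρ (x + v) - ρ x by ring]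
      exact h1.trans h2
  have hcut : ∀ m, ∃ χ : Rd d → ℝ, Smooth χ ∧ (∀ x, 0 ≤ χ x ∧ χ x ≤ 1) ∧
      (∀ x, ρ x ≤ S m → χ x = 0) ∧ (∀ x, 2 * S m ≤ ρ x → χ x = 1) ∧
      ∀ x, ‖fderiv ℝ χ x‖ ≤ 2 * L / S m := fun m => by
    have := exists_smooth_cutoff hρ (show S m < 2 * S m by linarith [hS0 m])
    rwa [show 2 * S m - S m = S m by ring] at this
  choose χ hχs hχ01 hχ0 hχ1 hχd using hcut
  obtain ⟨X, hX⟩ : ∃ X : ℕ → Set (Rd d), X = fun m =>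
    Metric.ball z r' ∩ {x | 0 < ρ x ∧ ρ x < 2 * S m} := ⟨_, rfl⟩
  obtain ⟨Λ, hΛ⟩ : ∃ X : ℕ → Set (Rd d), X = fun m =>
    Metric.ball z r' ∩ {x | S m ≤ ρ x ∧ ρ x < 2 * S m} := ⟨_, rfl⟩
  -- From a point with `S m ≤ ρ < 2 * S m`, a shift down by 4 to 16 times `S m`, with a sideways
  -- error of at most `S m` in `ρ`, lands between `-16 * S m` and `-S m`.
  obtain ⟨Z, hZ⟩ : ∃ X : ℕ → Set (Rd d), X = fun m =>
    Metric.ball z r ∩ {x | -(16 * S m) ≤ ρ x ∧ ρ x ≤ -(S m)} := ⟨_, rfl⟩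
  have hXm : ∀ m, MeasurableSet (X m) := fun m => by
    rw [hX]
    exact measurableSet_ball.inter ((measurableSet_lt measurable_const hρm).inter
      (measurableSet_lt hρm measurable_const))
  have hΛm : ∀ m, MeasurableSet (Λ m) := fun m => by
    rw [hΛ]
    exact measurableSet_ball.inter ((measurableSet_le measurable_const hρm).inter
      (measurableSet_lt hρm measurable_const))
  have hZm : ∀ m, MeasurableSet (Z m) := fun m => by
    rw [hZ]
    exact measurableSet_ball.inter ((measurableSet_le measurable_const hρm).inter
      (measurableSet_le hρm measurable_const))
  have hXsub : ∀ m, X m ⊆ X (m + 1) ∪ Λ m := fun m x hx => by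
    rw [hX] at hx
    rcases lt_or_ge (ρ x) (S m) with h | h
    · left
      rw [hX]
      exact ⟨hx.1, hx.2.1, by rw [hSsucc]; linarith⟩
    · right
      rw [hΛ]
      exact ⟨hx.1, h, hx.2.2⟩
  have hXanti : Antitone X := antitone_nat_of_succ_le fun m x hx => by
    rw [hX] at hx ⊢
    exact ⟨hx.1, hx.2.1, by have := hx.2.2; rw [hSsucc] at this; linarith [hS0 m]⟩
  have hXvol : Tendsto (fun m => volume (X m)) atTop (𝓝 0) := by
    have hemp : ⋂ m, X m = ∅ := by
      refine Set.eq_empty_of_forall_notMem fun x hx => ?_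
      have hx' := fun m => Set.mem_iInter.1 hx m
      rw [hX] at hx'
      have h1 : ρ x ≤ 2 * 0 := ge_of_tendsto' (hS_tend.const_mul 2) fun m => (hx' m).2.2.le
      have h2 := (hx' 0).2.1
      linarith
    have := tendsto_measure_iInter_atTop (μ := volume) (fun m => (hXm m).nullMeasurableSet) hXanti
      ⟨0, ne_top_of_le_ne_top (measure_ball_lt_top (x := z) (r := r')).ne
        (measure_mono (by rw [hX]; exact Set.inter_subset_left))⟩
    rwa [hemp, measure_empty] at this
  obtain ⟨K, hK⟩ : ∃ K : NNReal, K = Real.toNNReal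
    (80 + 2 * (d * (2 * (L : ℝ)) ^ 2) * (d * (144 * 12 ^ 4) / (1 / (L : ℝ)) ^ 2)) := ⟨_, rfl⟩
  refine ⟨r', hr'0, K * 5, fun u hu ε hε => ?_⟩
  obtain ⟨T, hT⟩ : ∃ T : ℕ → Rd d → Rd d, T = fun m => shiftComb ν (S m) u := ⟨_, rfl⟩
  have hTs : ∀ m, Smooth (T m) := fun m => by rw [hT]; exact smooth_shiftComb ν (S m) hu
  have hTsucc : ∀ m, T (m + 1) = shiftComb ν (S m / 2) u := fun m => by
    rw [hT]; simp only [hSsucc]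
  obtain ⟨V, hV⟩ : ∃ V : ℕ → ℕ → Rd d → Rd d, V = descend χ T u := ⟨_, rfl⟩
  have hVs : ∀ n m, Smooth (V n m) := fun n m => by rw [hV]; exact smooth_descend hχs hTs hu n m
  have hVsucc : ∀ n m, V (n + 1) m = fun x => χ m x • T m x + (1 - χ m x) • V n (m + 1) x :=
    fun n m => by rw [hV]; rfl
  -- on a layer
  have hlayer : ∀ n m, ∫⁻ x in Λ m, ENNReal.ofReal (dens (V (n + 2) m) x) ≤
      K * ∫⁻ x in Z m, ENNReal.ofReal (dens u x) := fun n m => by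
    have e1 : ∀ x ∈ Λ m, ENNReal.ofReal (dens (V (n + 2) m) x) ≤
        ENNReal.ofReal (dens (fun x => χ m x • shiftComb ν (S m) u x +
          (1 - χ m x) • shiftComb ν (S m / 2) u x) x) := fun x hx => by
      refine ENNReal.ofReal_le_ofReal (le_of_eq ?_)
      -- As `2 * S (m + 1) = S m`, the next cutoff is already 1 on this layer and the recursion
      -- stops: only the scales `m` and `m + 1` are seen.
      have hx1 : χ (m + 1) x = 1 := hχ1 _ x (by
        rw [hΛ] at hx
        rw [hSsucc]; linarith [hx.2.1])
      have h2 := blend_eq_left (hχs (m + 1)) (hTs (m + 1)) (hVs n (m + 1 + 1)) (hχ01 (m + 1)) hx1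
      rw [← hVsucc n (m + 1)] at h2
      rw [hVsucc (n + 1) m, ← hTsucc]
      have e0 : shiftComb ν (S m) u = T m := by rw [hT]
      rw [e0]
      refine dens_congr ?_ ?_
      · simp only [h2.1]
      · rw [classicalGrad_blend (hχs m) (hTs m) (hVs (n + 1) (m + 1)),
          classicalGrad_blend (hχs m) (hTs m) (hTs (m + 1)), h2.1, h2.2]
    refine (setLIntegral_mono' (hΛm m) e1).trans ?_
    rw [hK]
    -- With `b = 1 / L` the sideways displacement changes `ρ` by at most `S m`.
    refine lintegral_dens_blend_shiftComb_le hu hν (hS0 m) (b := 1 / L) (c := 2 * L) (by positivity)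
      (by rw [div_le_one hL0]; exact hL1) (hχs m) (hχ01 m) (hχd m) (hΛm m) (hZm m) ?_ ?_
    · intro x hx τ hτ
      rw [hΛ] at hx
      have h1 := hpt m x hx.1 τ ⟨by linarith [hτ.1], hτ.2⟩ 0
        (by rw [norm_zero]; exact div_nonneg (hS0 m).le hL0.le)
      rw [add_zero] at h1
      have h2 := abs_le.1 h1.2
      have h3 := mul_le_mul_of_nonneg_right hτ.1 (hS0 m).le
      have h4 := mul_le_mul_of_nonneg_right hτ.2 (hS0 m).le
      rw [hZ]
      exact ⟨h1.1, by linarith [hx.2.1], by linarith [hx.2.2]⟩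
    · intro x hx τ hτ β hβ i
      rw [hΛ] at hx
      have h1 := hpt m x hx.1 τ ⟨by linarith [hτ.1], hτ.2⟩ (EuclideanSpace.single i (β * S m)) (by
        rw [PiLp.norm_single, Real.norm_eq_abs, abs_of_nonneg (mul_nonneg hβ.1 (hS0 m).le)]
        refine (mul_le_mul_of_nonneg_right hβ.2 (hS0 m).le).trans (le_of_eq ?_)
        ring)
      have h2 := abs_le.1 h1.2
      have h3 := mul_le_mul_of_nonneg_right hτ.1 (hS0 m).le
      have h4 := mul_le_mul_of_nonneg_right hτ.2 (hS0 m).le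
      rw [hZ]
      exact ⟨h1.1, by linarith [hx.2.1], by linarith [hx.2.2]⟩
  have hstep : ∀ n m, ∫⁻ x in X m, ENNReal.ofReal (dens (V (n + 2) m) x) ≤
      (∫⁻ x in X (m + 1), ENNReal.ofReal (dens (V (n + 1) (m + 1)) x)) +
      K * ∫⁻ x in Z m, ENNReal.ofReal (dens u x) := fun n m => by
    refine (lintegral_mono_set (hXsub m)).trans ((lintegral_union_le _ _ _).trans ?_)
    refine add_le_add (le_of_eq ?_) (hlayer n m)
    refine setLIntegral_congr_fun (hXm (m + 1)) fun x hx => ?_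
    rw [hX] at hx
    -- Below height `S m` the first blend is inactive, so one scale can be peeled off.
    have hx0 : χ m x = 0 := hχ0 m x (by have := hx.2.2; rw [hSsucc] at this; linarith)
    have h2 := blend_eq_right (hχs m) (hTs m) (hVs (n + 1) (m + 1)) (hχ01 m) hx0
    rw [← hVsucc (n + 1) m] at h2
    simp only [dens_congr h2.1 h2.2]
  have hsum : ∀ n m, ∫⁻ x in X m, ENNReal.ofReal (dens (V (n + 1) m) x) ≤
      (∫⁻ x in X (m + n), ENNReal.ofReal (dens (V 1 (m + n)) x)) +
      K * ∑ j ∈ Finset.range n, ∫⁻ x in Z (m + j), ENNReal.ofReal (dens u x) := by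
    intro n
    induction n with
    | zero => intro m; simp
    | succ n ih =>
      intro m
      refine (hstep n m).trans ((add_le_add (ih (m + 1)) le_rfl).trans (le_of_eq ?_))
      rw [Finset.sum_range_succ', show m + 1 + n = m + (n + 1) by ring, mul_add, add_zero, add_assoc]
      simp only [show ∀ j, m + 1 + j = m + (j + 1) from fun j => by ring]
  -- the last layer
  obtain ⟨U, hU⟩ := (isCompact_closedBall z r).exists_bound_of_continuousOn
    (hu.continuous_fderiv (by simp)).continuousOn
  obtain ⟨U', hU'⟩ := (isCompact_closedBall z r).exists_bound_of_continuousOn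
    (continuous_dens hu).continuousOn
  have hdu : ∀ x ∈ Metric.ball z r, dens u x ≤ U' := fun x hx =>
    (le_abs_self _).trans (hU' x (Metric.ball_subset_closedBall hx))
  have hball : ∀ x ∈ Metric.ball z r', x ∈ Metric.ball z r := fun x hx =>
    Metric.ball_subset_ball (by linarith [hr'σ, show r = 40 * σ by rw [hσ]; ring]) hx
  have hU'0 : 0 ≤ U' := (dens_nonneg u z).trans (hdu z (Metric.mem_ball_self hr))
  have hU0 : 0 ≤ U := (norm_nonneg _).trans (hU z (Metric.mem_closedBall_self hr.le))
  -- This bound depends on `u` but not on `m`: by smoothness `T m - u` is of order `S m`, which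
  -- compensates the cutoff slope `2 * L / S m`. Since the volume of `X m` tends to zero, the last
  -- layer is absorbed by `ε`.
  have hlast : ∀ m, ∀ x ∈ X m, dens (V 1 m) x ≤
      44 * U' + 2 * (d * (64 * L * U) ^ 2) := fun m x hx => by
    rw [hX] at hx
    have hxr := hball x hx.1
    have q : ∀ k ∈ Set.Icc (0 : ℝ) 16, x + (-(k * S m)) • ν ∈ Metric.ball z r := fun k hk => by
      have h1 := (hpt m x hx.1 k hk 0 (by rw [norm_zero]; exact div_nonneg (hS0 m).le hL0.le)).1
      rwa [add_zero] at h1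
    have q8 := q 8 ⟨by norm_num, by norm_num⟩
    have q16 := q 16 ⟨by norm_num, by norm_num⟩
    have e0 : V 1 m = fun x => χ m x • T m x + (1 - χ m x) • u x := by
      rw [hVsucc 0 m]; rw [hV]; rfl
    rw [e0]
    refine (dens_blend_le (hχs m) (hTs m) hu (hχ01 m x)).trans ?_
    have e1 : dens (T m) x ≤ 10 * U' := by
      rw [hT]
      refine (dens_shiftComb_le ν (S m) hu x).trans ?_
      linarith [hdu _ q8, hdu _ q16]
    have e2 : ‖T m x - u x‖ ≤ 32 * S m * U := by
      have e3 : T m x - u x = (2 : ℝ) • (u (x + (-(8 * S m)) • ν) - u x)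
          - (u (x + (-(16 * S m)) • ν) - u x) := by
        rw [hT]; simp only [shiftComb]; module
      have n8 := norm_sub_le_of_fderiv_bound hu hU hxr q8
      have n16 := norm_sub_le_of_fderiv_bound hu hU hxr q16
      rw [add_sub_cancel_left, norm_smul, hν, mul_one, Real.norm_eq_abs, abs_neg,
        abs_of_nonneg (mul_nonneg (by norm_num) (hS0 m).le)] at n8 n16
      rw [e3]
      refine (norm_sub_le _ _).trans ?_
      rw [norm_smul, Real.norm_eq_abs, abs_two]
      linarith
    have e4 : d * ‖fderiv ℝ (χ m) x‖ ^ 2 * ‖T m x - u x‖ ^ 2 ≤ d * (64 * L * U) ^ 2 := by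
      rw [mul_assoc, ← mul_pow]
      refine mul_le_mul_of_nonneg_left (pow_le_pow_left₀ (by positivity) ?_ 2) (Nat.cast_nonneg d)
      calc ‖fderiv ℝ (χ m) x‖ * ‖T m x - u x‖ ≤ (2 * L / S m) * (32 * S m * U) :=
            mul_le_mul (hχd m x) e2 (norm_nonneg _) (by have := hS0 m; positivity)
        _ = 64 * L * U := by have := (hS0 m).ne'; field_simp; ring
    linarith [hdu x hxr]
  obtain ⟨K', hK'⟩ : ∃ K' : ℝ, K' = 44 * U' + 2 * (d * (64 * L * U) ^ 2) := ⟨_, rfl⟩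
  obtain ⟨n, hn⟩ : ∃ n, ENNReal.ofReal K' * volume (X n) < ε := by
    have h1 := ENNReal.Tendsto.const_mul hXvol (a := ENNReal.ofReal K')
      (Or.inr ENNReal.ofReal_ne_top)
    rw [mul_zero] at h1
    exact (h1.eventually (gt_mem_nhds (pos_iff_ne_zero.2 hε))).exists
  refine ⟨V (n + 1) 0, hVs _ _, fun x hx => ?_, ?_⟩
  -- Below height `S n` every cutoff in use vanishes, so the blended field is `u` itself.
  · have : ∀ᶠ y in 𝓝 x, ρ y < S n := hρc.continuousAt.eventually (gt_mem_nhds (by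
      rw [hx]; exact hS0 n))
    filter_upwards [this] with y hy
    rw [hV]
    refine descend_eq (n + 1) 0 fun j hj => ?_
    rw [zero_add]
    exact hχ0 j y (hy.le.trans (hSanti (by omega)))
  · have hsub : Metric.ball z r' ∩ {x | 0 < ρ x} ⊆ X 0 := fun x hx => by
      rw [hX]; exact ⟨hx.1, hx.2, hρball x hx.1⟩
    refine (lintegral_mono_set hsub).trans ((hsum n 0).trans ?_)
    rw [add_comm, zero_add]
    refine add_le_add ?_ ?_
    · have := lintegral_sum_dyadic_le (measurable_ofReal_dens hu) hρm hσ0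
        (measurableSet_ball (x := z) (ε := r)) n
      push_cast
      rw [mul_assoc]
      refine mul_le_mul' le_rfl (le_trans (le_of_eq ?_) this)
      refine Finset.sum_congr rfl fun j _ => ?_
      rw [hZ, hS, zero_add]
    · refine le_trans ?_ hn.le
      calc ∫⁻ x in X n, ENNReal.ofReal (dens (V 1 n) x) ≤ ∫⁻ _x in X n, ENNReal.ofReal K' :=
            setLIntegral_mono' (hXm n) fun x hx =>
              ENNReal.ofReal_le_ofReal (by rw [hK']; exact hlast n x hx)
        _ = _ := setLIntegral_const _ _

/-! ### Extension into one inclusion -/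

/-- Near a boundary point, a set with Lipschitz boundary is the positivity set of a Lipschitz
function that increases at unit speed in the vertical direction. -/
lemma HasLipschitzBoundary.exists_graph {U : Set (Rd d)} (hU : HasLipschitzBoundary U)
    (ho : IsOpen U) {z : Rd d} (hz : z ∈ frontier U) :
    ∃ (ν : Rd d) (r : ℝ) (L : NNReal) (ρ : Rd d → ℝ), ‖ν‖ = 1 ∧ 0 < r ∧ 1 ≤ L ∧
      LipschitzWith L ρ ∧ (∀ x t, ρ (x + t • ν) = ρ x + t) ∧
      (∀ x ∈ Metric.ball z r, x ∈ U ↔ 0 < ρ x) ∧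
      (∀ x ∈ Metric.ball z r, ρ x < 0 → x ∉ closure U) ∧
      (∀ x ∈ Metric.ball z r, x ∈ frontier U → ρ x = 0) := by
  obtain ⟨ν, r, K, ψ, hν, hr, hψ, h⟩ := hU z hz
  obtain ⟨ρ, hρ⟩ : ∃ ρ : Rd d → ℝ, ρ = fun x => inner ℝ ν x - ψ (x - inner ℝ ν x • ν) :=
    ⟨_, rfl⟩
  have hin : ∀ v : Rd d, |inner ℝ ν v| ≤ ‖v‖ := fun v => by
    have := abs_real_inner_le_norm ν v
    rwa [hν, one_mul] at this
  have hlip : LipschitzWith (1 + 2 * K) ρ := by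
    refine LipschitzWith.of_dist_le_mul fun x y => ?_
    rw [Real.dist_eq, dist_eq_norm, hρ]
    have h1 := hψ.dist_le_mul (x - inner ℝ ν x • ν) (y - inner ℝ ν y • ν)
    rw [Real.dist_eq, dist_eq_norm] at h1
    have h2 : (x - inner ℝ ν x • ν) - (y - inner ℝ ν y • ν)
        = (x - y) - inner ℝ ν (x - y) • ν := by rw [inner_sub_right]; module
    have h3 : ‖(x - y) - inner ℝ ν (x - y) • ν‖ ≤ 2 * ‖x - y‖ := by
      refine (norm_sub_le _ _).trans ?_
      rw [norm_smul, hν, mul_one, Real.norm_eq_abs]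
      linarith [hin (x - y)]
    rw [h2] at h1
    have h4 := h1.trans (mul_le_mul_of_nonneg_left h3 K.coe_nonneg)
    have h5 := hin (x - y)
    rw [inner_sub_right] at h5
    rw [abs_le] at h4 h5 ⊢
    push_cast
    constructor <;> linarith [h4.1, h4.2, h5.1, h5.2]
  have hU' : ∀ x ∈ Metric.ball z r, x ∈ U ↔ 0 < ρ x := fun x hx => by
    rw [h x hx, hρ, sub_pos]
  have hneg : ∀ x ∈ Metric.ball z r, ρ x < 0 → x ∉ closure U := fun x hx hlt hcl => by
    have hn : Metric.ball z r ∩ {y | ρ y < 0} ∈ 𝓝 x :=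
      inter_mem (Metric.isOpen_ball.mem_nhds hx)
        (hlip.continuous.continuousAt.eventually (gt_mem_nhds hlt))
    obtain ⟨y, hy, hyU⟩ := mem_closure_iff_nhds.1 hcl _ hn
    exact absurd ((hU' y hy.1).1 hyU) (not_lt.2 (le_of_lt hy.2))
  refine ⟨ν, r, 1 + 2 * K, ρ, hν, hr, le_self_add, hlip, fun x t => ?_, hU', hneg,
    fun x hx hxf => ?_⟩
  · rw [hρ]
    have e1 : inner ℝ ν (x + t • ν) = inner ℝ ν x + t := by
      rw [inner_add_right, inner_smul_right, real_inner_self_eq_norm_sq, hν]; ring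
    simp only [e1]
    rw [show x + t • ν - (inner ℝ ν x + t) • ν = x - inner ℝ ν x • ν by module]
    ring
  · rw [ho.frontier_eq] at hxf
    refine le_antisymm (not_lt.1 fun hlt => hxf.2 ((hU' x hx).2 hlt))
      (not_lt.1 fun hlt => hneg x hx hlt hxf.1)

/-- Extension near a boundary point of an inclusion from a part of the matrix on which the
Korn–Poincaré inequality holds. -/
lemma exists_boundary_extension {ι : Type*} {ω : Set (Rd d)} {F : ι → Set (Rd d)}
    (hω : IsPeriodicMatrix ω F) (k : ι) {z : Rd d} (hz : z ∈ frontier (F k)) :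
    ∃ (a : ℝ) (N E : Set (Rd d)) (y : Rd d) (s : ℝ) (C : NNReal), 0 < a ∧ 0 < s ∧
      Metric.ball y s ⊆ N ∧ (N ⊆ ω ∧ MeasurableSet N ∧ Bornology.IsBounded N) ∧
      (E ⊆ ω ∧ MeasurableSet E ∧ Bornology.IsBounded E) ∧ KornOn N E ∧
      ∀ u : Rd d → Rd d, Smooth u → ∀ ε : ℝ≥0∞, ε ≠ 0 → ∃ w : Rd d → Rd d, Smooth w ∧
        (∀ x ∈ frontier (F k) ∩ Metric.ball z a, ∀ᶠ y in 𝓝 x, w y = u y) ∧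
        ∫⁻ x in F k ∩ Metric.ball z a, ENNReal.ofReal (dens w x) ≤
          C * (∫⁻ x in N, ENNReal.ofReal (dens u x)) + ε := by
  obtain ⟨ν, r, L, ρ, hν, hr, hL, hlip, hρν, hpos, hneg, hzero⟩ :=
    (hω.inclusion k).lipschitz.exists_graph (hω.inclusion k).isOpen hz
  obtain ⟨c, hc, hsep⟩ := hω.separated
  have hL1 : (1 : ℝ) ≤ L := by exact_mod_cast hL
  have hρz : ρ z = 0 := hzero z (Metric.mem_ball_self hr) hz
  have hρc := hlip.continuous
  -- Within the separation distance `c` of a boundary point of `F k` there is no point of another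
  -- closed inclusion, so points below the graph belong to the matrix.
  obtain ⟨r₀, hr₀⟩ : ∃ r₀, r₀ = min r c := ⟨_, rfl⟩
  have hr₀0 : 0 < r₀ := hr₀ ▸ lt_min hr hc
  have hr₀r : r₀ ≤ r := hr₀ ▸ min_le_left _ _
  have hr₀c : r₀ ≤ c := hr₀ ▸ min_le_right _ _
  obtain ⟨r₁, hr₁⟩ : ∃ r₁, r₁ = r₀ / (10 * L) := ⟨_, rfl⟩
  have hr₁0 : 0 < r₁ := by rw [hr₁]; positivity
  have hLr : 10 * (L * r₁) = r₀ := by rw [hr₁]; field_simp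
  have hr₁L : r₁ ≤ L * r₁ := le_mul_of_one_le_left hr₁0.le hL1
  have hopen : ∀ s : ℝ, IsOpen (Metric.ball z s ∩ {x | ρ x < 0}) := fun s =>
    Metric.isOpen_ball.inter (isOpen_lt hρc continuous_const)
  have hEω : Metric.ball z r₀ ∩ {x | ρ x < 0} ⊆ ω := fun x hx => by
    by_contra hxω
    have hx' : x ∈ ωᶜ := hxω
    rw [hω.compl_eq] at hx'
    obtain ⟨l, hl⟩ := Set.mem_iUnion.1 hx'
    rcases eq_or_ne l k with rfl | hlk
    · exact hneg x (Metric.ball_subset_ball hr₀r hx.1) hx.2 hl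
    · have h1 : dist x z < c := lt_of_lt_of_le hx.1 hr₀c
      obtain ⟨e, he⟩ : ∃ e, e = (c - dist x z) / 2 := ⟨_, rfl⟩
      have he0 : 0 < e := by rw [he]; linarith
      obtain ⟨x', hx', hxd⟩ := Metric.mem_closure_iff.1 hl e he0
      obtain ⟨z', hz', hzd⟩ := Metric.mem_closure_iff.1 (frontier_subset_closure hz) e he0
      have h2 := hsep l k hlk x' hx' z' hz'
      have h3 := dist_triangle4 x' x z z'
      rw [dist_comm x' x] at h3
      linarith
  have hNE : Metric.ball z r₁ ∩ {x | ρ x < 0} ⊆ Metric.ball z r₀ ∩ {x | ρ x < 0} :=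
    Set.inter_subset_inter_left _ (Metric.ball_subset_ball (by linarith))
  have hkorn : KornOn (Metric.ball z r₁ ∩ {x | ρ x < 0}) (Metric.ball z r₀ ∩ {x | ρ x < 0}) := by
    -- From a point of `N` towards a point within `r₁` of `p`, the height at time `t` loses `4 * t *
    -- L * r₁` and regains at most half of that. The segment thus stays below the graph, and the
    -- factor 10 in `r₁` keeps it in the ball of radius `r₀`.
    obtain ⟨p, hp⟩ : ∃ p, p = z + (-(4 * (L * r₁))) • ν := ⟨_, rfl⟩
    have hρp : ρ p = -(4 * (L * r₁)) := by rw [hp, hρν, hρz, zero_add]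
    have hpz : dist p z = 4 * (L * r₁) := by
      rw [hp, dist_eq_norm, add_sub_cancel_left, norm_smul, hν, mul_one, Real.norm_eq_abs, abs_neg,
        abs_of_nonneg (by positivity)]
    have hball : Metric.ball p r₁ ⊆ Metric.ball z r₀ ∩ {x | ρ x < 0} := fun y hy => by
      rw [Metric.mem_ball] at hy
      refine ⟨?_, ?_⟩
      · rw [Metric.mem_ball]
        linarith [dist_triangle y p z]
      · have h1 := hlip.dist_le_mul y p
        rw [Real.dist_eq, hρp] at h1
        have h2 : L * dist y p ≤ L * r₁ := mul_le_mul_of_nonneg_left hy.le L.coe_nonneg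
        have h3 := (abs_le.1 h1).2
        have : 0 < L * r₁ := by linarith
        rw [Set.mem_ofPred_eq]
        linarith
    -- `KornOn.of_segment` needs the central ball inside the domain; it is adjoined here and dropped
    -- by monotonicity.
    refine (KornOn.of_segment (D := Metric.ball z r₁ ∩ {x | ρ x < 0} ∪ Metric.ball p r₁)
      ((hopen r₁).measurableSet.union measurableSet_ball)
      ((Metric.isBounded_ball.subset Set.inter_subset_left).union Metric.isBounded_ball)
      (hopen r₀).measurableSet p hr₁0 Set.subset_union_right ?_).mono Set.subset_union_left subset_rfl
    intro x hx y hy t ht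
    have hy' := hball hy
    rcases hx with hx | hx
    · refine ⟨(convex_ball z r₀).add_smul_sub_mem (hNE hx).1 hy'.1 ht, ?_⟩
      have e : x + t • (y - x) = (x + t • ((y - p) - (x - z))) + (-(t * (4 * (L * r₁)))) • ν := by
        rw [hp]; module
      have h1 := hlip.dist_le_mul (x + t • ((y - p) - (x - z))) x
      rw [Real.dist_eq, dist_eq_norm, add_sub_cancel_left, norm_smul, Real.norm_eq_abs,
        abs_of_nonneg ht.1] at h1
      have h2 : ‖(y - p) - (x - z)‖ ≤ 2 * r₁ := by
        refine (norm_sub_le _ _).trans ?_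
        rw [← dist_eq_norm, ← dist_eq_norm]
        linarith [Metric.mem_ball.1 hy, Metric.mem_ball.1 hx.1]
      have h3 : L * (t * ‖(y - p) - (x - z)‖) ≤ L * (t * (2 * r₁)) := by
        have := ht.1
        gcongr
      have h4 := (abs_le.1 (h1.trans h3)).2
      have h5 : 0 ≤ t * (L * r₁) := mul_nonneg ht.1 (by linarith)
      have h6 : ρ x < 0 := hx.2
      rw [Set.mem_ofPred_eq, e, hρν]
      linarith
    · exact hball ((convex_ball p r₁).add_smul_sub_mem hx hy ht)
  have hyN : z + (-(r₁ / 2)) • ν ∈ Metric.ball z r₁ ∩ {x | ρ x < 0} := by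
    constructor
    · rw [Metric.mem_ball, dist_eq_norm, add_sub_cancel_left, norm_smul, hν, mul_one,
        Real.norm_eq_abs, abs_neg, abs_of_pos (by positivity)]
      linarith
    · rw [Set.mem_ofPred_eq, hρν, hρz]; linarith
  -- Different pieces of the matrix are later joined through such balls.
  obtain ⟨s, hs, hsub⟩ := Metric.isOpen_iff.1 (hopen r₁) _ hyN
  obtain ⟨r', hr', C, hC⟩ := exists_local_extension hL hlip hν hρν hρz hr₁0
  have hN : Metric.ball z r₁ ∩ {x | ρ x < 0} ⊆ ω ∧
      MeasurableSet (Metric.ball z r₁ ∩ {x | ρ x < 0}) ∧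
      Bornology.IsBounded (Metric.ball z r₁ ∩ {x | ρ x < 0}) :=
    ⟨hNE.trans hEω, (hopen r₁).measurableSet, Metric.isBounded_ball.subset Set.inter_subset_left⟩
  refine ⟨min r' r, _, _, _, s, C, lt_min hr' hr, hs, hsub, hN, ⟨hEω, (hopen r₀).measurableSet,
    Metric.isBounded_ball.subset Set.inter_subset_left⟩, hkorn, fun u hu ε hε => ?_⟩
  obtain ⟨w, hw, hw1, hw2⟩ := hC u hu ε hε
  refine ⟨w, hw, fun x hx => hw1 x (hzero x (Metric.ball_subset_ball (min_le_right _ _) hx.2) hx.1),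
    (lintegral_mono_set fun x hx => ?_).trans hw2⟩
  exact ⟨Metric.ball_subset_ball (min_le_left _ _) hx.2,
    (hpos x (Metric.ball_subset_ball (min_le_right _ _) hx.2)).1 hx.1⟩

/-- Finitely many sets on which the Korn–Poincaré inequality holds can be joined inside a connected
open set. -/
lemma exists_kornOn_biUnion {ω : Set (Rd d)} (ho : IsOpen ω) (hc : IsPreconnected ω) {α : Type*}
    (N E : α → Set (Rd d)) (y : α → Rd d) (s : α → ℝ) (t : Finset α)
    (hs : ∀ z ∈ t, 0 < s z) (hball : ∀ z ∈ t, Metric.ball (y z) (s z) ⊆ N z)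
    (hN : ∀ z ∈ t, N z ⊆ ω ∧ MeasurableSet (N z) ∧ Bornology.IsBounded (N z))
    (hE : ∀ z ∈ t, E z ⊆ ω ∧ MeasurableSet (E z) ∧ Bornology.IsBounded (E z))
    (hK : ∀ z ∈ t, KornOn (N z) (E z)) {y₀ : Rd d} (hy₀ : y₀ ∈ ω) :
    ∃ s₀ > 0, ∃ E₀ : Set (Rd d), (E₀ ⊆ ω ∧ MeasurableSet E₀ ∧ Bornology.IsBounded E₀) ∧
      KornOn (Metric.ball y₀ s₀ ∪ ⋃ z ∈ t, N z) E₀ := by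
  classical
  induction t using Finset.induction_on with
  | empty =>
    obtain ⟨s₀, hs₀, hsub⟩ := Metric.isOpen_iff.1 ho y₀ hy₀
    exact ⟨s₀, hs₀, Metric.ball y₀ s₀, ⟨hsub, measurableSet_ball, Metric.isBounded_ball⟩,
      by simpa using KornOn.ball y₀ hs₀⟩
  | insert z t hzt ih =>
    have hm : ∀ {x}, x ∈ t → x ∈ insert z t := Finset.mem_insert_of_mem
    have hz := Finset.mem_insert_self z t
    obtain ⟨s₀, hs₀, E₀, hE₀, hK₀⟩ := ih (fun x hx => hs x (hm hx)) (fun x hx => hball x (hm hx))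
      (fun x hx => hN x (hm hx)) (fun x hx => hE x (hm hx)) (fun x hx => hK x (hm hx))
    -- A chain inside `ω` from `y₀` to the ball in the new piece; the two unions below glue along
    -- its two ends.
    obtain ⟨s₁, hs₁, E₁, hE₁, hE₁m, hE₁b, hK₁⟩ := exists_kornOn_ball_union ho hc hy₀
      ((hN z hz).1 (hball z hz (Metric.mem_ball_self (hs z hz))))
    have k1 := hK₀.union hK₁ (measurableSet_ball.union measurableSet_ball)
      (Metric.isBounded_ball.union Metric.isBounded_ball) y₀ (lt_min hs₀ hs₁)
      ((Metric.ball_subset_ball (min_le_left _ _)).trans Set.subset_union_left)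
      ((Metric.ball_subset_ball (min_le_right _ _)).trans Set.subset_union_left)
    have k2 := k1.union (hK z hz) (hN z hz).2.1 (hN z hz).2.2 (y z) (lt_min hs₁ (hs z hz))
      ((Metric.ball_subset_ball (min_le_left _ _)).trans
        (Set.subset_union_right.trans Set.subset_union_right))
      ((Metric.ball_subset_ball (min_le_right _ _)).trans (hball z hz))
    refine ⟨s₀, hs₀, _, ⟨Set.union_subset (Set.union_subset hE₀.1 hE₁) (hE z hz).1,
      (hE₀.2.1.union hE₁m).union (hE z hz).2.1, (hE₀.2.2.union hE₁b).union (hE z hz).2.2⟩,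
      k2.mono ?_ subset_rfl⟩
    rw [Finset.set_biUnion_insert]
    intro x hx
    rcases hx with hx | hx | hx
    · exact Or.inl (Or.inl (Or.inl hx))
    · exact Or.inr hx
    · exact Or.inl (Or.inl (Or.inr hx))

/-- Extension operators near finitely many points are blended. -/
lemma exists_blended_extension {G A : Set (Rd d)}
    {α : Type*} (p : α → Rd d) (a : α → ℝ) (N : α → Set (Rd d)) (C : α → NNReal) (t : Finset α)
    (ha : ∀ z ∈ t, 0 < a z)
    (hext : ∀ z ∈ t, ∀ u : Rd d → Rd d, Smooth u → ∀ ε : ℝ≥0∞, ε ≠ 0 →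
      ∃ w : Rd d → Rd d, Smooth w ∧
        (∀ x ∈ A ∩ Metric.ball (p z) (a z), ∀ᶠ y in 𝓝 x, w y = u y) ∧
        ∫⁻ x in G ∩ Metric.ball (p z) (a z), ENNReal.ofReal (dens w x) ≤
          C z * (∫⁻ x in N z, ENNReal.ofReal (dens u x)) + ε) :
    ∃ C₀ : NNReal, ∀ u : Rd d → Rd d, Smooth u → ∀ ε : ℝ≥0∞, ε ≠ 0 →
      ∃ w : Rd d → Rd d, Smooth w ∧
        (∀ z ∈ t, ∀ x ∈ A ∩ Metric.ball (p z) (a z / 2), ∀ᶠ y in 𝓝 x, w y = u y) ∧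
        ∫⁻ x in G, ENNReal.ofReal (dens w x) ≤
          C₀ * (∫⁻ x in ⋃ z ∈ t, N z, ENNReal.ofReal (dens u x)) + ε := by
  classical
  induction t using Finset.induction_on with
  | empty =>
    refine ⟨0, fun u _ ε _ => ⟨fun _ => 0, contDiff_const, by simp, ?_⟩⟩
    have : ∀ x : Rd d, dens (fun _ : Rd d => (0 : Rd d)) x = 0 := fun x => by
      simp [dens, strain, symSq, classicalGrad]
    simp [this]
  | insert z t hzt ih =>
    have hm : ∀ {x}, x ∈ t → x ∈ insert z t := Finset.mem_insert_of_mem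
    have hz := Finset.mem_insert_self z t
    have haz := ha z hz
    obtain ⟨C₁, hC₁⟩ := ih (fun x hx => ha x (hm hx)) (fun x hx => hext x (hm hx))
    have hlip : LipschitzWith 1 fun x => -dist x (p z) := (LipschitzWith.dist_left (p z)).neg
    -- The cutoff is 1 within `a z / 2` of `p z` and 0 beyond `3 * a z / 4`, well inside the ball
    -- where the new extension is controlled.
    obtain ⟨χ, hχs, hχ01, hχ0, hχ1, hχd⟩ :=
      exists_smooth_cutoff hlip (show -(3 * a z / 4) < -(a z / 2) by linarith)
    obtain ⟨κ, hκ⟩ : ∃ κ : ℝ, κ = 2 * (1 : NNReal) / (-(a z / 2) - -(3 * a z / 4)) := ⟨_, rfl⟩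
    rw [← hκ] at hχd
    have hκ0 : 0 ≤ κ := (norm_nonneg _).trans (hχd 0)
    obtain ⟨K, hK⟩ : ∃ K : NNReal, K = Real.toNNReal (4 + 4 * (d * κ ^ 2)) := ⟨_, rfl⟩
    have hKr : (K : ℝ) = 4 + 4 * (d * κ ^ 2) := by
      rw [hK]; exact Real.coe_toNNReal _ (by positivity)
    have hKpos : K ≠ 0 := by
      rw [← NNReal.coe_ne_zero, hKr]; positivity
    refine ⟨K * (C₁ + C z), fun u hu ε hε => ?_⟩
    -- Two errors occur, and the blend multiplies both by `K`.
    have hε' : ε / (2 * K) ≠ 0 := by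
      refine ENNReal.div_ne_zero.2 ⟨hε, ENNReal.mul_ne_top (by simp) ENNReal.coe_ne_top⟩
    obtain ⟨w₁, hw₁, hw₁e, hw₁i⟩ := hC₁ u hu _ hε'
    obtain ⟨w₂, hw₂, hw₂e, hw₂i⟩ := hext z hz u hu _ hε'
    refine ⟨fun x => χ x • w₂ x + (1 - χ x) • w₁ x,
      (hχs.smul hw₂).add ((contDiff_const.sub hχs).smul hw₁), ?_, ?_⟩
    -- Near a point of an earlier half-ball, either both fields equal `u`, and so does every
    -- combination of them, or the cutoff vanishes and the earlier field is kept.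
    · intro z' hz' x hx
      have hcont : Continuous fun y : Rd d => dist y (p z) := by fun_prop
      by_cases hxa : x ∈ Metric.ball (p z) (a z)
      · have e2 := hw₂e x ⟨hx.1, hxa⟩
        rcases Finset.mem_insert.1 hz' with rfl | hz'
        · have : ∀ᶠ y in 𝓝 x, dist y (p z') < a z' / 2 :=
            hcont.continuousAt.eventually (gt_mem_nhds hx.2)
          filter_upwards [this, e2] with y hy hy2
          rw [hχ1 y (by linarith), hy2]; simp
        · filter_upwards [hw₁e z' hz' x hx, e2] with y hy1 hy2
          rw [hy1, hy2, ← add_smul]; simp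
      · have hd : a z ≤ dist x (p z) := not_lt.1 hxa
        have h0 : ∀ᶠ y in 𝓝 x, 3 * a z / 4 < dist y (p z) :=
          hcont.continuousAt.eventually (lt_mem_nhds (by linarith))
        rcases Finset.mem_insert.1 hz' with rfl | hz'
        · have := Metric.mem_ball.1 hx.2
          linarith
        · filter_upwards [hw₁e z' hz' x hx, h0] with y hy1 hy2
          rw [hχ0 y (by linarith), hy1]; simp
    · have hmB : MeasurableSet (Metric.ball (p z) (a z)) := measurableSet_ball
      have hpt : ∀ x, ENNReal.ofReal (dens (fun x => χ x • w₂ x + (1 - χ x) • w₁ x) x) ≤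
          K * (ENNReal.ofReal (dens w₁ x) +
            (Metric.ball (p z) (a z)).indicator (fun x => ENNReal.ofReal (dens w₂ x)) x) := by
        intro x
        have hKe : (K : ℝ≥0∞) = ENNReal.ofReal (4 + 4 * (d * κ ^ 2)) := by rw [hK]; rfl
        by_cases hx : x ∈ Metric.ball (p z) (a z)
        · rw [Set.indicator_of_mem hx, hKe, ← ENNReal.ofReal_add (dens_nonneg _ _) (dens_nonneg _ _),
            ← ENNReal.ofReal_mul (by positivity)]
          refine ENNReal.ofReal_le_ofReal ((dens_blend_le hχs hw₂ hw₁ (hχ01 x)).trans ?_)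
          have e1 : ‖w₂ x - w₁ x‖ ^ 2 ≤ 2 * dens w₂ x + 2 * dens w₁ x := by
            rw [sub_eq_add_neg]
            refine (norm_add_sq_le_two _ _).trans ?_
            rw [norm_neg]
            simp only [dens]
            linarith [strain_nonneg w₁ x, strain_nonneg w₂ x]
          have e2 : d * ‖fderiv ℝ χ x‖ ^ 2 * ‖w₂ x - w₁ x‖ ^ 2 ≤
              d * κ ^ 2 * (2 * dens w₂ x + 2 * dens w₁ x) := by
            gcongr
            exact hχd x
          linarith
        · rw [Set.indicator_of_notMem hx, add_zero]
          have hd : a z ≤ dist x (p z) := not_lt.1 hx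
          have h2 := blend_eq_right hχs hw₂ hw₁ hχ01 (hχ0 x (by linarith))
          rw [dens_congr h2.1 h2.2]
          refine le_mul_of_one_le_left (zero_le) ?_
          rw [hKe]
          refine ENNReal.one_le_ofReal.2 ?_
          have : 0 ≤ d * κ ^ 2 := by positivity
          linarith
      refine (lintegral_mono hpt).trans ?_
      have m1 := measurable_ofReal_dens hw₁
      have m2 := (measurable_ofReal_dens hw₂).indicator hmB
      have m3 : Measurable fun x => ENNReal.ofReal (dens w₁ x) +
          (Metric.ball (p z) (a z)).indicator (fun x => ENNReal.ofReal (dens w₂ x)) x := m1.add m2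
      rw [lintegral_const_mul _ m3, lintegral_add_left m1, lintegral_indicator hmB,
        Measure.restrict_restrict hmB, Set.inter_comm, Finset.set_biUnion_insert]
      obtain ⟨J, hJ⟩ : ∃ J, J = ∫⁻ x in N z ∪ ⋃ x ∈ t, N x, ENNReal.ofReal (dens u x) := ⟨_, rfl⟩
      rw [← hJ]
      calc (K : ℝ≥0∞) * ((∫⁻ x in G, ENNReal.ofReal (dens w₁ x)) +
            ∫⁻ x in G ∩ Metric.ball (p z) (a z), ENNReal.ofReal (dens w₂ x))
          ≤ K * ((C₁ * J + ε / (2 * K)) + (C z * J + ε / (2 * K))) := by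
            refine mul_le_mul' le_rfl (add_le_add (hw₁i.trans ?_) (hw₂i.trans ?_))
            · refine add_le_add (mul_le_mul' le_rfl ?_) le_rfl
              rw [hJ]; exact lintegral_mono_set Set.subset_union_right
            · refine add_le_add (mul_le_mul' le_rfl ?_) le_rfl
              rw [hJ]; exact lintegral_mono_set Set.subset_union_left
        _ = K * (C₁ + C z) * J + 2 * K * (ε / (2 * K)) := by ring
        _ = _ := by
            rw [ENNReal.mul_div_cancel (mul_ne_zero two_ne_zero (ENNReal.coe_ne_zero.2 hKpos))
              (ENNReal.mul_ne_top (by simp) ENNReal.coe_ne_top)]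
            push_cast; rfl

lemma ofReal_norm_sq_add_le (a b : Rd d) : ENNReal.ofReal (‖a + b‖ ^ 2) ≤
    2 * ENNReal.ofReal (‖a‖ ^ 2) + 2 * ENNReal.ofReal (‖b‖ ^ 2) := by
  have h2 : ∀ c : ℝ, 2 * ENNReal.ofReal c = ENNReal.ofReal (2 * c) := fun c => by
    rw [ENNReal.ofReal_mul zero_le_two, ENNReal.ofReal_ofNat]
  rw [h2, h2, ← ENNReal.ofReal_add (by positivity) (by positivity)]
  exact ENNReal.ofReal_le_ofReal (norm_add_sq_le_two a b)

lemma lintegral_ofReal_norm_sq_add_le {μ : Measure (Rd d)} {v w : Rd d → Rd d}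
    (hv : AEMeasurable v μ) (hw : AEMeasurable w μ) :
    ∫⁻ x, ENNReal.ofReal (‖v x + w x‖ ^ 2) ∂μ ≤
      2 * (∫⁻ x, ENNReal.ofReal (‖v x‖ ^ 2) ∂μ) + 2 * ∫⁻ x, ENNReal.ofReal (‖w x‖ ^ 2) ∂μ := by
  have m1 : AEMeasurable (fun x => ENNReal.ofReal (‖v x‖ ^ 2)) μ :=
    (hv.norm.pow_const 2).ennreal_ofReal
  have m2 : AEMeasurable (fun x => ENNReal.ofReal (‖w x‖ ^ 2)) μ :=
    (hw.norm.pow_const 2).ennreal_ofReal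
  refine (lintegral_mono fun x => ofReal_norm_sq_add_le (v x) (w x)).trans ?_
  rw [lintegral_add_left' (m1.const_mul 2), lintegral_const_mul'' _ m1, lintegral_const_mul'' _ m2]

/-- Extension into an inclusion: smooth fields near the matrix extend into each inclusion, with
the strain controlled by the strain in a bounded part of the matrix. -/
lemma exists_extension {ι : Type*} {ω : Set (Rd d)} {F : ι → Set (Rd d)}
    (hω : IsPeriodicMatrix ω F) (k : ι) :
    ∃ (C : NNReal) (E : Set (Rd d)), (E ⊆ ω ∧ MeasurableSet E ∧ Bornology.IsBounded E) ∧
      ∀ u : Rd d → Rd d, Smooth u → ∀ ε : ℝ≥0∞, ε ≠ 0 → ∃ w : Rd d → Rd d, Smooth w ∧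
        (∀ x ∈ frontier (F k), ∀ᶠ y in 𝓝 x, w y = u y) ∧
        ∫⁻ x in F k, ENNReal.ofReal (strain w x) ≤
          C * (∫⁻ x in E, ENNReal.ofReal (strain u x)) + ε ∧
        ∫⁻ x in F k, ENNReal.ofReal (‖w x‖ ^ 2) ≤
          C * (∫⁻ x in E, ENNReal.ofReal (dens u x)) + ε := by
  have H := fun z : frontier (F k) => exists_boundary_extension hω k z.2
  choose a N E y s C ha hs hball hN hE hK hext using H
  have hcomp : IsCompact (frontier (F k)) := Metric.isCompact_of_isClosed_isBounded
    isClosed_frontier ((hω.inclusion k).isBounded.closure.subset frontier_subset_closure)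
  obtain ⟨t, ht⟩ := hcomp.elim_nhds_subcover' (fun z hz => Metric.ball z (a ⟨z, hz⟩ / 2))
    (fun z hz => Metric.ball_mem_nhds z (half_pos (ha ⟨z, hz⟩)))
  obtain ⟨C₀, hC₀⟩ := exists_blended_extension (G := F k) (fun z : frontier (F k) => (z : Rd d))
    a N C t (fun z _ => ha z) (fun z _ => hext z)
  obtain ⟨z₀, hz₀⟩ := (hω.inclusion k).frontier_connected.nonempty
  obtain ⟨z₁, hz₁, -⟩ := Set.mem_iUnion₂.1 (ht hz₀)
  have hy₁ : y z₁ ∈ ω := (hN z₁).1 (hball z₁ (Metric.mem_ball_self (hs z₁)))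
  obtain ⟨s₀, -, E₀, hE₀, hK₀⟩ := exists_kornOn_biUnion hω.isOpen hω.isConnected.isPreconnected
    N E y s t (fun z _ => hs z) (fun z _ => hball z) (fun z _ => hN z) (fun z _ => hE z)
    (fun z _ => hK z) hy₁
  obtain ⟨C₁, hC₁⟩ := hK₀.mono Set.subset_union_right subset_rfl
  obtain ⟨C₂, hC₂⟩ := exists_lintegral_rigid_le (hω.inclusion k).isOpen.measurableSet
    (hω.inclusion k).isBounded (y z₁) (hs z₁)
  obtain ⟨M, hM⟩ : ∃ M, M = ⋃ z ∈ t, N z := ⟨_, rfl⟩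
  rw [← hM] at hC₁ hC₀
  have hMm : MeasurableSet M := hM ▸ Finset.measurableSet_biUnion t fun z _ => (hN z).2.1
  have hMb : Bornology.IsBounded M :=
    hM ▸ (Bornology.isBounded_biUnion t.finite_toSet).2 fun z _ => (hN z).2.2
  have hMω : M ⊆ ω := hM ▸ Set.iUnion₂_subset fun z _ => (hN z).1
  have hBM : Metric.ball (y z₁) (s z₁) ⊆ M :=
    hM ▸ (hball z₁).trans (Set.subset_biUnion_of_mem (u := fun z => N z) hz₁)
  refine ⟨2 * C₀ * (1 + C₁) + 2 * C₂ * (2 * C₁ + 2), E₀ ∪ M, ⟨Set.union_subset hE₀.1 hMω,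
    hE₀.2.1.union hMm, hE₀.2.2.union hMb⟩, fun u hu ε hε => ?_⟩
  -- Gluing costs the square of the field. For `u - r` that term is bounded by strain through
  -- Korn–Poincaré, and adding `r` back at the end leaves the strain unchanged.
  obtain ⟨r, hr, hur⟩ := hC₁ u hu
  have hrs : Smooth r := hr.contDiff
  have hus : Smooth fun x => u x - r x := hu.sub hrs
  obtain ⟨w, hw, hwe, hwi⟩ := hC₀ _ hus (ε / 2) (by simp [hε])
  obtain ⟨J, hJ⟩ : ∃ J, J = ∫⁻ x in E₀ ∪ M, ENNReal.ofReal (strain u x) := ⟨_, rfl⟩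
  obtain ⟨J', hJ'⟩ : ∃ J', J' = ∫⁻ x in E₀ ∪ M, ENNReal.ofReal (dens u x) := ⟨_, rfl⟩
  have hJJ : J ≤ J' := by
    rw [hJ, hJ']
    exact lintegral_mono fun x => ENNReal.ofReal_le_ofReal (le_add_of_nonneg_right (sq_nonneg _))
  have hur' : ∫⁻ x in M, ENNReal.ofReal (‖u x - r x‖ ^ 2) ≤ C₁ * J := by
    refine hur.trans (mul_le_mul' le_rfl ?_)
    rw [hJ]; exact lintegral_mono_set Set.subset_union_left
  have hwi' : ∫⁻ x in F k, ENNReal.ofReal (dens w x) ≤ C₀ * (1 + C₁) * J + ε / 2 := by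
    refine hwi.trans (add_le_add ?_ le_rfl)
    rw [mul_assoc]
    refine mul_le_mul' le_rfl ?_
    calc ∫⁻ x in M, ENNReal.ofReal (dens (fun x => u x - r x) x)
        = ∫⁻ x in M, (ENNReal.ofReal (strain u x) + ENNReal.ofReal (‖u x - r x‖ ^ 2)) := by
          refine lintegral_congr fun x => ?_
          rw [dens, strain_sub_rigid hu hr, ENNReal.ofReal_add (strain_nonneg _ _) (sq_nonneg _)]
      _ = (∫⁻ x in M, ENNReal.ofReal (strain u x)) +
            ∫⁻ x in M, ENNReal.ofReal (‖u x - r x‖ ^ 2) :=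
          lintegral_add_left (measurable_ofReal_strain hu) _
      _ ≤ J + C₁ * J := by
          refine add_le_add ?_ hur'
          rw [hJ]; exact lintegral_mono_set Set.subset_union_right
      _ = (1 + C₁) * J := by ring
  have hwc : Continuous w := hw.continuous
  have hrc : Continuous r := hrs.continuous
  have huc : Continuous u := hu.continuous
  -- A rigid motion is controlled on `F k` by its values on one ball of `M`, where it is compared
  -- with `u`.
  have hr2 : ∫⁻ x in F k, ENNReal.ofReal (‖r x‖ ^ 2) ≤ C₂ * ((2 * C₁ + 2) * J') := by
    refine (hC₂ r hr).trans (mul_le_mul' le_rfl ?_)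
    have h1 := lintegral_ofReal_norm_sq_add_le (μ := volume.restrict M)
      (v := fun x => r x - u x) (w := u) (hrc.sub huc).measurable.aemeasurable
      huc.measurable.aemeasurable
    simp only [sub_add_cancel] at h1
    refine (lintegral_mono_set hBM).trans (h1.trans ?_)
    rw [add_mul, mul_assoc]
    refine add_le_add (mul_le_mul' le_rfl ?_) (mul_le_mul' le_rfl ?_)
    · simp only [norm_sub_rev (r _)]
      exact hur'.trans (mul_le_mul' le_rfl hJJ)
    · rw [hJ']
      refine (lintegral_mono_set Set.subset_union_right).trans (lintegral_mono fun x =>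
        ENNReal.ofReal_le_ofReal (le_add_of_nonneg_left (strain_nonneg _ _)))
  refine ⟨fun x => w x + r x, hw.add hrs, fun x hx => ?_, ?_, ?_⟩
  · obtain ⟨z, hz, hxz⟩ := Set.mem_iUnion₂.1 (ht hx)
    filter_upwards [hwe z hz x ⟨hx, hxz⟩] with y hy
    rw [hy, sub_add_cancel]
  · rw [← hJ]
    have h1 : ∫⁻ x in F k, ENNReal.ofReal (strain (fun x => w x + r x) x) ≤
        ∫⁻ x in F k, ENNReal.ofReal (dens w x) := by
      refine lintegral_mono fun x => ENNReal.ofReal_le_ofReal ?_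
      rw [strain_add_rigid hw hr]
      exact le_add_of_nonneg_right (sq_nonneg _)
    refine h1.trans (hwi'.trans (add_le_add (mul_le_mul' ?_ le_rfl) ENNReal.half_le_self))
    norm_cast
    have : C₀ * (1 + C₁) ≤ 2 * C₀ * (1 + C₁) := by
      rw [mul_assoc]; exact le_mul_of_one_le_left (zero_le) one_le_two
    exact this.trans le_self_add
  · rw [← hJ']
    refine (lintegral_ofReal_norm_sq_add_le hwc.measurable.aemeasurable
      hrc.measurable.aemeasurable).trans ?_
    have h1 : ∫⁻ x in F k, ENNReal.ofReal (‖w x‖ ^ 2) ≤ C₀ * (1 + C₁) * J' + ε / 2 :=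
      (lintegral_mono fun x => ENNReal.ofReal_le_ofReal
        (le_add_of_nonneg_left (strain_nonneg _ _))).trans
        (hwi'.trans (add_le_add (mul_le_mul' le_rfl hJJ) le_rfl))
    calc _ ≤ 2 * (C₀ * (1 + C₁) * J' + ε / 2) + 2 * (C₂ * ((2 * C₁ + 2) * J')) :=
          add_le_add (mul_le_mul' le_rfl h1) (mul_le_mul' le_rfl hr2)
      _ = (2 * C₀ * (1 + C₁) + 2 * C₂ * (2 * C₁ + 2)) * J' + 2 * (ε / 2) := by ring
      _ = _ := by
          rw [ENNReal.mul_div_cancel two_ne_zero (by simp)]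
          push_cast; rfl

/-! ### Geometry of the periodic family of inclusions -/

lemma latticeVec_neg (z : Fin d → ℤ) : latticeVec (-z) = -latticeVec z := by
  ext i; simp [latticeVec]

lemma one_le_dist_latticeVec {z z' : Fin d → ℤ} (h : z ≠ z') :
    1 ≤ dist (latticeVec z) (latticeVec z') := by
  obtain ⟨i, hi⟩ := Function.ne_iff.1 h
  rw [dist_eq_norm]
  refine le_trans ?_ (PiLp.norm_apply_le (latticeVec z - latticeVec z') i)
  have h1 : (1 : ℤ) ≤ |z i - z' i| := Int.one_le_abs (sub_ne_zero.2 hi)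
  have h2 : (1 : ℝ) ≤ |(z i : ℝ) - z' i| := by exact_mod_cast h1
  simpa [latticeVec] using h2

/-- A set with Lipschitz boundary is a regular open set. -/
lemma HasLipschitzBoundary.interior_closure_subset {U : Set (Rd d)}
    (hU : HasLipschitzBoundary U) (ho : IsOpen U) : interior (closure U) ⊆ U := by
  intro x hx
  by_contra hxU
  have hxf : x ∈ frontier U := by
    rw [ho.frontier_eq]; exact ⟨interior_subset hx, hxU⟩
  obtain ⟨ν, r, L, ρ, hν, hr, -, hlip, hρν, -, hneg, hzero⟩ := hU.exists_graph ho hxf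
  have hcont : Continuous fun t : ℝ => x + t • ν := by fun_prop
  have h1 : ∀ᶠ t : ℝ in 𝓝 0, x + t • ν ∈ Metric.ball x r ∩ interior (closure U) := by
    refine hcont.continuousAt.eventually (p := fun y => y ∈ Metric.ball x r ∩ interior (closure U))
      ?_
    simp only [zero_smul, add_zero]
    exact inter_mem (Metric.ball_mem_nhds x hr) (isOpen_interior.mem_nhds hx)
  -- A boundary point moved slightly downwards leaves the closure of `U`, although it should remain
  -- in the interior of that closure.
  obtain ⟨t, ht, ht0⟩ := ((h1.filter_mono nhdsWithin_le_nhds).and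
    (self_mem_nhdsWithin : Set.Iio (0 : ℝ) ∈ 𝓝[<] 0)).exists
  refine hneg _ ht.1 ?_ (interior_subset ht.2)
  rw [hρν, hzero x (Metric.mem_ball_self hr) hxf, zero_add]
  exact ht0

/-- The boundary of a set with Lipschitz boundary is a null set. -/
lemma HasLipschitzBoundary.volume_frontier {U : Set (Rd d)}
    (hU : HasLipschitzBoundary U) (ho : IsOpen U) : volume (frontier U) = 0 := by
  refine measure_null_of_locally_null _ fun x hx => ?_
  obtain ⟨ν, r, L, ρ, hν, hr, -, hlip, hρν, -, -, hzero⟩ := hU.exists_graph ho hx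
  refine ⟨Metric.ball x r ∩ frontier U, ?_, ?_⟩
  · exact inter_mem (mem_nhdsWithin_of_mem_nhds (Metric.ball_mem_nhds x hr)) self_mem_nhdsWithin
  · refine measure_mono_null (t := {y | ρ y = 0}) (fun y hy => hzero y hy.1 hy.2) ?_
    -- The function `ρ` grows at unit speed along `ν`, so the translates of its zero set by distinct
    -- multiples of `ν` are disjoint. Infinitely many bounded translations then force measure zero.
    refine Measure.addHaar_eq_zero_of_disjoint_translates volume
      (fun n : ℕ => (1 / ((n : ℝ) + 1)) • ν) ?_ ?_
      (isClosed_eq hlip.continuous continuous_const).measurableSet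
    · refine Metric.isBounded_range_iff.2 ⟨2, fun m n => ?_⟩
      have hn : ∀ n : ℕ, ‖(1 / ((n : ℝ) + 1)) • ν‖ ≤ 1 := fun n => by
        rw [norm_smul, hν, mul_one, Real.norm_of_nonneg (by positivity)]
        rw [div_le_one (by positivity)]
        have : (0 : ℝ) ≤ n := n.cast_nonneg
        linarith
      rw [dist_eq_norm]
      exact (norm_sub_le _ _).trans (by linarith [hn m, hn n])
    · intro m n hmn
      refine Set.disjoint_left.2 ?_
      rintro y hy1 hy2
      obtain ⟨_, rfl, a, ha, rfl⟩ := Set.mem_add.1 hy1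
      obtain ⟨_, rfl, b, hb, hab⟩ := Set.mem_add.1 hy2
      have h1 := congrArg ρ hab
      simp only [add_comm _ a, add_comm _ b, hρν] at h1
      rw [Set.mem_ofPred_eq] at ha hb
      rw [ha, hb, zero_add, zero_add] at h1
      apply hmn
      field_simp at h1
      have h2 : (m : ℝ) = n := by linarith
      exact_mod_cast h2

namespace IsPeriodicMatrix

variable {ι : Type*} {ω : Set (Rd d)} {F : ι → Set (Rd d)}

lemma exists_le_dist_closure (hω : IsPeriodicMatrix ω F) : ∃ c : ℝ, 0 < c ∧ ∀ k l, k ≠ l →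
    ∀ x ∈ closure (F k), ∀ y ∈ closure (F l), c ≤ dist x y := by
  obtain ⟨c, hc, h⟩ := hω.separated
  refine ⟨c, hc, fun k l hkl x hx y hy => ?_⟩
  by_contra hlt
  obtain ⟨e, he⟩ : ∃ e, e = (c - dist x y) / 2 := ⟨_, rfl⟩
  have he0 : 0 < e := by rw [he]; linarith
  obtain ⟨x', hx', hxd⟩ := Metric.mem_closure_iff.1 hx e he0
  obtain ⟨y', hy', hyd⟩ := Metric.mem_closure_iff.1 hy e he0
  have h2 := h k l hkl x' hx' y' hy'
  have h3 := dist_triangle4 x' x y y'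
  rw [dist_comm x' x] at h3
  linarith

lemma eq_of_mem_closure (hω : IsPeriodicMatrix ω F) {k l : ι} {x : Rd d}
    (hk : x ∈ closure (F k)) (hl : x ∈ closure (F l)) : k = l := by
  obtain ⟨c, hc, h⟩ := hω.exists_le_dist_closure
  by_contra hkl
  have := h k l hkl x hk x hl
  rw [dist_self] at this
  linarith

/-- The closed inclusions are a uniform distance `c` apart, so their `c / 2`-thickenings are open
and disjoint, and a connected set covered by them lies in a single one. -/
lemma exists_subset_closure (hω : IsPeriodicMatrix ω F) {S : Set (Rd d)} (hS : IsConnected S)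
    (hSω : S ⊆ ωᶜ) : ∃ l, S ⊆ closure (F l) := by
  obtain ⟨c, hc, h⟩ := hω.exists_le_dist_closure
  rw [hω.compl_eq] at hSω
  obtain ⟨x, hx⟩ := hS.nonempty
  obtain ⟨l, hl⟩ := Set.mem_iUnion.1 (hSω hx)
  obtain ⟨T, hT⟩ : ∃ T : ι → Set (Rd d), T = fun m => Metric.thickening (c / 2) (closure (F m)) :=
    ⟨_, rfl⟩
  have hTo : ∀ m, IsOpen (T m) := fun m => by rw [hT]; exact Metric.isOpen_thickening
  have hsub : ∀ m, closure (F m) ⊆ T m := fun m => by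
    rw [hT]; exact Metric.self_subset_thickening (half_pos hc) _
  have hdis : Disjoint (T l) (⋃ m ∈ {m | m ≠ l}, T m) := by
    refine Set.disjoint_iUnion₂_right.2 fun m hm => Set.disjoint_left.2 fun y hy1 hy2 => ?_
    rw [hT] at hy1 hy2
    obtain ⟨p, hp, hpd⟩ := Metric.mem_thickening_iff.1 hy1
    obtain ⟨q, hq, hqd⟩ := Metric.mem_thickening_iff.1 hy2
    have h1 := h m l hm q hq p hp
    have h2 := dist_triangle_left q p y
    linarith
  have hS' : S ⊆ T l := by
    refine hS.isPreconnected.subset_left_of_subset_union (hTo l)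
      (isOpen_biUnion fun m _ => hTo m) hdis (fun y hy => ?_) ⟨x, hx, hsub l hl⟩
    obtain ⟨m, hm⟩ := Set.mem_iUnion.1 (hSω hy)
    by_cases hml : m = l
    · exact Or.inl (hml ▸ hsub m hm)
    · exact Or.inr (Set.mem_biUnion (x := m) hml (hsub m hm))
  refine ⟨l, fun y hy => ?_⟩
  obtain ⟨m, hm⟩ := Set.mem_iUnion.1 (hSω hy)
  by_cases hml : m = l
  · exact hml ▸ hm
  · exact absurd (Set.mem_biUnion (x := m) hml (hsub m hm)) (Set.disjoint_left.1 hdis (hS' hy))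

lemma mem_sub_latticeVec (hω : IsPeriodicMatrix ω F) (z : Fin d → ℤ) (x : Rd d) :
    x - latticeVec z ∈ ω ↔ x ∈ ω := by
  rw [← hω.periodic z, sub_add_cancel]

/-- The translate is connected and misses `ω`, hence lies in one closed inclusion. It is also open,
and a Lipschitz domain equals the interior of its closure. -/
lemma exists_translate_subset (hω : IsPeriodicMatrix ω F) (k : ι) (z : Fin d → ℤ) :
    ∃ l, ∀ x ∈ F k, x + latticeVec z ∈ F l := by
  have hk := hω.inclusion k
  have himg : IsConnected ((fun x => x + latticeVec z) '' F k) :=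
    hk.isConnected.image _ (by fun_prop)
  obtain ⟨l, hl⟩ := hω.exists_subset_closure himg (by
    rintro _ ⟨x, hx, rfl⟩
    rw [Set.mem_compl_iff, hω.periodic]
    have : x ∈ ωᶜ := by
      rw [hω.compl_eq]; exact Set.mem_iUnion.2 ⟨k, subset_closure hx⟩
    exact this)
  have ho : IsOpen ((fun x => x + latticeVec z) '' F k) :=
    (Homeomorph.addRight (latticeVec z)).isOpenMap _ hk.isOpen
  exact ⟨l, fun x hx => (hω.inclusion l).lipschitz.interior_closure_subset
    (hω.inclusion l).isOpen (interior_maximal hl ho ⟨x, hx, rfl⟩)⟩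

/-- Lattice translations permute the inclusions. -/
lemma exists_translate (hω : IsPeriodicMatrix ω F) (k : ι) (z : Fin d → ℤ) :
    ∃ l, ∀ x, x + latticeVec z ∈ F l ↔ x ∈ F k := by
  obtain ⟨l, hl⟩ := hω.exists_translate_subset k z
  obtain ⟨m, hm⟩ := hω.exists_translate_subset l (-z)
  obtain ⟨x₀, hx₀⟩ := (hω.inclusion k).isConnected.nonempty
  have hkm : k = m := by
    have := hm _ (hl x₀ hx₀)
    rw [latticeVec_neg, add_neg_cancel_right] at this
    exact hω.eq_of_mem_closure (subset_closure hx₀) (subset_closure this)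
  refine ⟨l, fun x => ⟨fun hx => ?_, hl x⟩⟩
  have := hm _ hx
  rwa [latticeVec_neg, add_neg_cancel_right, ← hkm] at this

lemma locallyFinite (hω : IsPeriodicMatrix ω F) : LocallyFinite F := by
  obtain ⟨c, hc, h⟩ := hω.separated
  refine fun x => ⟨Metric.ball x (c / 2), Metric.ball_mem_nhds x (half_pos hc),
    Set.Subsingleton.finite ?_⟩
  rintro k ⟨y, hy, hyx⟩ l ⟨y', hy', hyx'⟩
  by_contra hkl
  have h1 := h k l hkl y hy y' hy'
  have h2 := dist_triangle_right y y' x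
  rw [Metric.mem_ball] at hyx hyx'
  linarith

lemma countable (hω : IsPeriodicMatrix ω F) : Countable ι :=
  Set.countable_univ_iff.1
    (hω.locallyFinite.countable_univ fun k => (hω.inclusion k).isConnected.nonempty)

/-- A lattice translation brings a point of any inclusion into the unit cube, hence into the ball of
radius √d, which meets only finitely many inclusions by local finiteness. Constants found one
inclusion at a time become uniform in this way. -/
lemma exists_finite_representatives (hω : IsPeriodicMatrix ω F) :
    ∃ (K : Finset ι) (κ : ι → ι) (τ : ι → Fin d → ℤ), (∀ l, κ l ∈ K) ∧
      (∀ l x, x + latticeVec (τ l) ∈ F l ↔ x ∈ F (κ l)) := by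
  have hfin := hω.locallyFinite.finite_nonempty_inter_compact
    (isCompact_closedBall (0 : Rd d) (Real.sqrt d))
  have h : ∀ l, ∃ (k : ι) (z : Fin d → ℤ), k ∈ hfin.toFinset ∧
      ∀ x, x + latticeVec z ∈ F l ↔ x ∈ F k := by
    intro l
    obtain ⟨x, hx⟩ := (hω.inclusion l).isConnected.nonempty
    obtain ⟨z, hz⟩ : ∃ z : Fin d → ℤ, z = fun i => ⌊x i⌋ := ⟨_, rfl⟩
    obtain ⟨k, hk⟩ := hω.exists_translate l (-z)
    refine ⟨k, z, ?_, fun y => ?_⟩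
    · rw [Set.Finite.mem_toFinset]
      refine ⟨x + latticeVec (-z), (hk x).2 hx, ?_⟩
      rw [mem_closedBall_zero_iff, EuclideanSpace.norm_eq]
      refine Real.sqrt_le_sqrt ?_
      calc ∑ i, ‖(x + latticeVec (-z)) i‖ ^ 2 ≤ ∑ i : Fin d, (1 : ℝ) := by
            refine Finset.sum_le_sum fun i _ => ?_
            have : (x + latticeVec (-z)) i = Int.fract (x i) := by
              simp [latticeVec, hz, Int.fract, sub_eq_add_neg]
            rw [this, Real.norm_of_nonneg (Int.fract_nonneg _)]
            exact pow_le_one₀ (Int.fract_nonneg _) (Int.fract_lt_one _).le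
        _ = d := by simp
    · rw [← hk (y + latticeVec z), latticeVec_neg, add_neg_cancel_right]
  choose κ τ hK hτ using h
  exact ⟨hfin.toFinset, κ, τ, hK, hτ⟩

lemma volume_compl_diff (hω : IsPeriodicMatrix ω F) : volume (ωᶜ \ ⋃ k, F k) = 0 := by
  have := hω.countable
  refine measure_mono_null (t := ⋃ k, frontier (F k)) ?_ (measure_iUnion_null fun k =>
    (hω.inclusion k).lipschitz.volume_frontier (hω.inclusion k).isOpen)
  rintro x ⟨hx, hxF⟩
  rw [hω.compl_eq] at hx
  obtain ⟨k, hk⟩ := Set.mem_iUnion.1 hx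
  refine Set.mem_iUnion.2 ⟨k, ?_⟩
  rw [(hω.inclusion k).isOpen.frontier_eq]
  exact ⟨hk, fun h => hxF (Set.mem_iUnion.2 ⟨k, h⟩)⟩

end IsPeriodicMatrix

/-! ### Uniform extension into all inclusions -/

lemma lintegral_biUnion_finset_le {α : Type*} (t : Finset α) (s : α → Set (Rd d))
    (g : Rd d → ℝ≥0∞) : ∫⁻ x in ⋃ y ∈ t, s y, g x ≤ ∑ y ∈ t, ∫⁻ x in s y, g x := by
  classical
  induction t using Finset.induction_on with
  | empty => simp
  | insert y t hy ih =>
    rw [Finset.set_biUnion_insert, Finset.sum_insert hy]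
    exact (lintegral_union_le _ _ _).trans (add_le_add le_rfl ih)

/-- The lattice translates of a bounded set overlap a bounded number of times. -/
lemma exists_tsum_lintegral_translate_le {E : Set (Rd d)} (hE : Bornology.IsBounded E) :
    ∃ N : ℕ, ∀ g : Rd d → ℝ≥0∞,
      ∑' z : Fin d → ℤ, ∫⁻ x in {x | x - latticeVec z ∈ E}, g x ≤ N * ∫⁻ x, g x := by
  -- Distinct lattice vectors are at distance at least 1, so the translates of one ball of radius
  -- 1/2 are disjoint. The number of balls in the cover bounds the overlap.
  obtain ⟨t, -, ht⟩ := hE.isCompact_closure.elim_nhds_subcover (fun x => Metric.ball x (1 / 2))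
    (fun x _ => Metric.ball_mem_nhds x (by norm_num))
  refine ⟨t.card, fun g => ?_⟩
  have hball : ∀ (y : Rd d) (z : Fin d → ℤ),
      {x | x - latticeVec z ∈ Metric.ball y (1 / 2)} = Metric.ball (y + latticeVec z) (1 / 2) := by
    intro y z
    ext x
    rw [Set.mem_ofPred_eq, Metric.mem_ball, Metric.mem_ball, dist_eq_norm, dist_eq_norm]
    congr! 2
    abel
  have h1 : ∀ z : Fin d → ℤ, ∫⁻ x in {x | x - latticeVec z ∈ E}, g x ≤
      ∑ y ∈ t, ∫⁻ x in Metric.ball (y + latticeVec z) (1 / 2), g x := by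
    intro z
    refine (lintegral_mono_set (t := ⋃ y ∈ t, Metric.ball (y + latticeVec z) (1 / 2))
      fun x hx => ?_).trans (lintegral_biUnion_finset_le t _ g)
    obtain ⟨y, hy, hxy⟩ := Set.mem_iUnion₂.1 (ht (subset_closure hx))
    refine Set.mem_iUnion₂.2 ⟨y, hy, ?_⟩
    rw [← hball]
    exact hxy
  calc ∑' z : Fin d → ℤ, ∫⁻ x in {x | x - latticeVec z ∈ E}, g x
      ≤ ∑' z : Fin d → ℤ, ∑ y ∈ t, ∫⁻ x in Metric.ball (y + latticeVec z) (1 / 2), g x :=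
        ENNReal.tsum_le_tsum h1
    _ = ∑ y ∈ t, ∑' z : Fin d → ℤ, ∫⁻ x in Metric.ball (y + latticeVec z) (1 / 2), g x :=
        Summable.tsum_finsetSum fun _ _ => ENNReal.summable
    _ ≤ ∑ y ∈ t, ∫⁻ x, g x := by
        refine Finset.sum_le_sum fun y _ => ?_
        rw [← lintegral_iUnion (fun z => measurableSet_ball)]
        · exact setLIntegral_le_lintegral _ _
        · intro z z' hzz
          refine Metric.ball_disjoint_ball ?_
          rw [dist_add_left]
          linarith [one_le_dist_latticeVec hzz]
    _ = t.card * ∫⁻ x, g x := by rw [Finset.sum_const, nsmul_eq_mul]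

/-- Extension into all inclusions with uniform constants and boundedly overlapping sources. -/
lemma exists_uniform_extension {ι : Type*} {ω : Set (Rd d)} {F : ι → Set (Rd d)}
    (hω : IsPeriodicMatrix ω F) :
    ∃ (C : NNReal) (N : ℕ) (E : ι → Set (Rd d)), (∀ l, E l ⊆ ω ∧ MeasurableSet (E l)) ∧
      (∀ g : Rd d → ℝ≥0∞, ∑' l, ∫⁻ x in E l, g x ≤ N * ∫⁻ x in ω, g x) ∧
      ∀ l, ∀ u : Rd d → Rd d, Smooth u → ∀ ε : ℝ≥0∞, ε ≠ 0 → ∃ w : Rd d → Rd d, Smooth w ∧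
        (∀ x ∈ frontier (F l), ∀ᶠ y in 𝓝 x, w y = u y) ∧
        ∫⁻ x in F l, ENNReal.ofReal (strain w x) ≤
          C * (∫⁻ x in E l, ENNReal.ofReal (strain u x)) + ε ∧
        ∫⁻ x in F l, ENNReal.ofReal (‖w x‖ ^ 2) ≤
          C * (∫⁻ x in E l, ENNReal.ofReal (dens u x)) + ε := by
  choose C E hE hext using fun k => exists_extension hω k
  choose N hN using fun k => exists_tsum_lintegral_translate_le (hE k).2.2
  obtain ⟨K, κ, τ, hK, hτ⟩ := hω.exists_finite_representatives
  have hτ' : ∀ l x, x - latticeVec (τ l) ∈ F (κ l) ↔ x ∈ F l := fun l x => by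
    rw [← hτ, sub_add_cancel]
  refine ⟨∑ k ∈ K, C k, ∑ k ∈ K, N k, fun l => {x | x - latticeVec (τ l) ∈ E (κ l)},
    fun l => ⟨fun x hx => (hω.mem_sub_latticeVec (τ l) x).1 ((hE (κ l)).1 hx),
      (measurable_id.sub_const _) (hE (κ l)).2.1⟩, fun g => ?_, fun l u hu ε hε => ?_⟩
  · have h1 : ∀ l, ∫⁻ x in {x | x - latticeVec (τ l) ∈ E (κ l)}, g x ≤
        ∫⁻ x in {x | x - latticeVec (τ l) ∈ E (κ l)}, ω.indicator g x := fun l => by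
      refine setLIntegral_mono' ((measurable_id.sub_const _) (hE (κ l)).2.1) fun x hx => ?_
      rw [Set.indicator_of_mem]
      exact (hω.mem_sub_latticeVec (τ l) x).1 ((hE (κ l)).1 hx)
    -- An inclusion is recovered from its representative and its translation, so the sum over
    -- inclusions is dominated by a sum over all such pairs.
    have hinj : Function.Injective fun l => ((⟨κ l, hK l⟩ : K), τ l) := by
      intro l l' h
      simp only [Prod.mk.injEq, Subtype.mk.injEq] at h
      obtain ⟨x, hx⟩ := (hω.inclusion l).isConnected.nonempty
      have h2 := (hτ' l x).2 hx
      rw [h.1, h.2, hτ'] at h2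
      exact hω.eq_of_mem_closure (subset_closure hx) (subset_closure h2)
    calc ∑' l, ∫⁻ x in {x | x - latticeVec (τ l) ∈ E (κ l)}, g x
        ≤ ∑' l, ∫⁻ x in {x | x - latticeVec (τ l) ∈ E (κ l)}, ω.indicator g x :=
          ENNReal.tsum_le_tsum h1
      _ ≤ ∑' p : K × (Fin d → ℤ), ∫⁻ x in {x | x - latticeVec p.2 ∈ E p.1}, ω.indicator g x :=
          ENNReal.tsum_comp_le_tsum_of_injective hinj (fun p : K × (Fin d → ℤ) =>
            ∫⁻ x in {x | x - latticeVec p.2 ∈ E p.1}, ω.indicator g x)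
      _ = ∑' k : K, ∑' z : Fin d → ℤ,
            ∫⁻ x in {x | x - latticeVec z ∈ E k}, ω.indicator g x :=
          ENNReal.tsum_prod (f := fun (k : K) (z : Fin d → ℤ) =>
            ∫⁻ x in {x | x - latticeVec z ∈ E k}, ω.indicator g x)
      _ ≤ ∑' k : K, (N k : ℝ≥0∞) * ∫⁻ x, ω.indicator g x :=
          ENNReal.tsum_le_tsum fun k => hN k _
      _ = _ := by
          rw [ENNReal.tsum_mul_right, lintegral_indicator hω.isOpen.measurableSet, tsum_fintype,
            Finset.sum_coe_sort K fun k => (N k : ℝ≥0∞)]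
          push_cast; rfl
  · obtain ⟨v, hv⟩ : ∃ v, v = latticeVec (τ l) := ⟨_, rfl⟩
    obtain ⟨w, hw, hwe, hw1, hw2⟩ := hext (κ l) (fun x => u (x + v))
      (hu.comp (contDiff_id.add contDiff_const)) ε hε
    have hC : ∀ I : ℝ≥0∞, C (κ l) * I ≤ ((∑ k ∈ K, C k : NNReal) : ℝ≥0∞) * I := fun I =>
      mul_le_mul' (ENNReal.coe_le_coe.2 (Finset.single_le_sum (f := C)
        (fun _ _ => zero_le) (hK l))) le_rfl
    have hFm : ∀ k, MeasurableSet (F k) := fun k => (hω.inclusion k).isOpen.measurableSet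
    have hEm : MeasurableSet {x | x - latticeVec (τ l) ∈ E (κ l)} :=
      (measurable_id.sub_const _) (hE (κ l)).2.1
    have hF : ∀ x ∈ F l, x + -v ∈ F (κ l) := fun x hx => by
      rw [← sub_eq_add_neg, hv]; exact (hτ' l x).2 hx
    have hEv : ∀ x ∈ E (κ l), x + v ∈ {x | x - latticeVec (τ l) ∈ E (κ l)} := fun x hx => by
      rw [Set.mem_ofPred_eq, hv, add_sub_cancel_right]; exact hx
    refine ⟨fun x => w (x + -v), hw.comp (contDiff_id.add contDiff_const), fun x hx => ?_, ?_, ?_⟩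
    · have hpre : F l = (Homeomorph.addRight (-v)) ⁻¹' F (κ l) := by
        ext y
        rw [Set.mem_preimage, Homeomorph.coe_addRight]
        simp only [← sub_eq_add_neg, hv, hτ']
      rw [hpre, ← Homeomorph.preimage_frontier] at hx
      have h1 := (Homeomorph.addRight (-v)).continuous.continuousAt.eventually (hwe _ hx)
      filter_upwards [h1] with y hy
      simpa using hy
    · refine le_trans ?_ (hw1.trans (add_le_add ((mul_le_mul' le_rfl ?_).trans (hC _)) le_rfl))
      · simp only [strain, classicalGrad_translate]
        exact setLIntegral_translate_le (fun x => ENNReal.ofReal (strain w x)) (-v) (hFm l)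
          (hFm _) hF
      · simp only [strain, classicalGrad_translate]
        exact setLIntegral_translate_le (fun x => ENNReal.ofReal (strain u x)) v
          (hE _).2.1 hEm hEv
    · refine le_trans ?_ (hw2.trans (add_le_add ((mul_le_mul' le_rfl ?_).trans (hC _)) le_rfl))
      · exact setLIntegral_translate_le (fun x => ENNReal.ofReal (‖w x‖ ^ 2)) (-v) (hFm l)
          (hFm _) hF
      · simp only [dens, strain, classicalGrad_translate]
        exact setLIntegral_translate_le (fun x => ENNReal.ofReal (dens u x)) v
          (hE _).2.1 hEm hEv

/-! ### Mollification and Sobolev fields with compact support -/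

lemma eLpNorm_two_sq {α V : Type*} [MeasurableSpace α] [NormedAddCommGroup V] (f : α → V)
    (μ : Measure α) : eLpNorm f 2 μ ^ 2 = ∫⁻ x, ENNReal.ofReal (‖f x‖ ^ 2) ∂μ := by
  have h := eLpNorm_nnreal_pow_eq_lintegral (f := f) (μ := μ) (p := 2) two_ne_zero
  simp only [NNReal.coe_ofNat, ENNReal.rpow_ofNat, ENNReal.coe_ofNat] at h
  rw [h]
  refine lintegral_congr fun x => ?_
  rw [← ofReal_norm, ENNReal.ofReal_pow (norm_nonneg _)]

lemma sq_lintegral_le {α : Type*} [MeasurableSpace α] {ν : Measure α} [IsProbabilityMeasure ν]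
    {f : α → ℝ≥0∞} (hf : AEMeasurable f ν) : (∫⁻ x, f x ∂ν) ^ 2 ≤ ∫⁻ x, f x ^ 2 ∂ν := by
  have h := ENNReal.lintegral_mul_le_Lp_mul_Lq ν Real.HolderConjugate.two_two hf
    (aemeasurable_const (b := (1 : ℝ≥0∞)))
  simp only [Pi.mul_apply, mul_one, one_pow, ENNReal.one_rpow, lintegral_const, measure_univ,
    ENNReal.rpow_ofNat] at h
  calc (∫⁻ x, f x ∂ν) ^ 2 ≤ ((∫⁻ x, f x ^ 2 ∂ν) ^ (1 / 2 : ℝ)) ^ 2 := by gcongr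
    _ = _ := by
      rw [← ENNReal.rpow_natCast, ← ENNReal.rpow_mul]
      norm_num

/-- Translations are continuous in `L²`. -/
lemma exists_eLpNorm_translate_le {h : Rd d → ℝ} (hh : MemLp h 2 volume) {ε : ℝ≥0∞}
    (hε : ε ≠ 0) : ∃ r > 0, ∀ s : Rd d, ‖s‖ < r →
      eLpNorm (fun x => h (x - s) - h x) 2 volume ≤ ε := by
  let gs : C(Rd d, C(Rd d, Rd d)) :=
    ContinuousMap.curry ⟨fun p : Rd d × Rd d => p.2 - p.1, by fun_prop⟩
  have hgm : ∀ s, MeasurePreserving (gs s) volume volume := fun s =>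
    measurePreserving_sub_right volume s
  have hc : Continuous fun s => Lp.compMeasurePreserving (gs s) (hgm s) (hh.toLp h) :=
    continuous_const.compMeasurePreservingLp gs.continuous hgm (by simp)
  have h1 := hc.continuousAt.eventually
    (Metric.eball_mem_nhds (Lp.compMeasurePreserving (gs 0) (hgm 0) (hh.toLp h))
      (pos_iff_ne_zero.2 hε))
  obtain ⟨r, hr, hr'⟩ := Metric.eventually_nhds_iff.1 h1
  refine ⟨r, hr, fun s hs => ?_⟩
  have h2 := hr' (y := s) (by rwa [dist_zero_right])
  rw [Lp.toLp_compMeasurePreserving, Lp.toLp_compMeasurePreserving,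
    Lp.edist_toLp_toLp] at h2
  refine le_trans (le_of_eq ?_) h2.le
  congr 1
  funext x
  simp [gs]

open scoped Convolution in
/-- Mollification is close to the identity in `L²`. -/
lemma eLpNorm_convolution_sub_le {h : Rd d → ℝ} (hh : MemLp h 2 volume) {ε : ℝ≥0∞} {r : ℝ}
    (hr : ∀ s : Rd d, ‖s‖ < r → eLpNorm (fun x => h (x - s) - h x) 2 volume ≤ ε)
    (η : ContDiffBump (0 : Rd d)) (hη : η.rOut ≤ r) :
    eLpNorm (fun x => (h ⋆[ContinuousLinearMap.mul ℝ ℝ, volume] η.normed volume) x - h x)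
      2 volume ≤ ε := by
  -- A strongly measurable representative makes `h (x - s)` jointly measurable in both variables, as
  -- the exchange of integrals requires.
  wlog hm : StronglyMeasurable h generalizing h
  · obtain ⟨h', hm', he⟩ := hh.1
    have hconv : (h ⋆[ContinuousLinearMap.mul ℝ ℝ, volume] η.normed volume) =
        (h' ⋆[ContinuousLinearMap.mul ℝ ℝ, volume] η.normed volume) := by
      funext x
      refine integral_congr_ae ?_
      filter_upwards [he] with t ht
      rw [ht]
    have hae : (fun x => (h ⋆[ContinuousLinearMap.mul ℝ ℝ, volume] η.normed volume) x - h x)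
        =ᵐ[volume]
        fun x => (h' ⋆[ContinuousLinearMap.mul ℝ ℝ, volume] η.normed volume) x - h' x := by
      rw [hconv]
      filter_upwards [he] with t ht
      rw [ht]
    rw [eLpNorm_congr_ae hae]
    refine this (hh.ae_eq he) (fun s hs => ?_) hm'
    rw [← eLpNorm_congr_ae (μ := volume) (f := fun x => h (x - s) - h x)]
    · exact hr s hs
    · filter_upwards [he, (measurePreserving_sub_right volume s).quasiMeasurePreserving.ae he]
        with x hx hxs
      rw [hx, hxs]
  obtain ⟨n, hn⟩ : ∃ n, n = η.normed volume := ⟨_, rfl⟩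
  have hnc : Continuous n := hn ▸ η.continuous_normed
  have hn0 : ∀ x, 0 ≤ n x := fun x => hn ▸ η.nonneg_normed x
  have hnint : ∫⁻ s, ENNReal.ofReal (n s) = 1 := by
    rw [← ofReal_integral_eq_lintegral_ofReal (hn ▸ η.integrable_normed) (ae_of_all _ hn0), hn,
      η.integral_normed, ENNReal.ofReal_one]
  have hnsupp : ∀ s, n s ≠ 0 → ‖s‖ < r := fun s hs => by
    have : s ∈ Function.support (η.normed volume) := hn ▸ hs
    rw [η.support_normed_eq, mem_ball_zero_iff] at this
    exact this.trans_le hη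
  -- With the mollifier as a probability density, the mollification error is an average of
  -- translation errors, and the square passes inside the average.
  obtain ⟨ν, hν⟩ : ∃ ν : Measure (Rd d), ν = volume.withDensity fun s => ENNReal.ofReal (n s) :=
    ⟨_, rfl⟩
  have hnm : Measurable fun s => ENNReal.ofReal (n s) := hnc.measurable.ennreal_ofReal
  have hνp : IsProbabilityMeasure ν := ⟨by
    rw [hν, withDensity_apply _ MeasurableSet.univ, Measure.restrict_univ, hnint]⟩
  have hνi : ∀ f : Rd d → ℝ≥0∞, Measurable f →
      ∫⁻ s, f s ∂ν = ∫⁻ s, ENNReal.ofReal (n s) * f s := fun f hf => by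
    rw [hν, lintegral_withDensity_eq_lintegral_mul _ hnm hf]; rfl
  have hhm : Measurable h := hm.measurable
  have hpt : ∀ x, ENNReal.ofReal
      (‖(h ⋆[ContinuousLinearMap.mul ℝ ℝ, volume] η.normed volume) x - h x‖ ^ 2) ≤
      ∫⁻ s, ENNReal.ofReal (‖h (x - s) - h x‖ ^ 2) ∂ν := by
    intro x
    have hmx : Measurable fun s => h (x - s) - h x :=
      (hhm.comp (measurable_const.sub measurable_id)).sub measurable_const
    have hex : Integrable (fun s => h (x - s) * n s) volume := by
      have := (η.hasCompactSupport_normed (μ := volume)).convolutionExists_right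
        (ContinuousLinearMap.mul ℝ ℝ) (hh.locallyIntegrable one_le_two) η.continuous_normed x
      rw [hn]
      exact this.integrable_swap
    have e1 : (h ⋆[ContinuousLinearMap.mul ℝ ℝ, volume] η.normed volume) x - h x =
        ∫ s, (h (x - s) - h x) * n s := by
      rw [convolution_eq_swap]
      simp only [sub_mul, ContinuousLinearMap.mul_apply', ← hn]
      rw [integral_sub hex ((hn ▸ η.integrable_normed).const_mul _), integral_const_mul, hn,
        η.integral_normed, mul_one]
    have e2 : ‖(h ⋆[ContinuousLinearMap.mul ℝ ℝ, volume] η.normed volume) x - h x‖ₑ ≤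
        ∫⁻ s, ‖h (x - s) - h x‖ₑ ∂ν := by
      rw [e1, hνi _ hmx.enorm]
      refine (enorm_integral_le_lintegral_enorm _).trans (lintegral_mono fun s => ?_)
      rw [enorm_mul, mul_comm, Real.enorm_of_nonneg (hn0 s)]
    calc _ = ‖(h ⋆[ContinuousLinearMap.mul ℝ ℝ, volume] η.normed volume) x - h x‖ₑ ^ 2 := by
          rw [← ofReal_norm, ENNReal.ofReal_pow (norm_nonneg _)]
      _ ≤ (∫⁻ s, ‖h (x - s) - h x‖ₑ ∂ν) ^ 2 := by gcongr
      _ ≤ ∫⁻ s, ‖h (x - s) - h x‖ₑ ^ 2 ∂ν := sq_lintegral_le hmx.enorm.aemeasurable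
      _ = _ := by
          refine lintegral_congr fun s => ?_
          rw [← ofReal_norm, ENNReal.ofReal_pow (norm_nonneg _)]
  have hsq : eLpNorm (fun x => (h ⋆[ContinuousLinearMap.mul ℝ ℝ, volume] η.normed volume) x - h x)
      2 volume ^ 2 ≤ ε ^ 2 := by
    rw [eLpNorm_two_sq]
    have hm2 : Measurable fun p : Rd d × Rd d => ENNReal.ofReal (‖h (p.1 - p.2) - h p.1‖ ^ 2) :=
      (((hhm.comp (measurable_fst.sub measurable_snd)).sub
        (hhm.comp measurable_fst)).norm.pow_const 2).ennreal_ofReal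
    calc _ ≤ ∫⁻ x, ∫⁻ s, ENNReal.ofReal (‖h (x - s) - h x‖ ^ 2) ∂ν := lintegral_mono hpt
      _ = ∫⁻ s, (∫⁻ x, ENNReal.ofReal (‖h (x - s) - h x‖ ^ 2)) ∂ν :=
          lintegral_lintegral_swap hm2.aemeasurable
      _ = ∫⁻ s, ENNReal.ofReal (n s) * ∫⁻ x, ENNReal.ofReal (‖h (x - s) - h x‖ ^ 2) :=
          hνi _ (hm2.lintegral_prod_left' (μ := volume))
      _ ≤ ∫⁻ s, ENNReal.ofReal (n s) * ε ^ 2 := by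
          refine lintegral_mono fun s => ?_
          by_cases hs : n s = 0
          · simp [hs]
          · rw [← eLpNorm_two_sq]
            have := hr s (hnsupp s hs)
            gcongr
      _ = ε ^ 2 := by rw [lintegral_mul_const _ hnm, hnint, one_mul]
  exact (ENNReal.pow_le_pow_left_iff two_ne_zero).1 hsq

open scoped Convolution in
/-- A compactly supported Sobolev function is a limit of test functions. -/
lemma exists_isTest_scalar_approx {Ω K : Set (Rd d)} (hΩ : IsOpen Ω) (hK : IsCompact K)
    (hKΩ : K ⊆ Ω) {f : Rd d → ℝ} {g : Fin d → Rd d → ℝ} (hf : MemLp f 2 volume)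
    (hg : ∀ i, MemLp (g i) 2 volume) (hfK : ∀ x ∉ K, f x = 0)
    (hweak : ∀ i, ∀ φ : Rd d → ℝ, IsTest Set.univ φ →
      ∫ x, f x * fderiv ℝ φ x (EuclideanSpace.single i 1) = -∫ x, g i x * φ x)
    {ε : ℝ≥0∞} (hε : ε ≠ 0) :
    ∃ φ : Rd d → ℝ, IsTest Ω φ ∧ eLpNorm (fun x => φ x - f x) 2 volume ≤ ε ∧
      ∀ i, eLpNorm (fun x => fderiv ℝ φ x (EuclideanSpace.single i 1) - g i x) 2 volume ≤ ε := by
  have hev : ∀ {h : Rd d → ℝ}, MemLp h 2 volume → ∀ᶠ r : ℝ in 𝓝[>] 0, ∀ s : Rd d, ‖s‖ < r →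
      eLpNorm (fun x => h (x - s) - h x) 2 volume ≤ ε := fun hh => by
    obtain ⟨r, hr, h⟩ := exists_eLpNorm_translate_le hh hε
    filter_upwards [Ioo_mem_nhdsGT hr] with r' hr' s hs using h s (hs.trans hr'.2)
  obtain ⟨e, he, heΩ⟩ := hK.exists_cthickening_subset_open hΩ hKΩ
  obtain ⟨r, hrf, hrg, hr0, hre⟩ := ((hev hf).and ((eventually_all.2 fun i => hev (hg i)).and
    (Ioo_mem_nhdsGT he))).exists
  have hr0' : 0 < r := hr0
  obtain ⟨η, hη⟩ : ∃ η : ContDiffBump (0 : Rd d), η.rOut = r :=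
    ⟨⟨r / 2, r, half_pos hr0', half_lt_self hr0'⟩, rfl⟩
  have hns : Smooth (η.normed volume) := η.contDiff_normed
  have hnc : HasCompactSupport (η.normed volume) := η.hasCompactSupport_normed
  have hfl := hf.locallyIntegrable one_le_two
  have hderiv : ∀ i x, fderiv ℝ (f ⋆[ContinuousLinearMap.mul ℝ ℝ, volume] η.normed volume) x
      (EuclideanSpace.single i 1) =
      (g i ⋆[ContinuousLinearMap.mul ℝ ℝ, volume] η.normed volume) x := by
    intro i x
    have hn1 : ContDiff ℝ 1 (η.normed volume) := η.contDiff_normed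
    rw [(hnc.hasFDerivAt_convolution_right (ContinuousLinearMap.mul ℝ ℝ) hfl hn1 x).fderiv,
      convolution_precompR_apply _ hfl (hnc.fderiv ℝ) (hn1.continuous_fderiv one_ne_zero)]
    have hψs : Smooth fun t => η.normed volume (x - t) :=
      hns.comp (contDiff_const.sub contDiff_id)
    -- Testing the weak derivative against the reflected and translated mollifier moves the
    -- derivative from the mollifier onto `f`.
    have hψ : IsTest Set.univ fun t => η.normed volume (x - t) :=
      ⟨hψs, hnc.comp_homeomorph (Homeomorph.subLeft x), Set.subset_univ _⟩
    have hψd : ∀ t, fderiv ℝ (fun t => η.normed volume (x - t)) t (EuclideanSpace.single i 1) =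
        -fderiv ℝ (η.normed volume) (x - t) (EuclideanSpace.single i 1) := fun t => by
      have h1 : HasFDerivAt (fun t : Rd d => x - t) (-ContinuousLinearMap.id ℝ (Rd d)) t :=
        (hasFDerivAt_id t).const_sub x
      have h2 := (hn1.differentiable one_ne_zero (x - t)).hasFDerivAt.comp t h1
      rw [HasFDerivAt.fderiv (f := fun t => η.normed volume (x - t)) h2]
      simp
    have h3 := hweak i _ hψ
    simp only [hψd, mul_neg, integral_neg, neg_inj] at h3
    simpa [convolution_def] using h3
  have hsupp : Function.support (f ⋆[ContinuousLinearMap.mul ℝ ℝ, volume] η.normed volume) ⊆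
      Metric.cthickening e K := by
    refine (support_convolution_subset _).trans ?_
    intro x hx
    obtain ⟨a, ha, b, hb, rfl⟩ := Set.mem_add.1 hx
    have haK : a ∈ K := by_contra fun h => ha (hfK a h)
    rw [η.support_normed_eq, mem_ball_zero_iff] at hb
    refine Metric.mem_cthickening_of_dist_le _ a _ _ haK ?_
    rw [dist_eq_norm, add_sub_cancel_left]
    linarith [hre]
  refine ⟨f ⋆[ContinuousLinearMap.mul ℝ ℝ, volume] η.normed volume,
    ⟨hnc.contDiff_convolution_right _ hfl hns,
      HasCompactSupport.of_support_subset_isCompact hK.cthickening hsupp,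
      (closure_minimal hsupp Metric.isClosed_cthickening).trans heΩ⟩,
    eLpNorm_convolution_sub_le hf hrf η hη.le, fun i => ?_⟩
  simp only [hderiv]
  exact eLpNorm_convolution_sub_le (hg i) (hrg i) η hη.le

lemma eLpNorm_le_sum_apply {μ : Measure (Rd d)} {v : Rd d → Rd d}
    (hv : AEStronglyMeasurable v μ) :
    eLpNorm v 2 μ ≤ ∑ α, eLpNorm (fun x => v x α) 2 μ := by
  have hm : ∀ α, AEStronglyMeasurable (fun x => v x α) μ := fun α =>
    (EuclideanSpace.proj (𝕜 := ℝ) α).continuous.comp_aestronglyMeasurable hv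
  have h1 : eLpNorm v 2 μ ≤ eLpNorm (∑ α, fun x => |v x α|) 2 μ := by
    refine eLpNorm_mono_real fun x => ?_
    rw [Finset.sum_apply, ← sq_le_sq₀ (norm_nonneg _) (Finset.sum_nonneg fun _ _ => abs_nonneg _),
      norm_sq_eq_sum]
    calc ∑ α, v x α ^ 2 = ∑ α, |v x α| ^ 2 := by simp only [sq_abs]
      _ ≤ _ := Finset.sum_sq_le_sq_sum_of_nonneg fun _ _ => abs_nonneg _
  refine h1.trans ((eLpNorm_sum_le (fun α _ => (hm α).norm) one_le_two).trans_eq ?_)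
  exact Finset.sum_congr rfl fun α _ => eLpNorm_norm _

lemma fderiv_apply {φ : Rd d → Rd d} {x : Rd d} (hφ : DifferentiableAt ℝ φ x) (α : Fin d)
    (v : Rd d) : fderiv ℝ (fun y => φ y α) x v = fderiv ℝ φ x v α := by
  have := (EuclideanSpace.proj (𝕜 := ℝ) α).hasFDerivAt.comp x hφ.hasFDerivAt
  rw [HasFDerivAt.fderiv (f := fun y => φ y α) this]
  rfl

/-- A compactly supported Sobolev field is a limit of test fields. -/
lemma MemH1.exists_isTest_approx {Ω K : Set (Rd d)} (hΩ : IsOpen Ω) (hK : IsCompact K)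
    (hKΩ : K ⊆ Ω) {f : Rd d → Rd d} {g : MatrixField d} (h : MemH1 Set.univ f g)
    (hfK : ∀ x ∉ K, f x = 0) {ε : ℝ≥0∞} (hε : ε ≠ 0) :
    ∃ φ : Rd d → Rd d, IsTest Ω φ ∧ eLpNorm (fun x => φ x - f x) 2 volume ≤ ε ∧
      ∀ i α, eLpNorm (fun x => classicalGrad φ x i α - g x i α) 2 volume ≤ ε := by
  have hf := h.memLp
  have hg := h.grad_memLp
  have hw := h.weak
  simp only [Measure.restrict_univ] at hf hg hw
  have hd : ε / (d + 1) ≠ 0 := ENNReal.div_ne_zero.2 ⟨hε, by finiteness⟩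
  have hle : ε / (d + 1) ≤ ε := ENNReal.div_le_of_le_mul (le_mul_of_one_le_right (zero_le)
    le_add_self)
  choose φ hφ hφ1 hφ2 using fun α => exists_isTest_scalar_approx hΩ hK hKΩ
    (f := fun x => f x α) (g := fun i x => g x i α)
    (hf.continuousLinearMap_comp (EuclideanSpace.proj (𝕜 := ℝ) α)) (fun i => hg i α)
    (fun x hx => by rw [hfK x hx]; rfl) (fun i => hw i α) hd
  obtain ⟨Φ, hΦ⟩ : ∃ Φ : Rd d → Rd d, Φ = fun x => WithLp.toLp 2 fun α => φ α x := ⟨_, rfl⟩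
  have hΦa : ∀ x α, Φ x α = φ α x := fun x α => by rw [hΦ]
  have hs : Smooth Φ := by
    refine contDiff_euclidean.2 fun α => ?_
    simp only [hΦa]
    exact (hφ α).1
  have hsupp : Function.support Φ ⊆ ⋃ α, tsupport (φ α) := fun x hx => by
    by_contra hn
    refine hx ?_
    ext α
    rw [hΦa]
    exact image_eq_zero_of_notMem_tsupport fun hx' => hn (Set.mem_iUnion.2 ⟨α, hx'⟩)
  have hcomp : IsCompact (⋃ α, tsupport (φ α)) := isCompact_iUnion fun α => (hφ α).2.1
  refine ⟨Φ, ⟨hs, HasCompactSupport.of_support_subset_isCompact hcomp hsupp,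
    (closure_minimal hsupp hcomp.isClosed).trans (Set.iUnion_subset fun α => (hφ α).2.2)⟩, ?_,
    fun i α => ?_⟩
  · refine (eLpNorm_le_sum_apply (hs.continuous.aestronglyMeasurable.sub hf.1)).trans ?_
    calc ∑ α, eLpNorm (fun x => (Φ x - f x) α) 2 volume ≤ ∑ _α : Fin d, ε / (d + 1) := by
          refine Finset.sum_le_sum fun α _ => ?_
          simpa [hΦa] using hφ1 α
      _ ≤ ε := by
          rw [Finset.sum_const, Finset.card_univ, Fintype.card_fin, nsmul_eq_mul]
          refine le_trans (mul_le_mul' ?_ le_rfl) ENNReal.mul_div_le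
          exact le_self_add
  · refine le_trans (le_of_eq ?_) ((hφ2 α i).trans hle)
    congr 1
    funext x
    have h1 := fderiv_apply (hs.differentiable (by simp) x) α (EuclideanSpace.single i 1)
    simp only [hΦa] at h1
    rw [classicalGrad, Matrix.of_apply, ← h1]

lemma MemH1.of_univ {Ω : Set (Rd d)} {f : Rd d → Rd d} {g : MatrixField d}
    (h : MemH1 Set.univ f g) : MemH1 Ω f g := by
  have hr : volume.restrict Ω ≤ volume.restrict Set.univ :=
    Measure.restrict_mono (Set.subset_univ _) le_rfl
  refine ⟨h.memLp.mono_measure hr, fun i α => (h.grad_memLp i α).mono_measure hr,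
    fun i α φ hφ => ?_⟩
  have hz : ∀ x ∉ Ω, φ x = 0 := fun x hx =>
    image_eq_zero_of_notMem_tsupport fun hx' => hx (hφ.2.2 hx')
  have hz' : ∀ x ∉ Ω, fderiv ℝ φ x = 0 := fun x hx =>
    image_eq_zero_of_notMem_tsupport fun hx' => hx (hφ.2.2 (tsupport_fderiv_subset ℝ hx'))
  have h1 := h.weak i α φ ⟨hφ.1, hφ.2.1, Set.subset_univ _⟩
  rw [setIntegral_eq_integral_of_forall_compl_eq_zero, setIntegral_eq_integral_of_forall_compl_eq_zero]
  · simpa using h1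
  · intro x hx; rw [hz x hx, mul_zero]
  · intro x hx; rw [hz' x hx]; simp

/-- A Sobolev field with compact support in `Ω` belongs to `H¹₀`. -/
lemma MemH1.memH10 {Ω K : Set (Rd d)} (hΩ : IsOpen Ω) (hK : IsCompact K) (hKΩ : K ⊆ Ω)
    {f : Rd d → Rd d} {g : MatrixField d} (h : MemH1 Set.univ f g) (hfK : ∀ x ∉ K, f x = 0) :
    MemH10 Ω f g := by
  have hε : ∀ n : ℕ, ((n : ℝ≥0∞) + 1)⁻¹ ≠ 0 := fun n => ENNReal.inv_ne_zero.2 (by finiteness)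
  choose φ hφ h1 h2 using fun n => h.exists_isTest_approx hΩ hK hKΩ hfK (hε n)
  have hlim : Tendsto (fun n : ℕ => ((n : ℝ≥0∞) + 1)⁻¹) atTop (𝓝 0) := by
    have := ENNReal.tendsto_inv_nat_nhds_zero.comp (tendsto_add_atTop_nat 1)
    simpa [Function.comp_def] using this
  refine ⟨h.of_univ, φ, hφ, ?_, fun i α => ?_⟩
  · exact tendsto_of_tendsto_of_tendsto_of_le_of_le tendsto_const_nhds hlim (fun n => zero_le)
      fun n => (eLpNorm_restrict_le _ _ _ _).trans (h1 n)
  · exact tendsto_of_tendsto_of_tendsto_of_le_of_le tendsto_const_nhds hlim (fun n => zero_le)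
      fun n => (eLpNorm_restrict_le _ _ _ _).trans (h2 n i α)

lemma hasCompactSupport_classicalGrad {φ : Rd d → Rd d} (hφ : HasCompactSupport φ)
    (i α : Fin d) : HasCompactSupport fun x => classicalGrad φ x i α :=
  (hφ.fderiv_apply ℝ (EuclideanSpace.single i 1)).comp_left (g := fun v : Rd d => v α) rfl

lemma IsTest.memH1 {Ω : Set (Rd d)} {φ : Rd d → Rd d} (hφ : IsTest Ω φ) :
    MemH1 Set.univ φ (classicalGrad φ) := by
  have hs : Smooth φ := hφ.1
  have hcα : ∀ α, Continuous fun x => φ x α := fun α =>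
    (EuclideanSpace.proj (𝕜 := ℝ) α).continuous.comp hs.continuous
  refine ⟨hs.continuous.memLp_of_hasCompactSupport hφ.2.1, fun i α =>
    (continuous_classicalGrad hs i α).memLp_of_hasCompactSupport
      (hasCompactSupport_classicalGrad hφ.2.1 i α), fun i α ψ hψ => ?_⟩
  have hψs : Smooth ψ := hψ.1
  have hdψ : Continuous fun x => fderiv ℝ ψ x (EuclideanSpace.single i 1) :=
    (hψs.continuous_fderiv (by simp)).clm_apply continuous_const
  have hdφ : ∀ x, fderiv ℝ (fun y => φ y α) x (EuclideanSpace.single i 1) =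
      classicalGrad φ x i α := fun x => by
    rw [fderiv_apply (hs.differentiable (by simp) x)]; rfl
  rw [Measure.restrict_univ, integral_mul_fderiv_eq_neg_fderiv_mul_of_integrable]
  · simp only [hdφ]
  · simp only [hdφ]
    exact ((continuous_classicalGrad hs i α).mul hψs.continuous).integrable_of_hasCompactSupport
      hψ.2.1.mul_left
  · exact ((hcα α).mul hdψ).integrable_of_hasCompactSupport
      (hψ.2.1.fderiv_apply ℝ _).mul_left
  · exact ((hcα α).mul hψs.continuous).integrable_of_hasCompactSupport hψ.2.1.mul_left
  · exact fun x _ => ((EuclideanSpace.proj (𝕜 := ℝ) α).differentiableAt.comp x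
      (hs.differentiable (by simp) x))
  · exact fun x _ => hψs.differentiable (by simp) x

lemma IsTest.memH10 {Ω : Set (Rd d)} (hΩ : IsOpen Ω) {φ : Rd d → Rd d} (hφ : IsTest Ω φ) :
    MemH10 Ω φ (classicalGrad φ) :=
  hφ.memH1.memH10 hΩ hφ.2.1 hφ.2.2 fun _ hx => image_eq_zero_of_notMem_tsupport hx

/-- The product of a Sobolev field with a scalar test function is a Sobolev field on the whole
space. -/
lemma MemH1.smul_isTest {Ω : Set (Rd d)} (hΩ : MeasurableSet Ω) {u : Rd d → Rd d}
    {G : MatrixField d} (h : MemH1 Ω u G) {η : Rd d → ℝ} (hη : IsTest Ω η) :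
    MemH1 Set.univ (fun x => η x • u x) (fun x => η x • G x + gradTensor η x (u x)) := by
  have hs : Smooth η := hη.1
  have hz : ∀ x ∉ Ω, η x = 0 := fun x hx =>
    image_eq_zero_of_notMem_tsupport fun hx' => hx (hη.2.2 hx')
  have hz' : ∀ x ∉ Ω, fderiv ℝ η x = 0 := fun x hx =>
    image_eq_zero_of_notMem_tsupport fun hx' => hx (hη.2.2 (tsupport_fderiv_subset ℝ hx'))
  have hdη : ∀ i, Continuous fun x => fderiv ℝ η x (EuclideanSpace.single i 1) := fun i =>
    (hs.continuous_fderiv (by simp)).clm_apply continuous_const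
  have hηL : MemLp η ∞ (volume.restrict Ω) :=
    hs.continuous.memLp_of_hasCompactSupport hη.2.1
  have hdL : ∀ i, MemLp (fun x => fderiv ℝ η x (EuclideanSpace.single i 1)) ∞
      (volume.restrict Ω) := fun i =>
    (hdη i).memLp_of_hasCompactSupport (hη.2.1.fderiv_apply ℝ _)
  have huα : ∀ α, MemLp (fun x => u x α) 2 (volume.restrict Ω) := fun α =>
    h.memLp.continuousLinearMap_comp (EuclideanSpace.proj (𝕜 := ℝ) α)
  refine ⟨?_, fun i α => ?_, fun i α φ hφ => ?_⟩
  · rw [Measure.restrict_univ]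
    have h1 : MemLp (fun x => η x • u x) 2 (volume.restrict Ω) := h.memLp.smul hηL
    rw [← memLp_indicator_iff_restrict hΩ, Set.indicator_eq_self.2] at h1
    · exact h1
    · exact fun x hx => by_contra fun hn => hx (by simp [hz x hn])
  · rw [Measure.restrict_univ]
    have h1 : MemLp (fun x => (η x • G x + gradTensor η x (u x)) i α) 2 (volume.restrict Ω) := by
      have e : (fun x => (η x • G x + gradTensor η x (u x)) i α) = fun x =>
          η x * G x i α + fderiv ℝ η x (EuclideanSpace.single i 1) * u x α := by
        funext x; simp [gradTensor]
      rw [e]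
      exact ((h.grad_memLp i α).mul' hηL).add ((huα α).mul' (hdL i))
    rw [← memLp_indicator_iff_restrict hΩ, Set.indicator_eq_self.2] at h1
    · exact h1
    · exact fun x hx => by_contra fun hn => hx (by simp [hz x hn, gradTensor, hz' x hn])
  · have hφs : Smooth φ := hφ.1
    have hψ : IsTest Ω fun x => η x * φ x :=
      ⟨hs.mul hφs, hη.2.1.mul_right, (tsupport_mul_subset_left).trans hη.2.2⟩
    have hd : ∀ x, fderiv ℝ (fun x => η x * φ x) x (EuclideanSpace.single i 1) =
        η x * fderiv ℝ φ x (EuclideanSpace.single i 1) +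
          φ x * fderiv ℝ η x (EuclideanSpace.single i 1) := fun x => by
      rw [fderiv_fun_mul (hs.differentiable (by simp) x) (hφs.differentiable (by simp) x)]
      simp
    have h1 := h.weak i α _ hψ
    have hdφ : Continuous fun x => fderiv ℝ φ x (EuclideanSpace.single i 1) :=
      (hφs.continuous_fderiv (by simp)).clm_apply continuous_const
    have i1 : Integrable (fun x => u x α * (η x * fderiv ℝ φ x (EuclideanSpace.single i 1)))
        (volume.restrict Ω) :=
      (huα α).integrable_mul ((hs.continuous.mul hdφ).memLp_of_hasCompactSupport (p := 2)
        hη.2.1.mul_right)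
    have i2 : Integrable (fun x => u x α * (φ x * fderiv ℝ η x (EuclideanSpace.single i 1)))
        (volume.restrict Ω) :=
      (huα α).integrable_mul ((hφs.continuous.mul (hdη i)).memLp_of_hasCompactSupport (p := 2)
        hφ.2.1.mul_right)
    have i3 : Integrable (fun x => G x i α * (η x * φ x)) (volume.restrict Ω) :=
      (h.grad_memLp i α).integrable_mul
        ((hs.continuous.mul hφs.continuous).memLp_of_hasCompactSupport (p := 2) hη.2.1.mul_right)
    simp only [hd, mul_add] at h1
    rw [integral_add i1 i2] at h1
    have f1 : ∫ x, (η x • u x) α * fderiv ℝ φ x (EuclideanSpace.single i 1) =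
        ∫ x in Ω, (η x • u x) α * fderiv ℝ φ x (EuclideanSpace.single i 1) :=
      (setIntegral_eq_integral_of_forall_compl_eq_zero fun x hx => by simp [hz x hx]).symm
    have f2 : ∫ x, (η x • G x + gradTensor η x (u x)) i α * φ x =
        ∫ x in Ω, (η x • G x + gradTensor η x (u x)) i α * φ x :=
      (setIntegral_eq_integral_of_forall_compl_eq_zero fun x hx => by
        simp [hz x hx, gradTensor, hz' x hx]).symm
    have e1 : ∫ x in Ω, (η x • u x) α * fderiv ℝ φ x (EuclideanSpace.single i 1) =
        ∫ x in Ω, u x α * (η x * fderiv ℝ φ x (EuclideanSpace.single i 1)) := by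
      congr 1; funext x; simp; ring
    have e2 : ∫ x in Ω, (η x • G x + gradTensor η x (u x)) i α * φ x =
        ∫ x in Ω, (G x i α * (η x * φ x) +
          u x α * (φ x * fderiv ℝ η x (EuclideanSpace.single i 1))) := by
      congr 1; funext x; simp [gradTensor]; ring
    rw [Measure.restrict_univ, f1, f2, e1, e2, integral_add i3 i2]
    linarith

/-! ### The elasticity form -/

section Form

variable (a : Fin d → Fin d → Fin d → Fin d → ℝ) (ξ ζ ζ' : Matrix (Fin d) (Fin d) ℝ)

lemma form_add_right : form a ξ (ζ + ζ') = form a ξ ζ + form a ξ ζ' := by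
  simp only [form, Matrix.add_apply, mul_add, Finset.sum_add_distrib]

lemma form_smul_right (c : ℝ) : form a ξ (c • ζ) = c * form a ξ ζ := by
  simp only [form, Matrix.smul_apply, smul_eq_mul, Finset.mul_sum]
  refine Finset.sum_congr rfl fun i _ => Finset.sum_congr rfl fun j _ =>
    Finset.sum_congr rfl fun α _ => Finset.sum_congr rfl fun β _ => by ring

lemma form_smul_left (c : ℝ) : form a (c • ξ) ζ = c * form a ξ ζ := by
  simp only [form, Matrix.smul_apply, smul_eq_mul, Finset.mul_sum]
  refine Finset.sum_congr rfl fun i _ => Finset.sum_congr rfl fun j _ =>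
    Finset.sum_congr rfl fun α _ => Finset.sum_congr rfl fun β _ => by ring

lemma form_sub_right : form a ξ (ζ - ζ') = form a ξ ζ - form a ξ ζ' := by
  rw [sub_eq_add_neg, ← neg_one_smul ℝ ζ', form_add_right, form_smul_right]
  ring

end Form

/-- The symmetric part of a matrix. -/
noncomputable def symPart (ξ : Matrix (Fin d) (Fin d) ℝ) : Matrix (Fin d) (Fin d) ℝ :=
  (1 / 2 : ℝ) • (ξ + ξ.transpose)

lemma isSymm_symPart (ξ : Matrix (Fin d) (Fin d) ℝ) : (symPart ξ).IsSymm := by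
  rw [symPart, Matrix.IsSymm, Matrix.transpose_smul, Matrix.transpose_add,
    Matrix.transpose_transpose, add_comm]

lemma normSq_symPart (ξ : Matrix (Fin d) (Fin d) ℝ) : normSq (symPart ξ) = symSq ξ := by
  simp only [normSq, symSq, symPart, Matrix.smul_apply, Matrix.add_apply, Matrix.transpose_apply,
    smul_eq_mul]
  refine Finset.sum_congr rfl fun i _ => Finset.sum_congr rfl fun j _ => by ring

namespace IsElasticityTensor

variable {κ₁ κ₂ : ℝ} {A : Tensor d}

lemma form_comm (hA : IsElasticityTensor κ₁ κ₂ A) (x : Rd d) (ξ ζ : Matrix (Fin d) (Fin d) ℝ) :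
    form (A x) ξ ζ = form (A x) ζ ξ := by
  simp only [form]
  rw [Finset.sum_comm]
  refine Finset.sum_congr rfl fun j _ => Finset.sum_congr rfl fun i _ => ?_
  rw [Finset.sum_comm]
  refine Finset.sum_congr rfl fun β _ => Finset.sum_congr rfl fun α _ => ?_
  rw [hA.symm_major]
  ring

lemma form_transpose_right (hA : IsElasticityTensor κ₁ κ₂ A) (x : Rd d) (ξ ζ : Matrix (Fin d) (Fin d) ℝ) :
    form (A x) ξ ζ.transpose = form (A x) ξ ζ := by
  have hswap : ∀ f : Fin d → Fin d → Fin d → ℝ,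
      ∑ i, ∑ j, ∑ α, f i j α = ∑ i, ∑ j, ∑ α, f α j i := fun f => by
    calc ∑ i, ∑ j, ∑ α, f i j α = ∑ j, ∑ i, ∑ α, f i j α := Finset.sum_comm
      _ = ∑ j, ∑ i, ∑ α, f α j i := Finset.sum_congr rfl fun j _ => Finset.sum_comm
      _ = _ := Finset.sum_comm
  simp only [form, Matrix.transpose_apply]
  rw [hswap]
  refine Finset.sum_congr rfl fun i _ => Finset.sum_congr rfl fun j _ =>
    Finset.sum_congr rfl fun α _ => Finset.sum_congr rfl fun β _ => ?_
  rw [hA.symm_minor]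

/-- The minor symmetry allows transposing the second argument, and the major symmetry exchanges the
arguments. Ellipticity, assumed on symmetric matrices only, thus applies to every gradient through
its strain. -/
lemma form_symPart (hA : IsElasticityTensor κ₁ κ₂ A) (x : Rd d) (ξ : Matrix (Fin d) (Fin d) ℝ) :
    form (A x) (symPart ξ) (symPart ξ) = form (A x) ξ ξ := by
  have h : ∀ ξ ζ, form (A x) ξ (symPart ζ) = form (A x) ξ ζ := fun ξ ζ => by
    rw [symPart, form_smul_right, form_add_right, hA.form_transpose_right]; ring
  rw [h, hA.form_comm, h]

lemma le_form (hA : IsElasticityTensor κ₁ κ₂ A) (x : Rd d) (ξ : Matrix (Fin d) (Fin d) ℝ) :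
    κ₁ * symSq ξ ≤ form (A x) ξ ξ := by
  rw [← hA.form_symPart, ← normSq_symPart]
  exact hA.lower x _ (isSymm_symPart ξ)

lemma form_le (hA : IsElasticityTensor κ₁ κ₂ A) (x : Rd d) (ξ : Matrix (Fin d) (Fin d) ℝ) :
    form (A x) ξ ξ ≤ κ₂ * symSq ξ := by
  rw [← hA.form_symPart, ← normSq_symPart]
  exact hA.upper x _ (isSymm_symPart ξ)

/-- For the symmetric form `a`, `2 a(ξ, ξ - ζ) = a(ξ, ξ) - a(ζ, ζ) + a(ξ - ζ, ξ - ζ)`, and the last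
term is nonnegative. -/
lemma sub_le_two_mul_form (hA : IsElasticityTensor κ₁ κ₂ A) (hκ₁ : 0 ≤ κ₁) (x : Rd d) (ξ ζ : Matrix (Fin d) (Fin d) ℝ) :
    κ₁ * symSq ξ - κ₂ * symSq ζ ≤ 2 * form (A x) ξ (ξ - ζ) := by
  have h1 := (mul_nonneg hκ₁ (symSq_nonneg (ξ - ζ))).trans (hA.le_form x (ξ - ζ))
  rw [form_sub_right, hA.form_comm x (ξ - ζ) ξ, hA.form_comm x (ξ - ζ) ζ, form_sub_right,
    form_sub_right, hA.form_comm x ζ ξ] at h1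
  rw [form_sub_right]
  linarith [hA.le_form x ξ, hA.form_le x ζ]

end IsElasticityTensor

/-! ### Square integrable matrix fields -/

/-- Square integrable matrix fields. -/
abbrev SqIntegrable (μ : Measure (Rd d)) (X : MatrixField d) : Prop :=
  ∀ i α, MemLp (fun x => X x i α) 2 μ

lemma SqIntegrable.add {μ : Measure (Rd d)} {X Y : MatrixField d} (hX : SqIntegrable μ X)
    (hY : SqIntegrable μ Y) : SqIntegrable μ fun x => X x + Y x :=
  fun i α => (hX i α).add (hY i α)

lemma SqIntegrable.sub {μ : Measure (Rd d)} {X Y : MatrixField d} (hX : SqIntegrable μ X)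
    (hY : SqIntegrable μ Y) : SqIntegrable μ fun x => X x - Y x :=
  fun i α => (hX i α).sub (hY i α)

lemma SqIntegrable.const_smul {μ : Measure (Rd d)} {X : MatrixField d} (hX : SqIntegrable μ X)
    (c : ℝ) : SqIntegrable μ fun x => c • X x :=
  fun i α => (hX i α).const_mul c

lemma SqIntegrable.integrable_normSq {μ : Measure (Rd d)} {X : MatrixField d}
    (hX : SqIntegrable μ X) : Integrable (fun x => normSq (X x)) μ :=
  integrable_finsetSum _ fun i _ => integrable_finsetSum _ fun α _ => (hX i α).integrable_sq

lemma SqIntegrable.integrable_symSq {μ : Measure (Rd d)} {X : MatrixField d}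
    (hX : SqIntegrable μ X) : Integrable (fun x => symSq (X x)) μ := by
  refine integrable_finsetSum _ fun i _ => integrable_finsetSum _ fun α _ => ?_
  have h : MemLp (fun x => (X x i α + X x α i) * 2⁻¹) 2 μ :=
    ((hX i α).add (hX α i)).mul_const _
  simpa only [div_eq_mul_inv] using h.integrable_sq

lemma IsElasticityTensor.integrable_form {κ₁ κ₂ : ℝ} {A : Tensor d}
    (hA : IsElasticityTensor κ₁ κ₂ A) {μ : Measure (Rd d)} (hμ : μ ≪ volume)
    {X Y : MatrixField d} (hX : SqIntegrable μ X) (hY : SqIntegrable μ Y) :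
    Integrable (fun x => form (A x) (X x) (Y x)) μ := by
  obtain ⟨M, hM⟩ := hA.bounded
  refine integrable_finsetSum _ fun i _ => integrable_finsetSum _ fun j _ =>
    integrable_finsetSum _ fun α _ => integrable_finsetSum _ fun β _ => ?_
  have h1 : Integrable (fun x => X x j β * Y x i α) μ := (hX j β).integrable_mul (hY i α)
  simp only [mul_assoc]
  exact h1.bdd_mul (c := M) ((hA.measurable i j α β).aestronglyMeasurable.mono_ac hμ)
    (ae_of_all _ fun x => by rw [Real.norm_eq_abs]; exact hM x i j α β)

/-- The energy inequality for a field whose weighted flux is orthogonal to a perturbation of the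
field. -/
lemma IsElasticityTensor.lintegral_symSq_le {κ₁ κ₂ : ℝ} {A : Tensor d}
    (hA : IsElasticityTensor κ₁ κ₂ A) (hκ₁ : 0 ≤ κ₁) (hκ₂ : 0 ≤ κ₂) {μ : Measure (Rd d)}
    (hμ : μ ≪ volume) {m : Rd d → ℝ} (hm : Measurable m) {M : ℝ}
    (hmM : ∀ x, 0 ≤ m x ∧ m x ≤ M) {X Z : MatrixField d} (hX : SqIntegrable μ X)
    (hZ : SqIntegrable μ Z) (h : ∫ x, m x * form (A x) (X x) (X x - Z x) ∂μ = 0) :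
    ENNReal.ofReal κ₁ * ∫⁻ x, ENNReal.ofReal (m x * symSq (X x)) ∂μ ≤
      ENNReal.ofReal κ₂ * ∫⁻ x, ENNReal.ofReal (m x * symSq (Z x)) ∂μ := by
  have hmb : ∀ᵐ x ∂μ, ‖m x‖ ≤ M := ae_of_all _ fun x => by
    rw [Real.norm_of_nonneg (hmM x).1]; exact (hmM x).2
  have hms : AEStronglyMeasurable m μ := hm.aestronglyMeasurable
  have i1 := hX.integrable_symSq.bdd_mul hms hmb
  have i2 := hZ.integrable_symSq.bdd_mul hms hmb
  have i3 := (hA.integrable_form hμ hX (hX.sub hZ)).bdd_mul hms hmb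
  have h1 : κ₁ * ∫ x, m x * symSq (X x) ∂μ ≤ κ₂ * ∫ x, m x * symSq (Z x) ∂μ := by
    have h2 : ∫ x, (κ₁ * (m x * symSq (X x)) - κ₂ * (m x * symSq (Z x))) ∂μ ≤
        ∫ x, 2 * (m x * form (A x) (X x) (X x - Z x)) ∂μ := by
      refine integral_mono ((i1.const_mul _).sub (i2.const_mul _)) (i3.const_mul 2) fun x => ?_
      have := mul_le_mul_of_nonneg_left (hA.sub_le_two_mul_form hκ₁ x (X x) (Z x)) (hmM x).1
      simp only
      linarith
    rw [integral_sub (i1.const_mul _) (i2.const_mul _), integral_const_mul, integral_const_mul,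
      integral_const_mul, h] at h2
    linarith
  rw [← ofReal_integral_eq_lintegral_ofReal i1 (ae_of_all _ fun x =>
      mul_nonneg (hmM x).1 (symSq_nonneg _)),
    ← ofReal_integral_eq_lintegral_ofReal i2 (ae_of_all _ fun x =>
      mul_nonneg (hmM x).1 (symSq_nonneg _)),
    ← ENNReal.ofReal_mul hκ₁, ← ENNReal.ofReal_mul hκ₂]
  exact ENNReal.ofReal_le_ofReal h1

lemma MemH1.sqIntegrable_smul {Ω : Set (Rd d)} {u : Rd d → Rd d} {G : MatrixField d}
    (h : MemH1 Ω u G) {η : Rd d → ℝ} (hη : IsTest Ω η) :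
    SqIntegrable (volume.restrict Ω) fun x => η x • G x := by
  have hs : Smooth η := hη.1
  have hηL : MemLp η ∞ (volume.restrict Ω) := hs.continuous.memLp_of_hasCompactSupport hη.2.1
  exact fun i α => (h.grad_memLp i α).mul' hηL

lemma MemH1.sqIntegrable_gradTensor {Ω : Set (Rd d)} {u : Rd d → Rd d} {G : MatrixField d}
    (h : MemH1 Ω u G) {η : Rd d → ℝ} (hη : IsTest Ω η) :
    SqIntegrable (volume.restrict Ω) fun x => gradTensor η x (u x) := by
  have hs : Smooth η := hη.1
  intro i α
  have hdL : MemLp (fun x => fderiv ℝ η x (EuclideanSpace.single i 1)) ∞ (volume.restrict Ω) :=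
    ((hs.continuous_fderiv (by simp)).clm_apply continuous_const).memLp_of_hasCompactSupport
      (hη.2.1.fderiv_apply ℝ _)
  have huα : MemLp (fun x => u x α) 2 (volume.restrict Ω) :=
    h.memLp.continuousLinearMap_comp (EuclideanSpace.proj (𝕜 := ℝ) α)
  exact huα.mul' hdL

lemma gradTensor_mul_self {η : Rd d → ℝ} {x : Rd d} (hη : DifferentiableAt ℝ η x) (v : Rd d) :
    gradTensor (fun x => η x * η x) x v = η x • (2 : ℝ) • gradTensor η x v := by
  ext i α
  simp only [gradTensor, Matrix.of_apply, Matrix.smul_apply, smul_eq_mul]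
  rw [fderiv_fun_mul hη hη]
  simp
  ring

lemma IsTest.mul_self {Ω : Set (Rd d)} {η : Rd d → ℝ} (hη : IsTest Ω η) :
    IsTest Ω fun x => η x * η x :=
  ⟨hη.1.mul hη.1, hη.2.1.mul_right, tsupport_mul_subset_left.trans hη.2.2⟩

/-! ### Energy estimates in the matrix and in the inclusions -/

lemma contrast_of_mem {ι : Type*} {F : ι → Set (Rd d)} {t : ℝ} {x : Rd d} {l : ι}
    (hx : x ∈ F l) : contrast F t x = t :=
  if_pos (Set.mem_iUnion.2 ⟨l, hx⟩)

lemma contrast_of_mem_matrix {ι : Type*} {ω : Set (Rd d)} {F : ι → Set (Rd d)}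
    (hω : IsPeriodicMatrix ω F) {t : ℝ} {x : Rd d} (hx : x ∈ ω) : contrast F t x = 1 := by
  refine if_neg fun h => ?_
  obtain ⟨l, hl⟩ := Set.mem_iUnion.1 h
  have : x ∈ ωᶜ := by
    rw [hω.compl_eq]; exact Set.mem_iUnion.2 ⟨l, subset_closure hl⟩
  exact this hx

lemma IsWeakSolution.memH1 {ι : Type*} {ω Ω : Set (Rd d)} {F : ι → Set (Rd d)} {A : Tensor d}
    {δ : ℝ} {u : Rd d → Rd d} {G : MatrixField d} (hu : IsWeakSolution ω F A δ Ω u G)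
    (hδ : 0 ≤ δ) : MemH1 Ω u G := by
  rcases hδ.lt_or_eq with hδ | rfl
  · exact (hu.1 hδ).1
  · exact (hu.2 rfl).1

/-- The Caccioppoli inequality in the matrix. -/
lemma IsWeakSolution.lintegral_matrix_le {ι : Type*} {ω Ω : Set (Rd d)} {F : ι → Set (Rd d)}
    (hω : IsPeriodicMatrix ω F) (hΩ : IsOpen Ω) {κ₁ κ₂ : ℝ} (hκ₁ : 0 ≤ κ₁) (hκ₂ : 0 ≤ κ₂)
    {A : Tensor d} (hA : IsElasticityTensor κ₁ κ₂ A) {δ : ℝ} (hδ : 0 ≤ δ) {u : Rd d → Rd d}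
    {G : MatrixField d} (hu : IsWeakSolution ω F A δ Ω u G) {η : Rd d → ℝ} (hη : IsTest Ω η) :
    ENNReal.ofReal κ₁ * ∫⁻ x in Ω ∩ ω, ENNReal.ofReal (symSq (η x • G x)) ≤
      ENNReal.ofReal κ₂ * (ENNReal.ofReal (1 + δ ^ 2) *
        ∫⁻ x in Ω, ENNReal.ofReal (4 * normSq (gradTensor η x (u x)))) := by
  have hH := hu.memH1 hδ
  have hs : Smooth η := hη.1
  have hX := hH.sqIntegrable_smul hη
  have hZ := (hH.sqIntegrable_gradTensor hη).const_smul (-2)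
  have hv := (hH.smul_isTest hΩ.measurableSet hη.mul_self).memH10 hΩ hη.2.1 hη.2.2
    fun x hx => by rw [image_eq_zero_of_notMem_tsupport hx]; simp
  -- The gradient of the test field `η²u` is `η²G + 2η ∇η ⊗ u`. One factor `η` moves to the first
  -- argument, which leaves `ηG` minus the perturbation `-2 ∇η ⊗ u`.
  have hform : ∀ x, form (A x) (G x) ((η x * η x) • G x + gradTensor (fun x => η x * η x) x (u x)) =
      form (A x) (η x • G x) (η x • G x - (-2 : ℝ) • gradTensor η x (u x)) := fun x => by
    rw [gradTensor_mul_self (hs.differentiable (by simp) x), mul_smul, ← smul_add,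
      form_smul_right, form_smul_left, neg_smul, sub_neg_eq_add]
  have hZle : ∀ x, symSq ((-2 : ℝ) • gradTensor η x (u x)) ≤
      4 * normSq (gradTensor η x (u x)) := fun x => by
    rw [symSq_smul]
    linarith [symSq_le_normSq (gradTensor η x (u x))]
  have hac : ∀ S : Set (Rd d), volume.restrict S ≪ volume := fun S =>
    Measure.absolutelyContinuous_of_le Measure.restrict_le_self
  rcases hδ.lt_or_eq with hδ' | rfl
  · have h0 := (hu.1 hδ').2 _ _ hv
    simp only [hform] at h0
    have hcm : Measurable (contrast F (δ ^ 2)) := by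
      have : MeasurableSet (⋃ k, F k) :=
        (isOpen_iUnion fun k => (hω.inclusion k).isOpen).measurableSet
      exact Measurable.ite this measurable_const measurable_const
    have hcb : ∀ x, 0 ≤ contrast F (δ ^ 2) x ∧ contrast F (δ ^ 2) x ≤ 1 + δ ^ 2 := fun x => by
      unfold contrast
      have := sq_nonneg δ
      split_ifs <;> constructor <;> linarith
    have h1 := hA.lintegral_symSq_le hκ₁ hκ₂ (hac Ω) hcm hcb hX hZ h0
    refine le_trans (mul_le_mul' le_rfl ?_) (h1.trans (mul_le_mul' le_rfl ?_))
    -- The inclusions are discarded on the left, where their weight `δ²` may be arbitrarily small.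
    · refine le_trans ?_ (lintegral_mono_set (Set.inter_subset_left (t := ω)))
      refine setLIntegral_mono' (hΩ.inter hω.isOpen).measurableSet fun x hx => ?_
      rw [contrast_of_mem_matrix hω hx.2, one_mul]
    · rw [← lintegral_const_mul' _ _ ENNReal.ofReal_ne_top]
      refine lintegral_mono fun x => ?_
      rw [← ENNReal.ofReal_mul (by positivity)]
      exact ENNReal.ofReal_le_ofReal (mul_le_mul (hcb x).2 (hZle x) (symSq_nonneg _)
        (by positivity))
  · have h0 := (hu.2 rfl).2.1 _ _ hv
    simp only [hform] at h0
    have hr : volume.restrict (Ω ∩ ω) ≤ volume.restrict Ω :=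
      Measure.restrict_mono Set.inter_subset_left le_rfl
    have h1 := hA.lintegral_symSq_le hκ₁ hκ₂ (hac (Ω ∩ ω)) (m := fun _ => 1) (M := 1)
      measurable_const (fun _ => ⟨zero_le_one, le_rfl⟩) (fun i α => (hX i α).mono_measure hr)
      (fun i α => (hZ i α).mono_measure hr) (by simpa only [one_mul] using h0)
    simp only [one_mul] at h1
    refine h1.trans (mul_le_mul' le_rfl ?_)
    rw [zero_pow two_ne_zero, add_zero, ENNReal.ofReal_one, one_mul]
    exact (lintegral_mono_set Set.inter_subset_left).trans
      (lintegral_mono fun x => ENNReal.ofReal_le_ofReal (hZle x))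

/-- Inside each inclusion, a weak solution solves the equation of the inclusion. -/
lemma IsWeakSolution.integral_inclusion_eq_zero {ι : Type*} {ω Ω : Set (Rd d)}
    {F : ι → Set (Rd d)} (hω : IsPeriodicMatrix ω F) (hΩ : IsOpen Ω) {A : Tensor d} {δ : ℝ}
    (hδ : 0 ≤ δ) {u : Rd d → Rd d} {G : MatrixField d} (hu : IsWeakSolution ω F A δ Ω u G)
    (l : ι) {v : Rd d → Rd d} (hv : IsTest (Ω ∩ F l) v) :
    ∫ x in Ω ∩ F l, form (A x) (G x) (classicalGrad v x) = 0 := by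
  have hz : ∀ x ∉ Ω ∩ F l, classicalGrad v x = 0 := fun x hx => by
    have : fderiv ℝ v x = 0 := image_eq_zero_of_notMem_tsupport fun hx' =>
      hx (hv.2.2 (tsupport_fderiv_subset ℝ hx'))
    ext i α
    simp [classicalGrad, this]
  have hform0 : ∀ x, form (A x) (G x) 0 = 0 := fun x => by simp [form]
  rcases hδ.lt_or_eq with hδ' | rfl
  · have hv' : IsTest Ω v := ⟨hv.1, hv.2.1, hv.2.2.trans Set.inter_subset_left⟩
    have h0 := (hu.1 hδ').2 _ _ (hv'.memH10 hΩ)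
    rw [setIntegral_eq_of_subset_of_forall_sdiff_eq_zero (s := Ω ∩ F l) hΩ.measurableSet
      Set.inter_subset_left (fun x hx => by rw [hz x hx.2, hform0, mul_zero])] at h0
    have h1 : ∫ x in Ω ∩ F l, contrast F (δ ^ 2) x * form (A x) (G x) (classicalGrad v x) =
        ∫ x in Ω ∩ F l, δ ^ 2 * form (A x) (G x) (classicalGrad v x) :=
      setIntegral_congr_fun (hΩ.inter (hω.inclusion l).isOpen).measurableSet fun x hx => by
        simp only [contrast_of_mem hx.2]
    -- On `F l` the weight is the constant `δ² > 0` and divides out: no trace of the contrast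
    -- remains inside an inclusion.
    rw [h1, integral_const_mul] at h0
    exact (mul_eq_zero.1 h0).resolve_left (by positivity)
  · have hFo : IsOpen (⋃ k, F k) := isOpen_iUnion fun k => (hω.inclusion k).isOpen
    have hsub : Ω ∩ F l ⊆ Ω ∩ ⋃ k, F k :=
      Set.inter_subset_inter_right _ (Set.subset_iUnion F l)
    have hv' : IsTest (Ω ∩ ⋃ k, F k) v := ⟨hv.1, hv.2.1, hv.2.2.trans hsub⟩
    have h0 := (hu.2 rfl).2.2 _ _ (hv'.memH10 (hΩ.inter hFo))
    rwa [setIntegral_eq_of_subset_of_forall_sdiff_eq_zero (s := Ω ∩ F l)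
      (hΩ.inter hFo).measurableSet hsub (fun x hx => by rw [hz x hx.2, hform0])] at h0

lemma continuous_gradTensor {ζ : Rd d → ℝ} (hζ : Smooth ζ) {v : Rd d → Rd d} (hv : Continuous v)
    (i α : Fin d) : Continuous fun x => gradTensor ζ x (v x) i α :=
  ((hζ.continuous_fderiv (by simp)).clm_apply continuous_const).mul
    ((EuclideanSpace.proj (𝕜 := ℝ) α).continuous.comp hv)

/-- A field that agrees with another near the boundary of an open set is extended by the
truncated difference. -/
lemma isTest_indicator_smul_sub {Ω U : Set (Rd d)} (hU : IsOpen U) {ζ : Rd d → ℝ}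
    (hζ : IsTest Ω ζ) {φ w : Rd d → Rd d} (hφ : Smooth φ) (hw : Smooth w)
    (h : ∀ x ∈ frontier U, ∀ᶠ y in 𝓝 x, w y = φ y) :
    IsTest (Ω ∩ U) (U.indicator fun x => (ζ x * ζ x) • (φ x - w x)) := by
  have hs : Smooth fun x => (ζ x * ζ x) • (φ x - w x) := (hζ.1.mul hζ.1).smul (hφ.sub hw)
  have hin : ∀ x ∈ U, (U.indicator fun x => (ζ x * ζ x) • (φ x - w x)) =ᶠ[𝓝 x]
      fun x => (ζ x * ζ x) • (φ x - w x) := fun x hx => by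
    filter_upwards [hU.mem_nhds hx] with y hy using Set.indicator_of_mem hy _
  have hout : ∀ x ∉ U, (U.indicator fun x => (ζ x * ζ x) • (φ x - w x)) =ᶠ[𝓝 x]
      fun _ => 0 := fun x hx => by
    by_cases hxf : x ∈ frontier U
    · filter_upwards [h x hxf] with y hy
      simp [Set.indicator, hy]
    · have hxc : x ∉ closure U := fun hc => hxf (by rw [hU.frontier_eq]; exact ⟨hc, hx⟩)
      filter_upwards [isClosed_closure.isOpen_compl.mem_nhds hxc] with y hy
      exact Set.indicator_of_notMem (fun hyU => hy (subset_closure hyU)) _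
  have hsupp : tsupport (U.indicator fun x => (ζ x * ζ x) • (φ x - w x)) ⊆ tsupport ζ ∩ U := by
    refine fun x hx => ⟨?_, ?_⟩
    · refine closure_mono (fun y hy => ?_) hx
      intro hy0
      refine hy ?_
      simp [Set.indicator, hy0]
    · by_contra hxU
      exact (notMem_tsupport_iff_eventuallyEq.2 (hout x hxU)) hx
  refine ⟨contDiff_iff_contDiffAt.2 fun x => ?_, ?_, fun x hx =>
    ⟨hζ.2.2 (hsupp hx).1, (hsupp hx).2⟩⟩
  · by_cases hx : x ∈ U
    · exact hs.contDiffAt.congr_of_eventuallyEq (hin x hx)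
    · exact contDiffAt_const.congr_of_eventuallyEq (hout x hx)
  · exact hζ.2.1.of_isClosed_subset (isClosed_tsupport _) (hsupp.trans Set.inter_subset_left)

lemma classicalGrad_indicator {U : Set (Rd d)} (hU : IsOpen U) (v : Rd d → Rd d) {x : Rd d}
    (hx : x ∈ U) : classicalGrad (U.indicator v) x = classicalGrad v x := by
  have h : U.indicator v =ᶠ[𝓝 x] v := by
    filter_upwards [hU.mem_nhds hx] with y hy using Set.indicator_of_mem hy _
  rw [classicalGrad, h.fderiv_eq]; rfl

/-- The energy inequality in one inclusion. -/
lemma IsWeakSolution.lintegral_inclusion_le {ι : Type*} {ω Ω : Set (Rd d)} {F : ι → Set (Rd d)}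
    (hω : IsPeriodicMatrix ω F) (hΩ : IsOpen Ω) {κ₁ κ₂ : ℝ} (hκ₁ : 0 ≤ κ₁) (hκ₂ : 0 ≤ κ₂)
    {A : Tensor d} (hA : IsElasticityTensor κ₁ κ₂ A) {δ : ℝ} (hδ : 0 ≤ δ) {u : Rd d → Rd d}
    {G : MatrixField d} (hu : IsWeakSolution ω F A δ Ω u G) {ζ : Rd d → ℝ} (hζ : IsTest Ω ζ)
    (l : ι) {φ w : Rd d → Rd d} (hφ : Smooth φ) (hw : Smooth w)
    (hwφ : ∀ x ∈ frontier (F l), ∀ᶠ y in 𝓝 x, w y = φ y) :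
    ENNReal.ofReal κ₁ * ∫⁻ x in Ω ∩ F l, ENNReal.ofReal (symSq (ζ x • G x)) ≤
      ENNReal.ofReal κ₂ * ∫⁻ x in Ω ∩ F l, ENNReal.ofReal (symSq (ζ x • G x -
        (ζ x • (classicalGrad φ x - classicalGrad w x) +
          (2 : ℝ) • gradTensor ζ x (φ x - w x)))) := by
  have hFo := (hω.inclusion l).isOpen
  have hs : Smooth ζ := hζ.1
  -- Since `w = φ` near the boundary of `F l`, the truncation of `ζ²(φ - w)` to `F l` is an
  -- admissible smooth test field. The field `φ` only approximates the solution; the defect `G - ∇φ`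
  -- is left on the right-hand side.
  have hv := isTest_indicator_smul_sub hFo hζ hφ hw hwφ
  have h0 := hu.integral_inclusion_eq_zero hω hΩ hδ l hv
  have hr : volume.restrict (Ω ∩ F l) ≤ volume.restrict Ω :=
    Measure.restrict_mono Set.inter_subset_left le_rfl
  have hX : SqIntegrable (volume.restrict (Ω ∩ F l)) fun x => ζ x • G x :=
    fun i α => ((hu.memH1 hδ).sqIntegrable_smul hζ i α).mono_measure hr
  have hY : SqIntegrable (volume.restrict (Ω ∩ F l)) fun x =>
      ζ x • (classicalGrad φ x - classicalGrad w x) + (2 : ℝ) • gradTensor ζ x (φ x - w x) := by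
    refine SqIntegrable.add (fun i α => ?_) (SqIntegrable.const_smul (fun i α => ?_) 2)
    · exact (hs.continuous.mul ((continuous_classicalGrad hφ i α).sub
        (continuous_classicalGrad hw i α))).memLp_of_hasCompactSupport hζ.2.1.mul_right
    · refine (continuous_gradTensor hs (hφ.continuous.sub hw.continuous)
        i α).memLp_of_hasCompactSupport ?_
      exact (hζ.2.1.fderiv_apply ℝ (EuclideanSpace.single i 1)).mul_right
  have hg : ∀ x ∈ Ω ∩ F l, form (A x) (G x)
      (classicalGrad ((F l).indicator fun x => (ζ x * ζ x) • (φ x - w x)) x) =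
      (1 : ℝ) * form (A x) (ζ x • G x) (ζ x • G x - (ζ x • G x -
        (ζ x • (classicalGrad φ x - classicalGrad w x) +
          (2 : ℝ) • gradTensor ζ x (φ x - w x)))) := fun x hx => by
    have hζd := hs.differentiable (by simp) x
    have hφd := hφ.differentiable (by simp) x
    have hwd := hw.differentiable (by simp) x
    rw [classicalGrad_indicator hFo _ hx.2, classicalGrad_smul_fun (χ := fun x => ζ x * ζ x)
      (v := fun x => φ x - w x) (hζd.fun_mul hζd) (hφd.fun_sub hwd),
      classicalGrad_sub_fun hφd hwd, gradTensor_mul_self hζd, mul_smul, ← smul_add,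
      form_smul_right, sub_sub_cancel, form_smul_left, one_mul]
  rw [setIntegral_congr_fun (hΩ.inter hFo).measurableSet hg] at h0
  have h1 := hA.lintegral_symSq_le hκ₁ hκ₂
    (Measure.absolutelyContinuous_of_le Measure.restrict_le_self) (m := fun _ => 1) (M := 1)
    measurable_const (fun _ => ⟨zero_le_one, le_rfl⟩) hX (hX.sub hY) h0
  simpa only [one_mul] using h1

/-- The matrix splits into `ζ(g - ξ)`, which is small when `ξ` approximates `g`, the strain of the
extension, and the cutoff term. The 32 is 2 · 2 from splitting the three terms, 2² from the factor
in front of the cutoff term, and 2 from `‖p - q‖²`. -/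
lemma symSq_perturbation_le {ζ : Rd d → ℝ} {x : Rd d} (h01 : 0 ≤ ζ x ∧ ζ x ≤ 1) {b : NNReal}
    (hb : ‖fderiv ℝ ζ x‖ ^ 2 ≤ b) (g ξ ξ' : Matrix (Fin d) (Fin d) ℝ) (p q : Rd d) :
    ENNReal.ofReal (symSq (ζ x • g - (ζ x • (ξ - ξ') + (2 : ℝ) • gradTensor ζ x (p - q)))) ≤
      2 * ENNReal.ofReal (normSq (ξ - g)) + 4 * ENNReal.ofReal (symSq ξ') +
        32 * d * b * (ENNReal.ofReal (‖p‖ ^ 2) + ENNReal.ofReal (‖q‖ ^ 2)) := by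
  have e0 : ζ x • g - (ζ x • (ξ - ξ') + (2 : ℝ) • gradTensor ζ x (p - q)) =
      (-ζ x) • (ξ - g) + (ζ x • ξ' + (-2 : ℝ) • gradTensor ζ x (p - q)) := by
    module
  have hζ2 : ζ x ^ 2 ≤ 1 := pow_le_one₀ h01.1 h01.2
  have h1 := symSq_add_le ((-ζ x) • (ξ - g)) (ζ x • ξ' + (-2 : ℝ) • gradTensor ζ x (p - q))
  have h2 := symSq_add_le (ζ x • ξ') ((-2 : ℝ) • gradTensor ζ x (p - q))
  rw [← e0, symSq_smul] at h1
  rw [symSq_smul, symSq_smul] at h2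
  have h3 := symSq_le_normSq (ξ - g)
  have h4 := (symSq_le_normSq (gradTensor ζ x (p - q))).trans (normSq_gradTensor_le ζ x (p - q))
  have h5 : ‖p - q‖ ^ 2 ≤ 2 * ‖p‖ ^ 2 + 2 * ‖q‖ ^ 2 := by
    have := norm_add_sq_le_two p (-q)
    rwa [norm_neg, ← sub_eq_add_neg] at this
  have h6 : d * ‖fderiv ℝ ζ x‖ ^ 2 * ‖p - q‖ ^ 2 ≤ d * b * (2 * ‖p‖ ^ 2 + 2 * ‖q‖ ^ 2) := by
    gcongr
  have h7 : ζ x ^ 2 * symSq (ξ - g) ≤ symSq (ξ - g) :=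
    mul_le_of_le_one_left (symSq_nonneg _) hζ2
  have h8 : ζ x ^ 2 * symSq ξ' ≤ symSq ξ' := mul_le_of_le_one_left (symSq_nonneg _) hζ2
  have h9 : symSq (ζ x • g - (ζ x • (ξ - ξ') + (2 : ℝ) • gradTensor ζ x (p - q))) ≤
      2 * normSq (ξ - g) + 4 * symSq ξ' + 32 * d * b * (‖p‖ ^ 2 + ‖q‖ ^ 2) := by
    rw [neg_sq] at h1
    linarith
  have hcalc : ∀ a b' c e : ℝ, 0 ≤ a → 0 ≤ b' → 0 ≤ c → 0 ≤ e →
      ENNReal.ofReal (2 * a + 4 * b' + 32 * d * b * (c + e)) =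
      2 * ENNReal.ofReal a + 4 * ENNReal.ofReal b' +
        32 * d * b * (ENNReal.ofReal c + ENNReal.ofReal e) := fun a b' c e ha hb' hc he => by
    rw [ENNReal.ofReal_add (by positivity) (by positivity),
      ENNReal.ofReal_add (by positivity) (by positivity), ENNReal.ofReal_mul (by positivity),
      ENNReal.ofReal_mul (by positivity), ENNReal.ofReal_mul (by positivity),
      ENNReal.ofReal_mul (by positivity), ENNReal.ofReal_mul (by positivity),
      ENNReal.ofReal_add hc he]
    simp
  rw [← hcalc _ _ _ _ (normSq_nonneg _) (symSq_nonneg _) (sq_nonneg _) (sq_nonneg _)]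
  exact ENNReal.ofReal_le_ofReal h9

/-- The energy inequality summed over all inclusions, for a smooth comparison field. -/
lemma IsWeakSolution.lintegral_inclusions_le_of_smooth {ι : Type*} {ω Ω : Set (Rd d)}
    {F : ι → Set (Rd d)} (hω : IsPeriodicMatrix ω F) {C : NNReal} {N : ℕ} {E : ι → Set (Rd d)}
    (hN : ∀ g : Rd d → ℝ≥0∞, ∑' l, ∫⁻ x in E l, g x ≤ N * ∫⁻ x in ω, g x)
    (hE : ∀ l, ∀ u : Rd d → Rd d, Smooth u → ∀ ε : ℝ≥0∞, ε ≠ 0 → ∃ w : Rd d → Rd d, Smooth w ∧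
        (∀ x ∈ frontier (F l), ∀ᶠ y in 𝓝 x, w y = u y) ∧
        ∫⁻ x in F l, ENNReal.ofReal (strain w x) ≤
          C * (∫⁻ x in E l, ENNReal.ofReal (strain u x)) + ε ∧
        ∫⁻ x in F l, ENNReal.ofReal (‖w x‖ ^ 2) ≤
          C * (∫⁻ x in E l, ENNReal.ofReal (dens u x)) + ε)
    (hΩ : IsOpen Ω) {κ₁ κ₂ : ℝ} (hκ₁ : 0 ≤ κ₁) (hκ₂ : 0 ≤ κ₂)
    {A : Tensor d} (hA : IsElasticityTensor κ₁ κ₂ A) {δ : ℝ} (hδ : 0 ≤ δ) {u : Rd d → Rd d}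
    {G : MatrixField d} (hu : IsWeakSolution ω F A δ Ω u G) {ζ : Rd d → ℝ} (hζ : IsTest Ω ζ)
    (h01 : ∀ x, 0 ≤ ζ x ∧ ζ x ≤ 1) {b : NNReal} (hb : ∀ x, ‖fderiv ℝ ζ x‖ ^ 2 ≤ b)
    {g : MatrixField d} (hg : ∀ x, ζ x • g x = ζ x • G x) {φ : Rd d → Rd d} (hφ : Smooth φ)
    {ε : ℝ≥0∞} (hε : ε ≠ 0) :
    ENNReal.ofReal κ₁ * ∫⁻ x in Ω ∩ ⋃ l, F l, ENNReal.ofReal (symSq (ζ x • G x)) ≤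
      ENNReal.ofReal κ₂ * (2 * (∫⁻ x, ENNReal.ofReal (normSq (classicalGrad φ x - g x))) +
        4 * (C * (N * ∫⁻ x in ω, ENNReal.ofReal (strain φ x)) + ε) +
        32 * d * b * ((∫⁻ x, ENNReal.ofReal (‖φ x‖ ^ 2)) +
          (C * (N * ∫⁻ x in ω, ENNReal.ofReal (dens φ x)) + ε))) := by
  have := hω.countable
  -- The extension errors of the countably many inclusions are chosen with sum below `ε`.
  obtain ⟨e, he0, hesum⟩ := ENNReal.exists_pos_sum_of_countable' hε ι
  choose w hw hwe hw1 hw2 using fun l => hE l φ hφ (e l) (he0 l).ne'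
  have hFm : ∀ l, MeasurableSet (F l) := fun l => (hω.inclusion l).isOpen.measurableSet
  have hFd : Pairwise (Function.onFun Disjoint F) := fun l l' hll => Set.disjoint_left.2
    fun x hx hx' => hll (hω.eq_of_mem_closure (subset_closure hx) (subset_closure hx'))
  have hsum : ∀ f : Rd d → ℝ≥0∞, ∑' l, ∫⁻ x in F l, f x ≤ ∫⁻ x, f x := fun f => by
    rw [← lintegral_iUnion hFm hFd]
    exact setLIntegral_le_lintegral _ _
  have hl : ∀ l, ENNReal.ofReal κ₁ * ∫⁻ x in Ω ∩ F l, ENNReal.ofReal (symSq (ζ x • G x)) ≤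
      ENNReal.ofReal κ₂ * (2 * (∫⁻ x in F l, ENNReal.ofReal (normSq (classicalGrad φ x - g x))) +
        4 * (C * (∫⁻ x in E l, ENNReal.ofReal (strain φ x)) + e l) +
        32 * d * b * ((∫⁻ x in F l, ENNReal.ofReal (‖φ x‖ ^ 2)) +
          (C * (∫⁻ x in E l, ENNReal.ofReal (dens φ x)) + e l))) := by
    intro l
    refine (hu.lintegral_inclusion_le hω hΩ hκ₁ hκ₂ hA hδ hζ l hφ (hw l) (hwe l)).trans
      (mul_le_mul' le_rfl ?_)
    have m1 : Measurable fun x => 4 * ENNReal.ofReal (strain (w l) x) :=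
      (measurable_ofReal_strain (hw l)).const_mul 4
    have m2 : Measurable fun x => ENNReal.ofReal (‖φ x‖ ^ 2) :=
      (hφ.continuous.norm.pow 2).measurable.ennreal_ofReal
    have m3 : Measurable fun x => ENNReal.ofReal (‖w l x‖ ^ 2) :=
      ((hw l).continuous.norm.pow 2).measurable.ennreal_ofReal
    have m4 : Measurable fun x => 32 * d * b *
        (ENNReal.ofReal (‖φ x‖ ^ 2) + ENNReal.ofReal (‖w l x‖ ^ 2)) := (m2.add m3).const_mul _
    calc _ ≤ ∫⁻ x in F l, (2 * ENNReal.ofReal (normSq (classicalGrad φ x - g x)) +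
            4 * ENNReal.ofReal (strain (w l) x) +
            32 * d * b * (ENNReal.ofReal (‖φ x‖ ^ 2) + ENNReal.ofReal (‖w l x‖ ^ 2))) := by
          refine (lintegral_mono fun x => ?_).trans (lintegral_mono_set Set.inter_subset_right)
          rw [← hg]
          exact symSq_perturbation_le (h01 x) (hb x) _ _ _ _ _
      _ = 2 * (∫⁻ x in F l, ENNReal.ofReal (normSq (classicalGrad φ x - g x))) +
            4 * (∫⁻ x in F l, ENNReal.ofReal (strain (w l) x)) +
            32 * d * b * ((∫⁻ x in F l, ENNReal.ofReal (‖φ x‖ ^ 2)) +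
              ∫⁻ x in F l, ENNReal.ofReal (‖w l x‖ ^ 2)) := by
          rw [lintegral_add_right _ m4, lintegral_add_right _ m1,
            lintegral_const_mul' _ _ (by simp), lintegral_const_mul' _ _ (by simp),
            lintegral_const_mul' _ _ (by finiteness), lintegral_add_right _ m3]
      _ ≤ _ := by
          refine add_le_add (add_le_add le_rfl (mul_le_mul' le_rfl (hw1 l)))
            (mul_le_mul' le_rfl (add_le_add le_rfl (hw2 l)))
  calc ENNReal.ofReal κ₁ * ∫⁻ x in Ω ∩ ⋃ l, F l, ENNReal.ofReal (symSq (ζ x • G x))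
      ≤ ∑' l, ENNReal.ofReal κ₁ * ∫⁻ x in Ω ∩ F l, ENNReal.ofReal (symSq (ζ x • G x)) := by
        rw [ENNReal.tsum_mul_left, Set.inter_iUnion]
        exact mul_le_mul' le_rfl (lintegral_iUnion_le _ _)
    _ ≤ _ := ENNReal.tsum_le_tsum hl
    _ = ENNReal.ofReal κ₂ *
        (2 * (∑' l, ∫⁻ x in F l, ENNReal.ofReal (normSq (classicalGrad φ x - g x))) +
        4 * (C * (∑' l, ∫⁻ x in E l, ENNReal.ofReal (strain φ x)) + ∑' l, e l) +
        32 * d * b * ((∑' l, ∫⁻ x in F l, ENNReal.ofReal (‖φ x‖ ^ 2)) +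
          (C * (∑' l, ∫⁻ x in E l, ENNReal.ofReal (dens φ x)) + ∑' l, e l))) := by
        simp only [ENNReal.tsum_mul_left, ENNReal.tsum_add]
    _ ≤ _ := by
        gcongr
        · exact hsum _
        · exact hN _
        · exact hsum _
        · exact hN _

/-! ### Korn's inequality for compactly supported fields -/

/-- Integrating by parts on both sides puts two derivatives on `q`, and second derivatives commute.
-/
lemma integral_fderiv_mul_fderiv_comm {p q : Rd d → ℝ} (hp : Smooth p) (hq : Smooth q)
    (hpc : HasCompactSupport p) (hqc : HasCompactSupport q) (a b : Rd d) :
    ∫ x, fderiv ℝ q x b * fderiv ℝ p x a = ∫ x, fderiv ℝ q x a * fderiv ℝ p x b := by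
  have hdp : ∀ v, Continuous fun x => fderiv ℝ p x v := fun v =>
    (hp.continuous_fderiv (by simp)).clm_apply continuous_const
  have hq' : Smooth (fderiv ℝ q) := hq.fderiv_right (by simp)
  have hdq : ∀ v, Smooth fun x => fderiv ℝ q x v := fun v => hq'.clm_apply contDiff_const
  have hdqc : ∀ v, HasCompactSupport fun x => fderiv ℝ q x v := fun v => hqc.fderiv_apply ℝ v
  have hparts : ∀ v w, ∫ x, fderiv ℝ q x v * fderiv ℝ p x w =
      -∫ x, fderiv ℝ (fderiv ℝ q) x w v * p x := fun v w => by
    have e : ∀ x, fderiv ℝ (fun x => fderiv ℝ q x v) x w = fderiv ℝ (fderiv ℝ q) x w v :=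
      fun x => by
        rw [fderiv_clm_apply (hq'.differentiable (by simp) x) (differentiableAt_const v)]
        simp
    rw [integral_mul_fderiv_eq_neg_fderiv_mul_of_integrable]
    · simp only [e]
    · refine Continuous.integrable_of_hasCompactSupport ?_ hpc.mul_left
      exact (((hdq v).continuous_fderiv (by simp)).clm_apply continuous_const).mul hp.continuous
    · exact ((hdq v).continuous.mul (hdp w)).integrable_of_hasCompactSupport
        (hdqc v).mul_right
    · exact ((hdq v).continuous.mul hp.continuous).integrable_of_hasCompactSupport hpc.mul_left
    · exact fun x _ => (hdq v).differentiable (by simp) x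
    · exact fun x _ => hp.differentiable (by simp) x
  rw [hparts, hparts]
  congr 2
  funext x
  have hsymm : IsSymmSndFDerivAt ℝ q x := (hq.contDiffAt).isSymmSndFDerivAt (by
    rw [minSmoothness_of_isRCLikeNormedField]
    exact WithTop.coe_le_coe.2 (le_top : (2 : ℕ∞) ≤ ⊤))
  rw [hsymm.eq]

lemma normSq_add_sum_mul (ξ : Matrix (Fin d) (Fin d) ℝ) :
    normSq ξ + ∑ i, ∑ α, ξ i α * ξ α i = 2 * symSq ξ := by
  have h : ∑ i, ∑ α, ξ α i ^ 2 = ∑ i, ∑ α, ξ i α ^ 2 := Finset.sum_comm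
  have h2 : 2 * symSq ξ = ∑ i, ∑ α, (ξ i α ^ 2 / 2 + ξ α i ^ 2 / 2 + ξ i α * ξ α i) := by
    simp only [symSq, Finset.mul_sum]
    exact Finset.sum_congr rfl fun i _ => Finset.sum_congr rfl fun α _ => by ring
  rw [h2]
  simp only [Finset.sum_add_distrib, ← Finset.sum_div, h, normSq]
  ring

/-- When `D` is a gradient, exchanging derivatives turns the product with its transpose into the
square of the divergence. This sign is what yields Korn's inequality. -/
lemma integral_sum_mul_nonneg {D : Fin d → Fin d → Rd d → ℝ}
    (hD : ∀ i α, MemLp (D i α) 2 volume)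
    (hswap : ∀ i α, ∫ x, D i α x * D α i x = ∫ x, D i i x * D α α x) :
    0 ≤ ∫ x, ∑ i, ∑ α, D i α x * D α i x := by
  have hint : ∀ i α j β, Integrable fun x => D i α x * D j β x :=
    fun i α j β => (hD i α).integrable_mul (hD j β)
  have e : ∫ x, ∑ i, ∑ α, D i α x * D α i x = ∫ x, (∑ i, D i i x) ^ 2 := by
    rw [integral_finsetSum _ fun i _ => integrable_finsetSum _ fun α _ => hint i α α i]
    simp_rw [sq, Finset.sum_mul_sum]
    rw [integral_finsetSum _ fun i _ => integrable_finsetSum _ fun α _ => hint i i α α]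
    refine Finset.sum_congr rfl fun i _ => ?_
    rw [integral_finsetSum _ fun α _ => hint i α α i, integral_finsetSum _ fun α _ => hint i i α α]
    exact Finset.sum_congr rfl fun α _ => hswap i α
  rw [e]
  exact integral_nonneg fun x => sq_nonneg _

/-- Korn's inequality for test fields. -/
lemma lintegral_normSq_classicalGrad_le {φ : Rd d → Rd d} (hφ : Smooth φ)
    (hc : HasCompactSupport φ) :
    ∫⁻ x, ENNReal.ofReal (normSq (classicalGrad φ x)) ≤
      2 * ∫⁻ x, ENNReal.ofReal (strain φ x) := by
  have hG : SqIntegrable volume (classicalGrad φ) := fun i α =>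
    (continuous_classicalGrad hφ i α).memLp_of_hasCompactSupport
      (hasCompactSupport_classicalGrad hc i α)
  have hcomp : ∀ α, Smooth fun x => φ x α := fun α => contDiff_euclidean.1 hφ α
  have hcompc : ∀ α, HasCompactSupport fun x => φ x α := fun α =>
    hc.comp_left (g := fun v : Rd d => v α) rfl
  have hfd : ∀ x i α, fderiv ℝ (fun y => φ y α) x (EuclideanSpace.single i 1) =
      classicalGrad φ x i α := fun x i α => by
    rw [fderiv_apply (hφ.differentiable (by simp) x)]; rfl
  have hint : ∀ i α j β, Integrable fun x => classicalGrad φ x i α * classicalGrad φ x j β :=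
    fun i α j β => (hG i α).integrable_mul (hG j β)
  have hswap : ∀ i α, ∫ x, classicalGrad φ x i α * classicalGrad φ x α i =
      ∫ x, classicalGrad φ x i i * classicalGrad φ x α α := fun i α => by
    have := integral_fderiv_mul_fderiv_comm (hcomp i) (hcomp α) (hcompc i) (hcompc α)
      (EuclideanSpace.single α 1) (EuclideanSpace.single i 1)
    simp only [hfd] at this
    rw [this]
    congr 1
    funext x
    ring
  have h0 : 0 ≤ ∫ x, ∑ i, ∑ α, classicalGrad φ x i α * classicalGrad φ x α i :=
    integral_sum_mul_nonneg (D := fun i α x => classicalGrad φ x i α) hG hswap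
  have h1 : ∫ x, normSq (classicalGrad φ x) ≤ 2 * ∫ x, strain φ x := by
    have i2 : Integrable fun x => ∑ i, ∑ α, classicalGrad φ x i α * classicalGrad φ x α i :=
      integrable_finsetSum _ fun i _ => integrable_finsetSum _ fun α _ => hint i α α i
    have e : ∫ x, (normSq (classicalGrad φ x) +
        ∑ i, ∑ α, classicalGrad φ x i α * classicalGrad φ x α i) = ∫ x, 2 * strain φ x := by
      simp only [normSq_add_sum_mul, strain]
    rw [integral_add hG.integrable_normSq i2, integral_const_mul] at e
    linarith
  rw [← ofReal_integral_eq_lintegral_ofReal hG.integrable_normSq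
      (ae_of_all _ fun x => normSq_nonneg _),
    ← ofReal_integral_eq_lintegral_ofReal (f := strain φ) hG.integrable_symSq
      (ae_of_all _ fun x => strain_nonneg _ _)]
  refine (ENNReal.ofReal_le_ofReal h1).trans_eq ?_
  rw [ENNReal.ofReal_mul zero_le_two, ENNReal.ofReal_ofNat]

/-! ### Passage to the limit -/

lemma le_of_forall_le_add_mul {a b K : ℝ≥0∞} (hK : K ≠ ∞)
    (h : ∀ ε : ℝ≥0∞, ε ≠ 0 → a ≤ b + K * ε) : a ≤ b := by
  refine ENNReal.le_of_forall_pos_le_add fun ε hε _ => ?_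
  have hε' : (ε : ℝ≥0∞) ≠ 0 := ENNReal.coe_ne_zero.2 hε.ne'
  refine (h (ε / (K + 1)) (ENNReal.div_ne_zero.2 ⟨hε', by finiteness⟩)).trans
    (add_le_add le_rfl ?_)
  exact (mul_le_mul' le_self_add le_rfl).trans ENNReal.mul_div_le

lemma SqIntegrable.lintegral_normSq {μ : Measure (Rd d)} {X : MatrixField d}
    (hX : SqIntegrable μ X) : ∫⁻ x, ENNReal.ofReal (normSq (X x)) ∂μ =
      ∑ i, ∑ α, eLpNorm (fun x => X x i α) 2 μ ^ 2 := by
  have hm : ∀ i α, AEMeasurable (fun x => ENNReal.ofReal (X x i α ^ 2)) μ := fun i α =>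
    ((hX i α).1.aemeasurable.pow_const 2).ennreal_ofReal
  have e : ∀ x, ENNReal.ofReal (normSq (X x)) = ∑ i, ∑ α, ENNReal.ofReal (X x i α ^ 2) :=
    fun x => by
      refine (ENNReal.ofReal_sum_of_nonneg fun i _ =>
        Finset.sum_nonneg fun α _ => sq_nonneg (X x i α)).trans ?_
      exact Finset.sum_congr rfl fun i _ => ENNReal.ofReal_sum_of_nonneg fun α _ => sq_nonneg _
  simp only [e]
  rw [lintegral_finsetSum' _ fun i _ => Finset.aemeasurable_fun_sum _ fun α _ => hm i α]
  refine Finset.sum_congr rfl fun i _ => ?_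
  rw [lintegral_finsetSum' _ fun α _ => hm i α]
  refine Finset.sum_congr rfl fun α _ => ?_
  rw [eLpNorm_two_sq]
  simp

/-- Approximation by test fields, measured by squared integrals. -/
lemma MemH1.exists_isTest_lintegral_le {Ω K : Set (Rd d)} (hΩ : IsOpen Ω) (hK : IsCompact K)
    (hKΩ : K ⊆ Ω) {f : Rd d → Rd d} {g : MatrixField d} (h : MemH1 Set.univ f g)
    (hfK : ∀ x ∉ K, f x = 0) {ε : ℝ≥0∞} (hε : ε ≠ 0) :
    ∃ φ : Rd d → Rd d, IsTest Ω φ ∧ ∫⁻ x, ENNReal.ofReal (‖φ x - f x‖ ^ 2) ≤ ε ∧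
      ∫⁻ x, ENNReal.ofReal (normSq (classicalGrad φ x - g x)) ≤ ε := by
  obtain ⟨e, he⟩ : ∃ e : ℝ≥0∞, e = min 1 (ε / (d * d + 1)) := ⟨_, rfl⟩
  have he0 : e ≠ 0 := by
    rw [he]
    exact (lt_min one_pos (pos_iff_ne_zero.2 (ENNReal.div_ne_zero.2 ⟨hε, by finiteness⟩))).ne'
  have hsq : ∀ a : ℝ≥0∞, a ≤ e → a ^ 2 ≤ ε / (d * d + 1) := fun a ha => by
    rw [sq]
    calc a * a ≤ 1 * (ε / (d * d + 1)) :=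
          mul_le_mul' (ha.trans (he ▸ min_le_left _ _)) (ha.trans (he ▸ min_le_right _ _))
      _ = _ := one_mul _
  obtain ⟨φ, hφ, h1, h2⟩ := h.exists_isTest_approx hΩ hK hKΩ hfK he0
  have hg := h.grad_memLp
  simp only [Measure.restrict_univ] at hg
  have hs : Smooth φ := hφ.1
  refine ⟨φ, hφ, ?_, ?_⟩
  · rw [← eLpNorm_two_sq]
    exact (hsq _ h1).trans (ENNReal.div_le_of_le_mul (le_mul_of_one_le_right (zero_le)
      le_add_self))
  · have hX : SqIntegrable volume fun x => classicalGrad φ x - g x :=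
      SqIntegrable.sub (fun i α => (continuous_classicalGrad hs i α).memLp_of_hasCompactSupport
        (hasCompactSupport_classicalGrad hφ.2.1 i α)) hg
    rw [hX.lintegral_normSq]
    calc _ ≤ ∑ _i : Fin d, ∑ _α : Fin d, ε / (d * d + 1) :=
          Finset.sum_le_sum fun i _ => Finset.sum_le_sum fun α _ => hsq _ (h2 i α)
      _ = d * d * (ε / (d * d + 1)) := by simp [mul_assoc]
      _ ≤ ε := (mul_le_mul' le_self_add le_rfl).trans ENNReal.mul_div_le

lemma lintegral_symSq_le_two_mul {μ : Measure (Rd d)} {X Y : MatrixField d}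
    (hX : SqIntegrable μ X) :
    ∫⁻ x, ENNReal.ofReal (symSq (Y x)) ∂μ ≤ 2 * (∫⁻ x, ENNReal.ofReal (symSq (X x)) ∂μ) +
      2 * ∫⁻ x, ENNReal.ofReal (normSq (Y x - X x)) ∂μ := by
  have m1 : AEMeasurable (fun x => 2 * ENNReal.ofReal (symSq (X x))) μ :=
    hX.integrable_symSq.1.aemeasurable.ennreal_ofReal.const_mul 2
  rw [← lintegral_const_mul' _ _ (by simp), ← lintegral_const_mul' _ _ (by simp),
    ← lintegral_add_left' m1]
  refine lintegral_mono fun x => ?_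
  have h2 : ∀ c : ℝ, 2 * ENNReal.ofReal c = ENNReal.ofReal (2 * c) := fun c => by
    rw [ENNReal.ofReal_mul zero_le_two, ENNReal.ofReal_ofNat]
  rw [h2, h2, ← ENNReal.ofReal_add (mul_nonneg zero_le_two (symSq_nonneg _))
    (mul_nonneg zero_le_two (normSq_nonneg _))]
  refine ENNReal.ofReal_le_ofReal ?_
  have h3 := symSq_add_le (X x) (Y x - X x)
  rw [add_sub_cancel] at h3
  linarith [symSq_le_normSq (Y x - X x)]

/-- Korn's inequality for compactly supported Sobolev fields. -/
lemma MemH1.lintegral_normSq_le {K : Set (Rd d)} (hK : IsCompact K) {f : Rd d → Rd d}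
    {g : MatrixField d} (h : MemH1 Set.univ f g) (hfK : ∀ x ∉ K, f x = 0) :
    ∫⁻ x, ENNReal.ofReal (normSq (g x)) ≤ 8 * ∫⁻ x, ENNReal.ofReal (symSq (g x)) := by
  have hg : SqIntegrable volume g := by
    have := h.grad_memLp
    simpa only [Measure.restrict_univ] using this
  -- The 8 is the factor 2 of Korn's inequality for test fields times a factor 2 for each of the two
  -- passages between the field and its approximation; the errors add up to 4 + 4 + 2 = 10.
  refine le_of_forall_le_add_mul (K := 10) (by simp) fun ε hε => ?_
  obtain ⟨φ, hφ, -, h2⟩ := h.exists_isTest_lintegral_le isOpen_univ hK (Set.subset_univ _) hfK hε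
  have hs : Smooth φ := hφ.1
  have hG : SqIntegrable volume (classicalGrad φ) := fun i α =>
    (continuous_classicalGrad hs i α).memLp_of_hasCompactSupport
      (hasCompactSupport_classicalGrad hφ.2.1 i α)
  have h3 := lintegral_symSq_le_two_mul (Y := classicalGrad φ) hg
  have h4 := lintegral_normSq_classicalGrad_le hs hφ.2.1
  have m1 : AEMeasurable (fun x => 2 * ENNReal.ofReal (normSq (classicalGrad φ x))) volume :=
    hG.integrable_normSq.1.aemeasurable.ennreal_ofReal.const_mul 2
  have h5 : ∫⁻ x, ENNReal.ofReal (normSq (g x)) ≤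
      2 * (∫⁻ x, ENNReal.ofReal (normSq (classicalGrad φ x))) +
        2 * ∫⁻ x, ENNReal.ofReal (normSq (classicalGrad φ x - g x)) := by
    rw [← lintegral_const_mul' _ _ (by simp), ← lintegral_const_mul' _ _ (by simp),
      ← lintegral_add_left' m1]
    refine lintegral_mono fun x => ?_
    have h2 : ∀ c : ℝ, 2 * ENNReal.ofReal c = ENNReal.ofReal (2 * c) := fun c => by
      rw [ENNReal.ofReal_mul zero_le_two, ENNReal.ofReal_ofNat]
    rw [h2, h2, ← ENNReal.ofReal_add (mul_nonneg zero_le_two (normSq_nonneg _))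
      (mul_nonneg zero_le_two (normSq_nonneg _))]
    refine ENNReal.ofReal_le_ofReal ?_
    have h3 := normSq_add_le (classicalGrad φ x) ((-1 : ℝ) • (classicalGrad φ x - g x))
    rw [normSq_smul, neg_one_smul, neg_sub, add_sub_cancel] at h3
    linarith
  obtain ⟨S, hS⟩ : ∃ S, S = ∫⁻ x, ENNReal.ofReal (symSq (g x)) := ⟨_, rfl⟩
  rw [← hS] at h3 ⊢
  calc _ ≤ 2 * (2 * (2 * S + 2 * ε)) + 2 * ε := by
        refine h5.trans (add_le_add (mul_le_mul' le_rfl (h4.trans (mul_le_mul' le_rfl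
          (h3.trans (add_le_add le_rfl (mul_le_mul' le_rfl h2)))))) (mul_le_mul' le_rfl h2))
    _ = 8 * S + 10 * ε := by ring

/-! ### Assembly of the Caccioppoli inequality -/

/-- The energy inequality summed over all inclusions. -/
lemma IsWeakSolution.exists_lintegral_inclusions_le {ι : Type*} {ω : Set (Rd d)}
    {F : ι → Set (Rd d)} (hω : IsPeriodicMatrix ω F) :
    ∃ C : NNReal, ∀ Ω : Set (Rd d), IsOpen Ω → ∀ κ₁ κ₂ : ℝ, 0 ≤ κ₁ → 0 ≤ κ₂ →
    ∀ A : Tensor d, IsElasticityTensor κ₁ κ₂ A → ∀ δ : ℝ, 0 ≤ δ →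
    ∀ (u : Rd d → Rd d) (G : MatrixField d), IsWeakSolution ω F A δ Ω u G →
    ∀ ζ : Rd d → ℝ, IsTest Ω ζ → (∀ x, 0 ≤ ζ x ∧ ζ x ≤ 1) →
    ∀ b : NNReal, b ≤ 9 → (∀ x, ‖fderiv ℝ ζ x‖ ^ 2 ≤ b) →
    ∀ (f : Rd d → Rd d) (g : MatrixField d) (K : Set (Rd d)), MemH1 Set.univ f g →
    IsCompact K → K ⊆ Ω → (∀ x ∉ K, f x = 0) → (∀ x, ζ x • g x = ζ x • G x) →
    ENNReal.ofReal κ₁ * ∫⁻ x in Ω ∩ ⋃ l, F l, ENNReal.ofReal (symSq (ζ x • G x)) ≤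
      ENNReal.ofReal κ₂ * (C * ((∫⁻ x in ω, ENNReal.ofReal (symSq (g x))) +
        b * ∫⁻ x, ENNReal.ofReal (‖f x‖ ^ 2))) := by
  obtain ⟨C, N, E, -, hN, hE⟩ := exists_uniform_extension hω
  -- The first two summands are the coefficient of the strain, where the extra `b` is replaced by
  -- its bound 9. The third multiplies `b * T`, in which `b` is kept because it carries the decay in
  -- `R`.
  refine ⟨8 * C * N + 32 * d * 9 * (C * N * 2) + 32 * d * (2 + 2 * C * N), ?_⟩
  intro Ω hΩ κ₁ κ₂ hκ₁ hκ₂ A hA δ hδ u G hu ζ hζ h01 b hb9 hb f g K h hK hKΩ hfK hgG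
  have hg : SqIntegrable volume g := by
    have := h.grad_memLp
    simpa only [Measure.restrict_univ] using this
  have hfm : AEMeasurable f volume := by
    have := h.memLp.1.aemeasurable
    simpa only [Measure.restrict_univ] using this
  obtain ⟨S, hS⟩ : ∃ S, S = ∫⁻ x in ω, ENNReal.ofReal (symSq (g x)) := ⟨_, rfl⟩
  obtain ⟨T, hT⟩ : ∃ T, T = ∫⁻ x, ENNReal.ofReal (‖f x‖ ^ 2) := ⟨_, rfl⟩
  rw [← hS, ← hT]
  refine le_of_forall_le_add_mul
    (K := ENNReal.ofReal κ₂ * (6 + 8 * C * N + 32 * d * b * (3 + 4 * C * N))) (by finiteness)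
    fun ε hε => ?_
  obtain ⟨φ, hφ, h1, h2⟩ := h.exists_isTest_lintegral_le hΩ hK hKΩ hfK hε
  have hs : Smooth φ := hφ.1
  have hstrain : ∫⁻ x in ω, ENNReal.ofReal (strain φ x) ≤ 2 * S + 2 * ε := by
    have h3 := lintegral_symSq_le_two_mul (μ := volume.restrict ω) (Y := classicalGrad φ)
      (fun i α => (hg i α).mono_measure Measure.restrict_le_self)
    rw [← hS] at h3
    exact h3.trans (add_le_add le_rfl (mul_le_mul' le_rfl
      ((setLIntegral_le_lintegral _ _).trans h2)))
  have hnorm : ∫⁻ x, ENNReal.ofReal (‖φ x‖ ^ 2) ≤ 2 * T + 2 * ε := by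
    have h3 := lintegral_ofReal_norm_sq_add_le (μ := volume) (v := f) (w := fun x => φ x - f x) hfm
      (hs.continuous.measurable.aemeasurable.sub hfm)
    simp only [add_sub_cancel] at h3
    rw [← hT] at h3
    exact h3.trans (add_le_add le_rfl (mul_le_mul' le_rfl h1))
  have hdens : ∫⁻ x in ω, ENNReal.ofReal (dens φ x) ≤ 2 * S + 2 * T + 4 * ε := by
    calc ∫⁻ x in ω, ENNReal.ofReal (dens φ x)
        = ∫⁻ x in ω, (ENNReal.ofReal (strain φ x) + ENNReal.ofReal (‖φ x‖ ^ 2)) := by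
          refine lintegral_congr fun x => ?_
          rw [dens, ENNReal.ofReal_add (strain_nonneg _ _) (sq_nonneg _)]
      _ = (∫⁻ x in ω, ENNReal.ofReal (strain φ x)) + ∫⁻ x in ω, ENNReal.ofReal (‖φ x‖ ^ 2) :=
          lintegral_add_left (measurable_ofReal_strain hs) _
      _ ≤ (2 * S + 2 * ε) + (2 * T + 2 * ε) :=
          add_le_add hstrain ((setLIntegral_le_lintegral _ _).trans hnorm)
      _ = _ := by ring
  have hb9' : (b : ℝ≥0∞) ≤ 9 := by exact_mod_cast hb9
  refine (hu.lintegral_inclusions_le_of_smooth hω hN hE hΩ hκ₁ hκ₂ hA hδ hζ h01 hb hgG hs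
    hε).trans ?_
  calc _ ≤ ENNReal.ofReal κ₂ * (2 * ε + 4 * (C * (N * (2 * S + 2 * ε)) + ε) +
          32 * d * b * ((2 * T + 2 * ε) + (C * (N * (2 * S + 2 * T + 4 * ε)) + ε))) := by
        gcongr
    _ = ENNReal.ofReal κ₂ * ((8 * C * N + 32 * d * b * (C * N * 2)) * S +
          (32 * d * (2 + 2 * C * N)) * (b * T)) +
          ENNReal.ofReal κ₂ * (6 + 8 * C * N + 32 * d * b * (3 + 4 * C * N)) * ε := by ring
    _ ≤ _ := by
        refine add_le_add (mul_le_mul' le_rfl ?_) le_rfl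
        push_cast
        rw [mul_add _ S]
        refine add_le_add (mul_le_mul' ?_ le_rfl) (mul_le_mul' ?_ le_rfl)
        · refine le_trans ?_ le_self_add
          gcongr
        · exact le_add_self

lemma setLIntegral_le_inter {S T : Set (Rd d)} (hT : MeasurableSet T) {f : Rd d → ℝ≥0∞}
    (h : ∀ x ∉ T, f x = 0) : ∫⁻ x in S, f x ≤ ∫⁻ x in T ∩ S, f x := by
  rw [← setLIntegral_indicator hT, Set.indicator_eq_self.2]
  exact fun x hx => by_contra fun hn => hx (h x hn)

lemma lintegral_le_setLIntegral {T : Set (Rd d)} (hT : MeasurableSet T) {f : Rd d → ℝ≥0∞}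
    (h : ∀ x ∉ T, f x = 0) : ∫⁻ x, f x ≤ ∫⁻ x in T, f x := by
  have := setLIntegral_le_inter (S := Set.univ) hT h
  rwa [Measure.restrict_univ, Set.inter_univ] at this

/-- The Caccioppoli inequality for a pair of nested cutoff functions. -/
lemma IsWeakSolution.exists_lintegral_normSq_le {ι : Type*} {ω : Set (Rd d)}
    {F : ι → Set (Rd d)} (hω : IsPeriodicMatrix ω F) {κ₁ κ₂ : ℝ} (hκ₁ : 0 < κ₁) (hκ₂ : 0 < κ₂) :
    ∃ C : NNReal, ∀ Ω : Set (Rd d), IsOpen Ω → ∀ A : Tensor d, IsElasticityTensor κ₁ κ₂ A →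
    ∀ δ : ℝ, 0 ≤ δ →
    ∀ (u : Rd d → Rd d) (G : MatrixField d), IsWeakSolution ω F A δ Ω u G →
    ∀ ζ η : Rd d → ℝ, IsTest Ω ζ → IsTest Ω η → (∀ x, 0 ≤ ζ x ∧ ζ x ≤ 1) →
    (∀ x, 0 ≤ η x ∧ η x ≤ 1) → (∀ x, ζ x ≠ 0 → η x = 1) →
    ∀ b : NNReal, b ≤ 9 → (∀ x, ‖fderiv ℝ ζ x‖ ^ 2 ≤ b) → (∀ x, ‖fderiv ℝ η x‖ ^ 2 ≤ b) →
    ∀ D : Set (Rd d), MeasurableSet D → (∀ x ∈ D, ζ x = 1) →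
    ∫⁻ x in D, ENNReal.ofReal (normSq (G x)) ≤
      C * (b * (ENNReal.ofReal (1 + δ ^ 2) * ∫⁻ x in Ω, ENNReal.ofReal (‖u x‖ ^ 2))) := by
  obtain ⟨c, hc⟩ := exists_lintegral_inclusions_le hω
  obtain ⟨q, hq⟩ : ∃ q : NNReal, q = Real.toNNReal (κ₂ / κ₁) := ⟨_, rfl⟩
  have hcancel : ∀ I J : ℝ≥0∞, ENNReal.ofReal κ₁ * I ≤ ENNReal.ofReal κ₂ * J → I ≤ q * J := by
    intro I J h
    have e : ENNReal.ofReal κ₂ = ENNReal.ofReal κ₁ * q := by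
      rw [hq, ← ENNReal.ofReal, ← ENNReal.ofReal_mul hκ₁.le, mul_div_cancel₀ _ hκ₁.ne']
    rw [e, mul_assoc] at h
    exact (ENNReal.mul_le_mul_iff_right (ENNReal.ofReal_pos.2 hκ₁).ne' ENNReal.ofReal_ne_top).1 h
  refine ⟨8 * (2 * (4 * q * d + q * (c * (8 * q * d + 2 * d + 1))) + 2 * d), ?_⟩
  intro Ω hΩ A hA δ hδ u G hu ζ η hζ hη hζ01 hη01 hζη b hb9 hζb hηb D hD hζD
  have hH := hu.memH1 hδ
  obtain ⟨U, hU⟩ : ∃ U, U = ∫⁻ x in Ω, ENNReal.ofReal (‖u x‖ ^ 2) := ⟨_, rfl⟩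
  obtain ⟨W, hW⟩ : ∃ W, W = b * (ENNReal.ofReal (1 + δ ^ 2) * U) := ⟨_, rfl⟩
  rw [← hU, ← hW]
  have hD1 : 1 ≤ ENNReal.ofReal (1 + δ ^ 2) :=
    ENNReal.one_le_ofReal.2 (le_add_of_nonneg_right (sq_nonneg δ))
  have hbU : b * U ≤ W := by
    rw [hW]; exact mul_le_mul' le_rfl (le_mul_of_one_le_left (zero_le) hD1)
  have hz : ∀ {χ : Rd d → ℝ}, IsTest Ω χ → ∀ x ∉ Ω, χ x = 0 ∧ fderiv ℝ χ x = 0 :=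
    fun hχ x hx => ⟨image_eq_zero_of_notMem_tsupport fun hx' => hx (hχ.2.2 hx'),
      image_eq_zero_of_notMem_tsupport fun hx' => hx (hχ.2.2 (tsupport_fderiv_subset ℝ hx'))⟩
  have hgrad : ∀ χ : Rd d → ℝ, (∀ x, ‖fderiv ℝ χ x‖ ^ 2 ≤ b) →
      ∫⁻ x in Ω, ENNReal.ofReal (normSq (gradTensor χ x (u x))) ≤ d * (b * U) := by
    intro χ hχb
    rw [hU, ← mul_assoc, ← lintegral_const_mul' _ _ (by finiteness)]
    refine lintegral_mono fun x => ?_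
    have e : (d : ℝ≥0∞) * b * ENNReal.ofReal (‖u x‖ ^ 2) =
        ENNReal.ofReal (d * b * ‖u x‖ ^ 2) := by
      rw [ENNReal.ofReal_mul (by positivity), ENNReal.ofReal_mul (by positivity)]
      simp
    rw [e]
    refine ENNReal.ofReal_le_ofReal ((normSq_gradTensor_le χ x (u x)).trans ?_)
    have := hχb x
    gcongr
  have hmat : ∀ χ : Rd d → ℝ, IsTest Ω χ → (∀ x, ‖fderiv ℝ χ x‖ ^ 2 ≤ b) →
      ∫⁻ x in Ω ∩ ω, ENNReal.ofReal (symSq (χ x • G x)) ≤ 4 * q * d * W := by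
    intro χ hχ hχb
    have h1 := hcancel _ _ (hu.lintegral_matrix_le hω hΩ hκ₁.le hκ₂.le hA hδ hχ)
    have h2 : ∫⁻ x in Ω, ENNReal.ofReal (4 * normSq (gradTensor χ x (u x))) ≤
        4 * (d * (b * U)) := by
      refine le_trans (le_of_eq ?_) (mul_le_mul' le_rfl (hgrad χ hχb))
      rw [← lintegral_const_mul' _ _ (by simp)]
      refine lintegral_congr fun x => ?_
      rw [ENNReal.ofReal_mul (by norm_num), ENNReal.ofReal_ofNat]
    calc _ ≤ _ := h1
      _ ≤ q * (ENNReal.ofReal (1 + δ ^ 2) * (4 * (d * (b * U)))) :=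
          mul_le_mul' le_rfl (mul_le_mul' le_rfl h2)
      _ = _ := by rw [hW]; ring
  have hsplit : ∀ (χ : Rd d → ℝ), IsTest Ω χ → (∀ x, ‖fderiv ℝ χ x‖ ^ 2 ≤ b) →
      ∀ S : Set (Rd d), ∫⁻ x in S, ENNReal.ofReal (symSq (χ x • G x + gradTensor χ x (u x))) ≤
        2 * (∫⁻ x in Ω ∩ S, ENNReal.ofReal (symSq (χ x • G x))) + 2 * (d * W) := by
    intro χ hχ hχb S
    have hr : volume.restrict (Ω ∩ S) ≤ volume.restrict Ω :=
      Measure.restrict_mono Set.inter_subset_left le_rfl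
    have h1 := lintegral_symSq_le_two_mul (μ := volume.restrict (Ω ∩ S))
      (X := fun x => χ x • G x) (Y := fun x => χ x • G x + gradTensor χ x (u x))
      (fun i α => (hH.sqIntegrable_smul hχ i α).mono_measure hr)
    simp only [add_sub_cancel_left] at h1
    refine (setLIntegral_le_inter hΩ.measurableSet fun x hx => ?_).trans
      (h1.trans (add_le_add le_rfl (mul_le_mul' le_rfl ?_)))
    · rw [(hz hχ x hx).1, gradTensor_zero_left (hz hχ x hx).2]
      simp [symSq]
    · exact (lintegral_mono_set Set.inter_subset_left).trans
        ((hgrad χ hχb).trans (mul_le_mul' le_rfl hbU))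
  have hS : ∫⁻ x in ω, ENNReal.ofReal (symSq (η x • G x + gradTensor η x (u x))) ≤
      (8 * q * d + 2 * d) * W := by
    calc _ ≤ _ := hsplit η hη hηb ω
      _ ≤ 2 * (4 * q * d * W) + 2 * (d * W) :=
          add_le_add (mul_le_mul' le_rfl (hmat η hη hηb)) le_rfl
      _ = _ := by ring
  have hf : ∫⁻ x, ENNReal.ofReal (‖η x • u x‖ ^ 2) ≤ U := by
    refine (lintegral_le_setLIntegral hΩ.measurableSet fun x hx => ?_).trans ?_
    · rw [(hz hη x hx).1]; simp
    · rw [hU]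
      refine lintegral_mono fun x => ENNReal.ofReal_le_ofReal ?_
      rw [norm_smul, mul_pow, Real.norm_of_nonneg (hη01 x).1]
      exact mul_le_of_le_one_left (sq_nonneg _) (pow_le_one₀ (hη01 x).1 (hη01 x).2)
  -- The comparison field is `ηu`. Where `ζ ≠ 0` the outer cutoff is 1 with vanishing gradient, so
  -- the gradient of `ηu` is `G` there. Its strain in `ω` is already bounded by the matrix estimate
  -- for `η`.
  have hincl : ∫⁻ x in Ω ∩ ⋃ l, F l, ENNReal.ofReal (symSq (ζ x • G x)) ≤
      q * (c * (8 * q * d + 2 * d + 1)) * W := by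
    have h1 := hcancel _ _ (hc Ω hΩ κ₁ κ₂ hκ₁.le hκ₂.le A hA δ hδ u G hu ζ hζ hζ01 b hb9 hζb _ _
      (tsupport η) (hH.smul_isTest hΩ.measurableSet hη) hη.2.1 hη.2.2
      (fun x hx => by rw [image_eq_zero_of_notMem_tsupport hx, zero_smul]) (fun x => by
        by_cases hx : ζ x = 0
        · rw [hx, zero_smul, zero_smul]
        · rw [hζη x hx, gradTensor_zero_left (fderiv_eq_zero_of_eq_one hη01 (hζη x hx)),
            one_smul, add_zero]))
    calc _ ≤ _ := h1
      _ ≤ q * (c * ((8 * q * d + 2 * d) * W + W)) :=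
          mul_le_mul' le_rfl (mul_le_mul' le_rfl (add_le_add hS
            ((mul_le_mul' le_rfl hf).trans hbU)))
      _ = _ := by ring
  have hall : ∫⁻ x in Ω, ENNReal.ofReal (symSq (ζ x • G x)) ≤
      4 * q * d * W + q * (c * (8 * q * d + 2 * d + 1)) * W := by
    have hsub : Ω ⊆ ((Ω ∩ ω) ∪ (Ω ∩ ⋃ l, F l)) ∪ (ωᶜ \ ⋃ l, F l) := fun x hx => by
      by_cases h1 : x ∈ ω
      · exact Or.inl (Or.inl ⟨hx, h1⟩)
      · by_cases h2 : x ∈ ⋃ l, F l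
        · exact Or.inl (Or.inr ⟨hx, h2⟩)
        · exact Or.inr ⟨h1, h2⟩
    refine (lintegral_mono_set hsub).trans ((lintegral_union_le _ _ _).trans ?_)
    -- The boundaries of the inclusions belong neither to `ω` nor to the open inclusions, but form a
    -- null set.
    rw [setLIntegral_measure_zero _ _ hω.volume_compl_diff, add_zero]
    exact (lintegral_union_le _ _ _).trans (add_le_add (hmat ζ hζ hζb) hincl)
  have hζglob := hH.smul_isTest hΩ.measurableSet hζ
  calc ∫⁻ x in D, ENNReal.ofReal (normSq (G x))
      = ∫⁻ x in D, ENNReal.ofReal (normSq (ζ x • G x + gradTensor ζ x (u x))) := by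
        refine setLIntegral_congr_fun hD fun x hx => ?_
        simp only [hζD x hx, gradTensor_zero_left (fderiv_eq_zero_of_eq_one hζ01 (hζD x hx)),
          one_smul, add_zero]
    _ ≤ ∫⁻ x, ENNReal.ofReal (normSq (ζ x • G x + gradTensor ζ x (u x))) :=
        setLIntegral_le_lintegral _ _
    _ ≤ 8 * ∫⁻ x, ENNReal.ofReal (symSq (ζ x • G x + gradTensor ζ x (u x))) :=
        hζglob.lintegral_normSq_le hζ.2.1 fun x hx => by
          rw [image_eq_zero_of_notMem_tsupport hx, zero_smul]
    _ ≤ 8 * (2 * (4 * q * d * W + q * (c * (8 * q * d + 2 * d + 1)) * W) + 2 * (d * W)) := by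
        refine mul_le_mul' le_rfl ?_
        have h1 := hsplit ζ hζ hζb Set.univ
        rw [Measure.restrict_univ, Set.inter_univ] at h1
        exact h1.trans (add_le_add (mul_le_mul' le_rfl hall) le_rfl)
    _ = _ := by push_cast; ring

/-! ### Cutoff functions for cubes -/

/-- `WithLp.ofLp x` carries the sup norm, so concentric cubes are sublevel sets of a function that
is 1-Lipschitz for the Euclidean distance, as the cutoff construction requires. -/
lemma mem_cube_iff {R : ℝ} (hR : 0 < R) (x : Rd d) : x ∈ cube d R ↔ ‖WithLp.ofLp x‖ < R / 2 := by
  rw [pi_norm_lt_iff (half_pos hR)]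
  simp only [cube, Set.mem_ofPred_eq, Real.norm_eq_abs, abs_lt]

lemma lipschitzWith_norm_ofLp : LipschitzWith 1 fun x : Rd d => ‖WithLp.ofLp x‖ := by
  have h := lipschitzWith_one_norm.comp (PiLp.lipschitzWith_ofLp 2 fun _ : Fin d => ℝ)
  simpa [Function.comp_def] using h

lemma isOpen_cube {R : ℝ} (hR : 0 < R) : IsOpen (cube d R) := by
  have : cube d R = {x | ‖WithLp.ofLp x‖ < R / 2} := Set.ext (mem_cube_iff hR)
  rw [this]
  exact isOpen_lt lipschitzWith_norm_ofLp.continuous continuous_const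

/-- Smooth cutoff functions between concentric cubes. -/
lemma exists_cube_cutoff {R s t : ℝ} (hst : s < t) (htR : t < R / 2) (hR : 0 < R) :
    ∃ χ : Rd d → ℝ, IsTest (cube d R) χ ∧ (∀ x, 0 ≤ χ x ∧ χ x ≤ 1) ∧
      (∀ x, t ≤ ‖WithLp.ofLp x‖ → χ x = 0) ∧ (∀ x, ‖WithLp.ofLp x‖ ≤ s → χ x = 1) ∧
      ∀ x, ‖fderiv ℝ χ x‖ ≤ 2 / (t - s) := by
  obtain ⟨χ, hχ, h01, h0, h1, hd⟩ := exists_smooth_cutoff (lipschitzWith_norm_ofLp (d := d)).neg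
    (neg_lt_neg hst)
  have hsupp : tsupport χ ⊆ {x | ‖WithLp.ofLp x‖ ≤ t} := by
    refine closure_minimal (fun x hx => ?_)
      (isClosed_le lipschitzWith_norm_ofLp.continuous continuous_const)
    by_contra hn
    exact hx (h0 x (neg_le_neg (not_le.1 hn).le))
  have hcomp : IsCompact {x : Rd d | ‖WithLp.ofLp x‖ ≤ t} := by
    have h := (isCompact_closedBall (0 : Fin d → ℝ) t).image
      (PiLp.continuous_toLp 2 fun _ : Fin d => ℝ)
    convert h using 1
    ext x
    simp only [Set.mem_ofPred_eq, Set.mem_image, mem_closedBall_zero_iff]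
    exact ⟨fun hx => ⟨WithLp.ofLp x, hx, rfl⟩, fun ⟨y, hy, hyx⟩ => hyx ▸ hy⟩
  refine ⟨χ, ⟨hχ, hcomp.of_isClosed_subset (isClosed_tsupport _) hsupp, fun x hx => ?_⟩, h01,
    fun x hx => h0 x (neg_le_neg hx), fun x hx => h1 x (neg_le_neg hx), fun x => ?_⟩
  · rw [mem_cube_iff hR]
    exact (hsupp hx : ‖WithLp.ofLp x‖ ≤ t).trans_lt htR
  · have := hd x
    rwa [NNReal.coe_one, mul_one, neg_sub_neg] at this

end HighContrast

/-! ### The theorem on concentric cubes -/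

theorem theorem2p5 {d : ℕ} {ι : Type*} (ω : Set (Rd d)) (F : ι → Set (Rd d))
    (hω : IsPeriodicMatrix ω F) (κ₁ κ₂ : ℝ) (hκ₁ : 0 < κ₁) (hκ₂ : 0 < κ₂) :
    ∃ C : ℝ, 0 < C ∧
      ∀ A : Tensor d, IsElasticityTensor κ₁ κ₂ A →
      ∀ δ : ℝ, 0 ≤ δ → ∀ R : ℝ, 4 ≤ R →
      ∀ (u : Rd d → Rd d) (G : MatrixField d), IsWeakSolution ω F A δ (cube d (2 * R)) u G →
        ∫ x in cube d R, normSq (G x) ≤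
          C * (1 + δ ^ 2) / R ^ 2 * ∫ x in cube d (2 * R), ‖u x‖ ^ 2 := by
  obtain ⟨C, hC⟩ := IsWeakSolution.exists_lintegral_normSq_le hω hκ₁ hκ₂
  -- 144 is the square of the numerator in the cutoff slope `12 / R`; the `+ 1` makes the constant
  -- positive even if `C = 0`.
  refine ⟨144 * C + 1, by positivity, fun A hA δ hδ R hR u G hu => ?_⟩
  have hR0 : 0 < R := by linarith
  have hH := hu.memH1 hδ
  -- In the sup norm the inner cube has radius `R / 2` and the outer one `R`. The cutoffs drop
  -- between `R / 2` and `2R / 3` and between `2R / 3` and `5R / 6`: gaps of `R / 6`, hence slopes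
  -- `12 / R`, and `η = 1` wherever `ζ ≠ 0`.
  obtain ⟨ζ, hζ, hζ01, hζ0, hζ1, hζd⟩ := exists_cube_cutoff (d := d) (R := 2 * R)
    (show R / 2 < 2 * R / 3 by linarith) (by linarith) (by linarith)
  obtain ⟨η, hη, hη01, -, hη1, hηd⟩ := exists_cube_cutoff (d := d) (R := 2 * R)
    (show 2 * R / 3 < 5 * R / 6 by linarith) (by linarith) (by linarith)
  have e1 : 2 / (2 * R / 3 - R / 2) = 12 / R := by field_simp; norm_num
  have e2 : 2 / (5 * R / 6 - 2 * R / 3) = 12 / R := by field_simp; norm_num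
  rw [e1] at hζd
  rw [e2] at hηd
  have hb : (Real.toNNReal ((12 / R) ^ 2) : ℝ) = (12 / R) ^ 2 :=
    Real.coe_toNNReal _ (sq_nonneg _)
  -- Here `4 ≤ R` bounds the slope by 3, at the scale of the period, so the constants of the
  -- extension need no dependence on `R`.
  have hb9 : Real.toNNReal ((12 / R) ^ 2) ≤ 9 := by
    rw [← NNReal.coe_le_coe, hb]
    have h3 : 12 / R ≤ 3 := by rw [div_le_iff₀ hR0]; linarith
    have h0 : 0 ≤ 12 / R := by positivity
    push_cast
    nlinarith
  have h1 := hC _ (isOpen_cube (by linarith)) A hA δ hδ u G hu ζ η hζ hη hζ01 hη01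
    (fun x hx => hη1 x (not_lt.1 fun hlt => hx (hζ0 x hlt.le))) _ hb9
    (fun x => by rw [hb]; exact pow_le_pow_left₀ (norm_nonneg _) (hζd x) 2)
    (fun x => by rw [hb]; exact pow_le_pow_left₀ (norm_nonneg _) (hηd x) 2)
    (cube d R) (isOpen_cube hR0).measurableSet
    (fun x hx => hζ1 x ((mem_cube_iff hR0 x).1 hx).le)
  have hsub : cube d R ⊆ cube d (2 * R) := fun x hx => by
    rw [mem_cube_iff hR0] at hx
    rw [mem_cube_iff (by linarith)]
    linarith
  have hGL : SqIntegrable (volume.restrict (cube d R)) G := fun i α =>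
    (hH.grad_memLp i α).mono_measure (Measure.restrict_mono hsub le_rfl)
  have hul : Integrable (fun x => ‖u x‖ ^ 2) (volume.restrict (cube d (2 * R))) :=
    hH.memLp.integrable_norm_pow two_ne_zero
  have hU0 : 0 ≤ ∫ x in cube d (2 * R), ‖u x‖ ^ 2 := integral_nonneg fun x => sq_nonneg _
  rw [← ofReal_integral_eq_lintegral_ofReal hGL.integrable_normSq
      (ae_of_all _ fun x => normSq_nonneg _),
    ← ofReal_integral_eq_lintegral_ofReal hul (ae_of_all _ fun x => sq_nonneg _),
    ← ENNReal.ofReal_coe_nnreal (p := C), ← ENNReal.ofReal_coe_nnreal (p := Real.toNNReal _), hb,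
    ← ENNReal.ofReal_mul (by positivity), ← ENNReal.ofReal_mul (by positivity),
    ← ENNReal.ofReal_mul (by positivity), ENNReal.ofReal_le_ofReal_iff (by positivity)] at h1
  refine h1.trans ?_
  calc _ = 144 * C * (1 + δ ^ 2) / R ^ 2 * ∫ x in cube d (2 * R), ‖u x‖ ^ 2 := by
        field_simp; ring
    _ ≤ _ := by
        gcongr
        linarith
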